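/- **Setting.** Let $v_F>0$, $\tilde a>0$, let $N$ be an odd positive integer and $L=N\tilde a$ (i.e. $L/\tilde a$ is an odd integer), and let $\gamma_1,\gamma_2\in\mathbb R$ satisfy $|\gamma_1|<1$ and $|\gamma_2|<|1+\gamma_1|$. Indices $r,s$ take the values $\pm$; vectors in $\mathbb R^2$ have components $u_+,u_-$, and ${\bf e}_\pm$ are the unit vectors. Put $$\Lambda_s^*=\{{\bf k}\in\tfrac{2\pi}{L}(\mathbb Z+\tfrac12)^2:\ -\tfrac{\pi}{\tilde a}\le k_{-s}<\tfrac{\pi}{\tilde a}\},\qquad \Lambda_{1D}=\{x\in\tilde a\mathbb Z:\ -\tfrac L2\le x<\tfrac L2\},$$ $$\hat\Lambda_s^*=\{{\bf p}\in\tfrac{2\pi}{L}\mathbb Z^2:\ -\tfrac{\pi}{\tilde a}\le p_{-s}<\tfrac{\pi}{\tilde a},\ p_s\ne0\}.$$ *Fermions.* Let $\mathcal F$ be the fermion Fock space of operators $c_{r,s,x}(k)$, $r,s=\pm$, $x\in\Lambda_{1D}$, $k\in\frac{2\pi}{L}(\mathbb Z+\frac12)$, that satisfy $\{c_A(k),c_B(q)^\dagger\}=\delta_{A,B}\delta_{k,q}$,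 $\{c_A(k),c_B(q)\}=0$, over the Dirac sea $\Omega$, a cyclic unit vector with $c_{r,s,x}(k)\Omega=0$ if $rk>0$ and $c_{r,s,x}(k)^\dagger\Omega=0$ if $rk<0$. The fermion field operators are $$\hat\psi_{r,s}({\bf k})=\frac{L}{2\pi}\sqrt{\frac{\tilde a}{L}}\sum_{x\in\Lambda_{1D}}c_{r,s,x}(k_s)\,e^{-ik_{-s}x},\qquad {\bf k}\in\Lambda_s^*;$$ they satisfy $\{\hat\psi_{r,s}({\bf k}),\hat\psi_{r',s'}({\bf k}')^\dagger\}=(\frac{L}{2\pi})^2\delta_{r,r'}\delta_{s,s'}\delta_{{\bf k},{\bf k}'}$, $\{\hat\psi_{r,s}({\bf k}),\hat\psi_{r',s'}({\bf k}')\}=0$, $\hat\psi_{r,s}({\bf k})\Omega=0$ if $rk_s>0$ and $\hat\psi_{r,s}({\bf k})^\dagger\Omega=0$ if $rk_s<0$. Normal ordering is $:\!\mathcal O\!:\,=\mathcal O-\langle\Omega,\mathcal O\Omega\rangle$. *Hamiltonian.* For ${\bf p}\in\frac{2\pi}{L}\mathbb Z^2$ the fermion densities are $$\hat J_{r,s}({\bf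 p})=\sum_{{\bf k}_1,{\bf k}_2\in\Lambda_s^*}\Bigl(\frac{2\pi}{L}\Bigr)^2:\!\hat\psi_{r,s}({\bf k}_1)^\dagger\hat\psi_{r,s}({\bf k}_2)\!:\sum_{n\in\mathbb Z}\delta_{{\bf k}_1+{\bf p},\,{\bf k}_2+2\pi n\tilde a^{-1}{\bf e}_{-s}} .$$ With $g_{r,s,r',s'}=\tilde a\pi v_F(\delta_{s,s'}\delta_{r,-r'}\gamma_1+\delta_{s,-s'}\gamma_2/2)$ and $\chi({\bf p})=1$ if $-\pi/\tilde a\le p_\pm<\pi/\tilde a$, $\chi({\bf p})=0$ otherwise, the regularized Mattis Hamiltonian is $H=H_0+H_1$, where $$H_0=v_F\sum_{r,s=\pm}\sum_{{\bf k}\in\Lambda_s^*}\Bigl(\frac{2\pi}{L}\Bigr)^2rk_s:\!\hat\psi_{r,s}({\bf k})^\dagger\hat\psi_{r,s}({\bf k})\!:,$$ $$H_1=\sum_{r,r',s,s'=\pm}\ \sum_{{\bf p}\in\frac{2\pi}{L}\mathbb Z^2}\frac1{L^2}\,g_{r,s,r',s'}\,\chi({\bf p})\,\hat J_{r,s}(-{\bf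 p})\hat J_{r',s'}({\bf p}).$$ Infinite sums of operators are defined on the vectors on which they converge unconditionally, and products of unbounded operators on their natural domains. *Bosons, Klein factors and the domain.* For ${\bf p}\in\hat\Lambda_s^*$ let $b_s({\bf p})=-\frac iL\sqrt{2\pi\tilde a/|p_s|}\,\hat J_{+,s}({\bf p})$ if $p_s>0$ and $b_s({\bf p})=\frac iL\sqrt{2\pi\tilde a/|p_s|}\,\hat J_{-,s}({\bf p})$ if $p_s<0$, and let $b_s^\dagger({\bf p})$ be the adjoint of $b_s({\bf p})$. The Klein factor $R_A$, $A=(r,s,x)$ with $x\in\Lambda_{1D}$, is the unitary operator on $\mathcal F$ determined by $R_Ac_A(k)=c_A(k+\frac{2\pi}{L})R_A$, $R_Ac_B(k)=-c_B(k)R_A$ for $B\ne A$, and $R_A\Omega=c_A(\frac{\pi}{L})^\dagger\Omega$ if $r=+$, $R_A\Omega=c_A(\frac{\pi}{L})\Omega$ if $r=-$. Let $\mathcal D$ be the space of all finite linear combinations of the vectors $$\eta_{{\bf n},\boldsymbol\nu}=\Bigl(\prod_{s=\pm}\prod_{{\bf p}\in\hat\Lambda_s^*}\frac{b_s^\dagger({\bf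 p})^{n_s({\bf p})}}{\sqrt{n_s({\bf p})!}}\Bigr)\Bigl(\prod_{r,s=\pm}\prod_{x\in\Lambda_{1D}}R_{r,s,x}^{\,\nu_{r,s}(x)}\Bigr)\Omega,$$ where the $\nu_{r,s}(x)$ are integers and the $n_s({\bf p})$ are nonnegative integers of which only finitely many are nonzero (the Klein factors are multiplied in any fixed order; changing it only changes signs). **Corollary.** The regularized Mattis Hamiltonian $H$ is essentially self-adjoint on $\mathcal D$: the subspace $\mathcal D$ is dense in $\mathcal F$ and contained in the domain of $H$, the restriction $H|_{\mathcal D}$ is symmetric, and its closure is self-adjoint. -/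

import Mathlib

open scoped InnerProductSpace lp

/-! ### Unbounded operators on a Hilbert space -/

namespace Mattis

section Operators

variable {F : Type*} [NormedAddCommGroup F] [InnerProductSpace ℂ F]

/-- A bounded operator, regarded as an everywhere defined partial operator. -/
noncomputable def ofBounded (T : F →L[ℂ] F) : F →ₗ.[ℂ] F :=
  (T : F →ₗ[ℂ] F).toPMap ⊤

/-- The (possibly infinite) sum of a family of partially defined operators, on its natural domain:
the vectors that lie in all domains and for which the series converges unconditionally. -/
noncomputable def opSum {ι : Type*} (T : ι → F →ₗ.[ℂ] F) : F →ₗ.[ℂ] F where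
  domain :=
    { carrier := {v | ∃ h : ∀ i, v ∈ (T i).domain, Summable fun i => T i ⟨v, h i⟩}
      zero_mem' := by
        refine ⟨fun i => (T i).domain.zero_mem, ?_⟩
        have h0 : (fun i => T i ⟨0, (T i).domain.zero_mem⟩) = fun _ => (0 : F) :=
          funext fun i => (T i).map_zero
        rw [h0]
        exact summable_zero
      add_mem' := by
        rintro v w ⟨hv, sv⟩ ⟨hw, sw⟩
        refine ⟨fun i => (T i).domain.add_mem (hv i) (hw i), ?_⟩
        have h0 : (fun i => T i ⟨v + w, (T i).domain.add_mem (hv i) (hw i)⟩)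
            = fun i => T i ⟨v, hv i⟩ + T i ⟨w, hw i⟩ :=
          funext fun i => (T i).map_add ⟨v, hv i⟩ ⟨w, hw i⟩
        rw [h0]
        exact sv.add sw
      smul_mem' := by
        rintro c v ⟨hv, sv⟩
        refine ⟨fun i => (T i).domain.smul_mem c (hv i), ?_⟩
        have h0 : (fun i => T i ⟨c • v, (T i).domain.smul_mem c (hv i)⟩)
            = fun i => c • T i ⟨v, hv i⟩ :=
          funext fun i => (T i).map_smul c ⟨v, hv i⟩
        rw [h0]
        exact sv.const_smul c }
  toFun :=
    { toFun := fun v => ∑' i, T i ⟨v.1, v.2.choose i⟩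
      map_add' := fun v w => by
        rw [← v.2.choose_spec.tsum_add w.2.choose_spec]
        exact tsum_congr fun i =>
          (T i).map_add ⟨v.1, v.2.choose i⟩ ⟨w.1, w.2.choose i⟩
      map_smul' := fun c v => by
        rw [RingHom.id_apply, ← v.2.choose_spec.tsum_const_smul c]
        exact tsum_congr fun i => (T i).map_smul c ⟨v.1, v.2.choose i⟩ }

/-- The product `S T` of two partially defined operators, with its natural domain
`{v ∈ dom T | T v ∈ dom S}`. -/
noncomputable def opComp (S T : F →ₗ.[ℂ] F) : F →ₗ.[ℂ] F where
  domain :=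
    { carrier := {v | ∃ h : v ∈ T.domain, T ⟨v, h⟩ ∈ S.domain}
      zero_mem' := ⟨T.domain.zero_mem, by
        have h0 : T ⟨0, T.domain.zero_mem⟩ = 0 := T.map_zero
        rw [h0]
        exact S.domain.zero_mem⟩
      add_mem' := by
        rintro v w ⟨hv, sv⟩ ⟨hw, sw⟩
        refine ⟨T.domain.add_mem hv hw, ?_⟩
        have h0 : T ⟨v + w, T.domain.add_mem hv hw⟩ = T ⟨v, hv⟩ + T ⟨w, hw⟩ :=
          T.map_add ⟨v, hv⟩ ⟨w, hw⟩
        rw [h0]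
        exact S.domain.add_mem sv sw
      smul_mem' := by
        rintro c v ⟨hv, sv⟩
        refine ⟨T.domain.smul_mem c hv, ?_⟩
        have h0 : T ⟨c • v, T.domain.smul_mem c hv⟩ = c • T ⟨v, hv⟩ := T.map_smul c ⟨v, hv⟩
        rw [h0]
        exact S.domain.smul_mem c sv }
  toFun :=
    { toFun := fun v => S ⟨T ⟨v.1, v.2.choose⟩, v.2.choose_spec⟩
      map_add' := fun v w => by
        rw [← S.map_add]
        congr 1
        exact Subtype.ext (T.map_add ⟨v.1, v.2.choose⟩ ⟨w.1, w.2.choose⟩)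
      map_smul' := fun c v => by
        rw [RingHom.id_apply, ← S.map_smul]
        congr 1
        exact Subtype.ext (T.map_smul c ⟨v.1, v.2.choose⟩) }

open Classical in
/-- The value `T v` of a partially defined operator (`0` if `v` is not in its domain). -/
noncomputable def opApply (T : F →ₗ.[ℂ] F) (v : F) : F :=
  if h : v ∈ T.domain then T ⟨v, h⟩ else 0

/-- `A` is essentially self-adjoint on the subspace `D`: `D` is dense, it is contained in the
domain of `A`, the restriction of `A` to `D` is symmetric, and the closure of this restriction
is self-adjoint. -/
def IsEssentiallySelfAdjointOn [CompleteSpace F] (A : F →ₗ.[ℂ] F) (D : Submodule ℂ F) : Prop :=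
  Dense (D : Set F) ∧ D ≤ A.domain ∧
    (A.domRestrict D).IsFormalAdjoint (A.domRestrict D) ∧
    IsSelfAdjoint (A.domRestrict D).closure

end Operators

/-! ### Two bounded operators on `ℓ²` -/

/-- The signed permutation operator on `ℓ²(ι)`: it maps the basis vector `e i` to
`ε i • e (σ i)`. -/
noncomputable def signedPerm {ι : Type*} (σ : Equiv.Perm ι) (ε : ι → ℤˣ) :
    ℓ²(ι, ℂ) ≃ₗᵢ[ℂ] ℓ²(ι, ℂ) where
  toFun f := ⟨fun i => ((ε (σ.symm i) : ℤ) : ℂ) * f (σ.symm i), by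
    have h := (lp.memℓp f).summable (by norm_num)
    refine memℓp_gen ?_
    refine ((σ.symm.summable_iff).2 h).congr fun i => ?_
    rcases Int.units_eq_one_or (ε (σ.symm i)) with h | h <;> simp [h]⟩
  invFun f := ⟨fun i => ((ε i : ℤ) : ℂ) * f (σ i), by
    have h := (lp.memℓp f).summable (by norm_num)
    refine memℓp_gen ?_
    refine ((σ.summable_iff).2 h).congr fun i => ?_
    rcases Int.units_eq_one_or (ε i) with h | h <;> simp [h]⟩
  map_add' f g := by
    ext i
    exact mul_add _ _ _
  map_smul' c f := by
    ext i
    exact mul_left_comm _ _ _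
  left_inv f := by
    ext i
    rcases Int.units_eq_one_or (ε i) with h | h <;> simp [h]
  right_inv f := by
    ext i
    rcases Int.units_eq_one_or (ε (σ.symm i)) with h | h <;> simp [h]
  norm_map' f := by
    rw [lp.norm_eq_tsum_rpow (by norm_num), lp.norm_eq_tsum_rpow (by norm_num)]
    congr 1
    rw [← σ.symm.tsum_eq (fun i => ‖f i‖ ^ (2 : ENNReal).toReal)]
    refine tsum_congr fun i => ?_
    rcases Int.units_eq_one_or (ε (σ.symm i)) with h | h <;> simp [h]

/-- The Jordan-Wigner sign `(-1) ^ #{m' ∈ S | m' < m}`. -/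
def jwSign {M : Type*} [LinearOrder M] (m : M) (S : Finset M) : ℤˣ :=
  (-1) ^ (S.filter (· < m)).card

/-- The annihilation operator of the mode `m` on the fermion Fock space `ℓ²(Finset M)`, whose
basis vector `e S` with `S = {m₁ < ⋯ < mⱼ}` is `a†(m₁) ⋯ a†(mⱼ) e ∅`. It maps `e (S ∪ {m})` to
`(-1) ^ #{m' ∈ S | m' < m} • e S` if `m ∉ S`, and it maps `e S` to `0` if `m ∉ S`. -/
noncomputable def annihilate {M : Type*} [LinearOrder M] (m : M) :
    ℓ²(Finset M, ℂ) →L[ℂ] ℓ²(Finset M, ℂ) :=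
  have key : ∀ f : ℓ²(Finset M, ℂ), ∀ S : Finset M,
      ‖(if m ∈ S then (0 : ℂ) else ((jwSign m S : ℤ) : ℂ) * f (insert m S))‖
          ^ (2 : ENNReal).toReal
        = Set.indicator {S : Finset M | m ∉ S}
            (fun S => ‖f (insert m S)‖ ^ (2 : ENNReal).toReal) S := by
    intro f S
    by_cases hS : m ∈ S
    · simp [hS]
    · rcases Int.units_eq_one_or (jwSign m S) with h | h <;> simp [hS, h]
  have inj : Function.Injective
      (fun S : {S : Finset M | m ∉ S} => insert m (S : Finset M)) := by
    rintro ⟨S, hS⟩ ⟨T, hT⟩ h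
    have h2 := congrArg (fun U => Finset.erase U m) h
    simpa [Finset.erase_insert hS, Finset.erase_insert hT] using h2
  have summ : ∀ f : ℓ²(Finset M, ℂ),
      Summable (fun S => ‖f S‖ ^ (2 : ENNReal).toReal) := fun f =>
    (lp.memℓp f).summable (by norm_num)
  LinearMap.mkContinuous
    { toFun := fun f =>
        ⟨fun S => if m ∈ S then 0 else ((jwSign m S : ℤ) : ℂ) * f (insert m S), by
          refine memℓp_gen ?_
          simp_rw [key f]
          exact summable_subtype_iff_indicator.1 ((summ f).comp_injective inj)⟩
      map_add' := fun f g => by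
        ext S
        change (if m ∈ S then (0 : ℂ) else ((jwSign m S : ℤ) : ℂ) * (f + g) (insert m S))
          = (if m ∈ S then 0 else ((jwSign m S : ℤ) : ℂ) * f (insert m S))
            + (if m ∈ S then 0 else ((jwSign m S : ℤ) : ℂ) * g (insert m S))
        by_cases hS : m ∈ S <;> simp [hS, mul_add]
      map_smul' := fun c f => by
        ext S
        by_cases hS : m ∈ S <;> simp [hS, mul_left_comm] }
    1 (fun f => by
      rw [one_mul, lp.norm_eq_tsum_rpow (by norm_num), lp.norm_eq_tsum_rpow (by norm_num)]
      refine Real.rpow_le_rpow (tsum_nonneg fun S => by positivity) ?_ (by norm_num)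
      refine (tsum_congr (key f)).trans_le ?_
      rw [← tsum_subtype]
      exact tsum_comp_le_tsum_of_inj (summ f) (fun S => by positivity) inj)

/-! ### The fermion Fock space

The parameters are `a > 0` and an odd natural number `N`; the box length is `L = N a`. Signs
`r, s = ±` are elements of `ℤˣ`, a vector with components `u_±` is a function on `ℤˣ`.
All momenta and positions are labelled by integers. -/

/-- The box length `L`. -/
noncomputable def boxLength (a : ℝ) (N : ℕ) : ℝ := N * a

/-- Labels of the one-dimensional lattice `Λ_1D = {x ∈ a ℤ | -L/2 ≤ x < L/2}`; the label `j`
stands for `x = a j`. -/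
abbrev Pos (N : ℕ) : Type := {j : ℤ // -(N : ℤ) ≤ 2 * j ∧ 2 * j < N}

noncomputable instance (N : ℕ) : Fintype (Pos N) :=
  Set.Finite.fintype ((Set.finite_Icc (-(N : ℤ)) N).subset fun j hj => by
    obtain ⟨h1, h2⟩ := hj
    exact ⟨by omega, by omega⟩)

/-- The species `(r, s, x)` of one-dimensional fermions, with `r, s = ±` and `x ∈ Λ_1D`
(in lexicographic order). -/
abbrev Species (N : ℕ) : Type := ℤˣ ×ₗ ℤˣ ×ₗ Pos N

/-- The species `(r, s, x)`. -/
def species {N : ℕ} (r s : ℤˣ) (x : Pos N) : Species N := toLex (r, toLex (s, x))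

/-- The one-particle modes `(A, n)`: species `A` and momentum `k = (2π/L)(n + 1/2)`
(in lexicographic order). -/
abbrev Mode (N : ℕ) : Type := Species N ×ₗ ℤ

/-- The mode `(A, n)`. -/
def mode {N : ℕ} (A : Species N) (n : ℤ) : Mode N := toLex (A, n)

/-- The fermion Fock space over the Dirac sea. Its orthonormal basis is labelled by the finite
sets of excited modes: occupied modes with `r k > 0` and empty modes with `r k < 0`. -/
abbrev Fock (N : ℕ) : Type := ℓ²(Finset (Mode N), ℂ)

/-- The Dirac sea `Ω`. -/
noncomputable def vacuum (N : ℕ) : Fock N := lp.single 2 (∅ : Finset (Mode N)) (1 : ℂ)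

/-- The fermion operators `c_{r,s,x}(k)` with `k = (2π/L)(n + 1/2)`, normalized by
`{c_A(k), c_B(q)†} = δ_{A,B} δ_{k,q}`: if `r k > 0` then `c_{r,s,x}(k)` annihilates an excitation
(a particle), and if `r k < 0` it creates one (a hole). -/
noncomputable def fermionC {N : ℕ} (r s : ℤˣ) (x : Pos N) (n : ℤ) : Fock N →L[ℂ] Fock N :=
  if 0 < (r : ℤ) * (2 * n + 1) then annihilate (mode (species r s x) n)
  else ContinuousLinearMap.adjoint (annihilate (mode (species r s x) n))

/-- Labels of `Λ_s^* = {k ∈ (2π/L)(ℤ + 1/2)² | -π/a ≤ k_{-s} < π/a}`; the label `κ` stands for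
the vector with components `k_± = (2π/L)(κ_± + 1/2)`. -/
abbrev FermiMomentum (N : ℕ) (s : ℤˣ) : Type :=
  {κ : ℤˣ → ℤ // -(N : ℤ) ≤ 2 * κ (-s) + 1 ∧ 2 * κ (-s) + 1 < N}

/-- The component `k_t` of `k ∈ Λ_s^*`. -/
noncomputable def fermiComp (a : ℝ) {N : ℕ} {s : ℤˣ} (k : FermiMomentum N s) (t : ℤˣ) : ℝ :=
  2 * Real.pi / boxLength a N * ((k.1 t : ℝ) + 1 / 2)

/-- The fermion field operators
`ψ_{r,s}(k) = (L/2π) √(a/L) ∑_x c_{r,s,x}(k_s) exp(-i k_{-s} x)`, `k ∈ Λ_s^*`. They satisfy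
`{ψ_{r,s}(k), ψ_{r',s'}(q)†} = (L/2π)² δ_{r,r'} δ_{s,s'} δ_{k,q}` and
`ψ_{r,s}(k) Ω = 0` if `r k_s > 0`, `ψ_{r,s}(k)† Ω = 0` if `r k_s < 0`. -/
noncomputable def psi (a : ℝ) {N : ℕ} (r s : ℤˣ) (k : FermiMomentum N s) : Fock N →L[ℂ] Fock N :=
  ((boxLength a N / (2 * Real.pi) * √(a / boxLength a N) : ℝ) : ℂ) •
    ∑ x : Pos N,
      Complex.exp (-Complex.I * ((fermiComp a k (-s) * (a * (x.1 : ℝ)) : ℝ) : ℂ)) •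
        fermionC r s x (k.1 s)

/-- The normal ordered bilinear `:ψ_{r,s}(k₁)† ψ_{r,s}(k₂):`, where `:O: = O - ⟨Ω, O Ω⟩`. -/
noncomputable def bilinear (a : ℝ) {N : ℕ} (r s : ℤˣ) (k₁ k₂ : FermiMomentum N s) :
    Fock N →L[ℂ] Fock N :=
  let O := ContinuousLinearMap.adjoint (psi a r s k₁) ∘L psi a r s k₂
  O - ⟪vacuum N, O (vacuum N)⟫_ℂ • ContinuousLinearMap.id ℂ (Fock N)

/-! ### Densities and the Hamiltonian -/

open Classical in
/-- The fermion densities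
`J_{r,s}(p) = ∑_{k₁, k₂ ∈ Λ_s^*} (2π/L)² :ψ_{r,s}(k₁)† ψ_{r,s}(k₂): ∑_n δ_{k₁ + p, k₂ + (2πn/a) e_{-s}}`
for the momentum `(2π/L) p` with `p ∈ ℤ²` (note `2π/a = (2π/L) N`; as `N ≠ 0`, at most one
integer `n` contributes). -/
noncomputable def density (a : ℝ) {N : ℕ} (r s : ℤˣ) (p : ℤˣ → ℤ) : Fock N →ₗ.[ℂ] Fock N :=
  opSum fun k : FermiMomentum N s × FermiMomentum N s =>
    ofBounded
      (if ∃ n : ℤ, ∀ t : ℤˣ, k.1.1 t + p t = k.2.1 t + (if t = -s then N * n else 0) then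
        (((2 * Real.pi / boxLength a N) ^ 2 : ℝ) : ℂ) • bilinear a r s k.1 k.2
      else 0)

/-- The free Hamiltonian `H₀ = v ∑_{r,s} ∑_{k ∈ Λ_s^*} (2π/L)² r k_s :ψ_{r,s}(k)† ψ_{r,s}(k):`. -/
noncomputable def freeHamiltonian (v a : ℝ) (N : ℕ) : Fock N →ₗ.[ℂ] Fock N :=
  (v : ℂ) • opSum fun i : (Σ rs : ℤˣ × ℤˣ, FermiMomentum N rs.2) =>
    ofBounded
      ((((2 * Real.pi / boxLength a N) ^ 2 * (((i.1.1 : ℤ) : ℝ) * fermiComp a i.2 i.1.2) : ℝ) : ℂ) •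
        bilinear a i.1.1 i.1.2 i.2 i.2)

/-- The coupling constants
`g_{r,s,r',s'} = π a v (δ_{s,s'} δ_{r,-r'} γ₁ + δ_{s,-s'} γ₂ / 2)`. -/
noncomputable def coupling (v a γ₁ γ₂ : ℝ) (r s r' s' : ℤˣ) : ℝ :=
  a * Real.pi * v *
    ((if s = s' ∧ r = -r' then γ₁ else 0) + (if s = -s' then γ₂ / 2 else 0))

/-- The cutoff function: `χ(p) = 1` if `-π/a ≤ p_± < π/a`, and `χ(p) = 0` otherwise, at the
momentum `(2π/L) p` with `p ∈ ℤ²`. -/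
def cutoff (N : ℕ) (p : ℤˣ → ℤ) : ℝ :=
  if ∀ t : ℤˣ, -(N : ℤ) ≤ 2 * p t ∧ 2 * p t < N then 1 else 0

/-- The interaction
`H₁ = ∑_{r,s,r',s'} ∑_p (1/L)² g_{r,s,r',s'} χ(p) J_{r,s}(-p) J_{r',s'}(p)`. -/
noncomputable def interaction (v a γ₁ γ₂ : ℝ) (N : ℕ) : Fock N →ₗ.[ℂ] Fock N :=
  opSum fun i : (ℤˣ × ℤˣ × ℤˣ × ℤˣ) × (ℤˣ → ℤ) =>
    let r := i.1.1
    let s := i.1.2.1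
    let r' := i.1.2.2.1
    let s' := i.1.2.2.2
    (((1 / boxLength a N) ^ 2 * coupling v a γ₁ γ₂ r s r' s' * cutoff N i.2 : ℝ) : ℂ) •
      opComp (density a r s (-i.2)) (density a r' s' i.2)

/-- The regularized Mattis Hamiltonian `H = H₀ + H₁`. -/
noncomputable def hamiltonian (v a γ₁ γ₂ : ℝ) (N : ℕ) : Fock N →ₗ.[ℂ] Fock N :=
  freeHamiltonian v a N + interaction v a γ₁ γ₂ N

/-! ### Bosons, Klein factors and the domain -/

/-- Labels `(s, p)` of the boson modes: `s = ±`, `p ∈ (2π/L) ℤ²`, `-π/a ≤ p_{-s} < π/a` and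
`p_s ≠ 0`. -/
abbrev BosonMode (N : ℕ) : Type :=
  {q : ℤˣ × (ℤˣ → ℤ) // (-(N : ℤ) ≤ 2 * q.2 (-q.1) ∧ 2 * q.2 (-q.1) < N) ∧ q.2 q.1 ≠ 0}

/-- The boson annihilation operators: `b_s(p) = -(i/L) √(2πa/|p_s|) J_{+,s}(p)` if `p_s > 0`, and
`b_s(p) = (i/L) √(2πa/|p_s|) J_{-,s}(p)` if `p_s < 0`. -/
noncomputable def boson (a : ℝ) {N : ℕ} (q : BosonMode N) : Fock N →ₗ.[ℂ] Fock N :=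
  let s := q.1.1
  let p := q.1.2
  let c : ℂ := Complex.I / (boxLength a N : ℂ) *
    ((√(2 * Real.pi * a / |2 * Real.pi / boxLength a N * (p s : ℝ)|) : ℝ) : ℂ)
  if 0 < p s then (-c) • density a 1 s p else c • density a (-1) s p

/-- The boson creation operators, i.e. the adjoints of the annihilation operators. -/
noncomputable def bosonDag (a : ℝ) {N : ℕ} (q : BosonMode N) : Fock N →ₗ.[ℂ] Fock N :=
  (boson a q).adjoint

/-- The shift `(A, n) ↦ (A, n + 1)` of the modes of the species `A`; other modes are fixed. -/
def shiftMode {N : ℕ} (A : Species N) : Equiv.Perm (Mode N) where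
  toFun m := if (ofLex m).1 = A then mode A ((ofLex m).2 + 1) else m
  invFun m := if (ofLex m).1 = A then mode A ((ofLex m).2 - 1) else m
  left_inv m := by
    by_cases h : (ofLex m).1 = A
    · subst h
      simp [mode]
    · simp [h]
  right_inv m := by
    by_cases h : (ofLex m).1 = A
    · subst h
      simp [mode]
    · simp [h]

/-- The effect on the sets of excitations of shifting all fermions of the species `A` (including
those in the Dirac sea) from `n` to `n + 1`: the excitations are shifted, and the mode `(A, 0)`,
which is in the sea but not in the shifted sea, or conversely, changes its status. -/
def kleinPerm {N : ℕ} (A : Species N) : Equiv.Perm (Finset (Mode N)) where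
  toFun S := symmDiff (S.map (shiftMode A).toEmbedding) {mode A 0}
  invFun S := (symmDiff S {mode A 0}).map (shiftMode A).symm.toEmbedding
  left_inv S := by
    beta_reduce
    rw [symmDiff_symmDiff_cancel_right]
    ext m
    simp
  right_inv S := by
    have h : ((symmDiff S {mode A 0}).map (shiftMode A).symm.toEmbedding).map
        (shiftMode A).toEmbedding = symmDiff S {mode A 0} := by
      ext m
      simp
    beta_reduce
    rw [h, symmDiff_symmDiff_cancel_right]

/-- The sign that accompanies `kleinPerm`. -/
def kleinSign {N : ℕ} (A : Species N) (S : Finset (Mode N)) : ℤˣ :=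
  (-1) ^ ((S.filter fun m => (ofLex m).1 ≠ A).card + (S.filter fun m => mode A (-1) < m).card)

/-- The Klein factor `R_A` of the species `A = (r, s, x)`: the unitary operator with
`R_A c_A(k) = c_A(k + 2π/L) R_A`, `R_A c_B(k) = -c_B(k) R_A` for `B ≠ A`, and
`R_A Ω = c_A(π/L)† Ω` if `r = +`, `R_A Ω = c_A(π/L) Ω` if `r = -`. It raises the charge
`N_{r,s}(x)` by `r`, anticommutes with the other Klein factors and their adjoints, and commutes
with all bosons. -/
noncomputable def klein {N : ℕ} (A : Species N) : Fock N ≃ₗᵢ[ℂ] Fock N :=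
  signedPerm (kleinPerm A) (kleinSign A)

/-- The vector `(∏_A R_A ^ ν_A) Ω`. Different orders of the factors change the vector only by a
sign. -/
noncomputable def kleinState {N : ℕ} (ν : Species N → ℤ) : Fock N :=
  ((Finset.univ : Finset (ℤˣ × ℤˣ × Pos N)).toList.map
    fun i => klein (species i.1 i.2.1 i.2.2) ^ ν (species i.1 i.2.1 i.2.2)).prod (vacuum N)

/-- The basis vectors
`η_{n,ν} = (∏_{s,p} b_s(p)† ^ n_s(p) / √(n_s(p)!)) (∏_A R_A ^ ν_A) Ω`. The condition
`∑ |p_s| n_s(p) < ∞` says that only finitely many `n_s(p)` are nonzero, since `|p_s| ≥ 2π/L`;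
there are only finitely many species `A`. The creation operators commute, so that the order of the
factors does not matter. -/
noncomputable def basisState (a : ℝ) {N : ℕ} (n : BosonMode N →₀ ℕ) (ν : Species N → ℤ) : Fock N :=
  n.support.toList.foldr
    (fun q v => ((1 / √((n q).factorial : ℝ) : ℝ) : ℂ) • (opApply (bosonDag a q))^[n q] v)
    (kleinState ν)

/-- The domain `𝓓` of all finite linear combinations of the vectors `η_{n,ν}`. -/
noncomputable def domain (a : ℝ) (N : ℕ) : Submodule ℂ (Fock N) :=
  Submodule.span ℂ
    (Set.range fun q : (BosonMode N →₀ ℕ) × (Species N → ℤ) => basisState a q.1 q.2)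

end Mattis

/-! The Hamiltonian is treated as a block band matrix in the occupation basis of the Fock space and
Carleman's criterion is applied; no diagonalization is used. Grade the basis by `weight`, twice the
kinetic energy of the excitations in units of 2π/L. Each layer of given weight is finite-dimensional
(`finite_weight_le`). The free part preserves the weight. The cutoff leaves finitely many terms in
the interaction, each a product of two densities, and each density changes the weight by at most N;
so H has band width at most 2N. Carleman's criterion (`eq_zero_of_band`) says that a symmetric band
operator whose off-diagonal blocks have norm O(m) at weight m has no deficiency vectors: truncating
such a vector at level n bounds its norm by boundary terms of size O(n) times its mass in a few
layers near n, and the divergence of the harmonic series contradicts square-summability.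

The linear growth of the blocks comes from the Kronig identity (`kronig_chain`): for one species,
twice the sum of ρ(-p)ρ(p) over p > 0 equals twice the energy minus the square of the charge. Hence
each density is bounded by the square root of the weight (`norm_rho_sq_le`), and a product of two of
them grows linearly (`norm_interactionTerm_le`).

It remains to see that 𝓓, defined through bosons and Klein factors, is exactly the space of vectors
with finitely many nonzero coordinates (`domain_eq_finiteVectors`). This is the completeness of
bosonization, and the Kronig identity is used once more: a vector killed by all lowering densities
is supported on configurations with zero excitation energy in every species, i.e. on shifted Fermi
seas, and these are the Klein states up to phases. An induction on the weight then removes, layer by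
layer, any vector orthogonal to 𝓓 (`graded_le_domain`).

The unbounded sums and products in the definitions cause little trouble: on finitely supported
vectors every series has only finitely many nonzero terms, and formal adjointness holds term by term
on the full natural domains. -/

open scoped InnerProductSpace lp

namespace Mattis

/-! ### Vanishing deficiency spaces and self-adjoint closures. -/

section EssentialSelfAdjointness

variable {F : Type*} [NormedAddCommGroup F] [InnerProductSpace ℂ F] [CompleteSpace F]

/-- A densely defined symmetric operator whose deficiency spaces vanish has a self-adjoint
closure. -/
theorem isSelfAdjoint_closure_of_deficiency (T : F →ₗ.[ℂ] F) (hd : Dense (T.domain : Set F))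
    (hs : T.IsFormalAdjoint T)
    (hdef : ∀ c : ℂ, c * c = -1 → ∀ ψ : F, (∀ u : T.domain, ⟪ψ, T u⟫_ℂ = c * ⟪ψ, (u : F)⟫_ℂ) →
      ψ = 0) :
    IsSelfAdjoint T.closure := by
  have hle : T ≤ T.adjoint := hs.le_adjoint hd
  have hcl : T.IsClosable := (LinearPMap.adjoint_isClosed hd).isClosable.leIsClosable hle
  have hgc := hcl.graph_closure_eq_closure_graph
  have hdc : Dense (T.closure.domain : Set F) := hd.mono T.le_closure.1
  -- Lying in the graph of the adjoint is a closed condition on the graph of the operator, so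
  -- passing to the closure does not change the adjoint.
  have hadj : T.closure.adjoint = T.adjoint := by
    apply LinearPMap.eq_of_eq_graph
    rw [LinearPMap.adjoint_graph_eq_graph_adjoint hd,
      LinearPMap.adjoint_graph_eq_graph_adjoint hdc, ← hgc]
    ext x
    rw [Submodule.mem_adjoint_iff, Submodule.mem_adjoint_iff]
    constructor
    · exact fun h a b hab => h a b (T.graph.le_topologicalClosure hab)
    · intro h a b hab
      have hc : IsClosed {p : F × F | ⟪p.2, x.1⟫_ℂ - ⟪p.1, x.2⟫_ℂ = 0} :=
        isClosed_eq (by fun_prop) continuous_const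
      exact closure_minimal (fun p hp => h p.1 p.2 hp) hc hab
  rw [LinearPMap.isSelfAdjoint_def, hadj]
  apply LinearPMap.eq_of_eq_graph
  rw [← hgc]
  apply le_antisymm
  · intro x hx
    -- The product norm on `F × F` is not Hilbertian; the `WithLp 2` copy allows the orthogonal
    -- splitting of a point of the adjoint graph along the closed graph of `T`.
    let e : WithLp 2 (F × F) ≃L[ℂ] F × F := WithLp.prodContinuousLinearEquiv 2 ℂ F F
    let K : Submodule ℂ (WithLp 2 (F × F)) := T.graph.topologicalClosure.comap e.toLinearMap
    have hK : IsClosed (K : Set (WithLp 2 (F × F))) :=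
      T.graph.isClosed_topologicalClosure.preimage e.continuous
    have : CompleteSpace K := hK.completeSpace_coe
    obtain ⟨k, hk, z, hz, hkz⟩ := K.exists_add_mem_mem_orthogonal (e.symm x)
    have hx' : x = e k + e z := by rw [← map_add, ← hkz, e.apply_symm_apply]
    have hkT : e k ∈ T.adjoint.graph := by
      have h1 : T.graph.topologicalClosure ≤ T.adjoint.graph :=
        Submodule.topologicalClosure_minimal _ (LinearPMap.le_graph_of_le hle)
          (LinearPMap.adjoint_isClosed hd)
      exact h1 hk
    have hzT : e z ∈ T.adjoint.graph := by
      have : e z = x - e k := by rw [hx']; abel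
      rw [this]
      exact Submodule.sub_mem _ hx hkT
    rw [LinearPMap.adjoint_graph_eq_graph_adjoint hd, Submodule.mem_adjoint_iff] at hzT
    have h1 : ∀ u : T.domain, ⟪(e z).1, T u⟫_ℂ = ⟪(e z).2, (u : F)⟫_ℂ := by
      intro u
      have := hzT u (T u) (T.mem_graph u)
      rw [sub_eq_zero] at this
      rw [← inner_conj_symm, this, inner_conj_symm]
    have h2 : ∀ u : T.domain, ⟪(e z).2, T u⟫_ℂ = -⟪(e z).1, (u : F)⟫_ℂ := by
      intro u
      have hu : e.symm ((u : F), T u) ∈ K := by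
        change e (e.symm ((u : F), T u)) ∈ T.graph.topologicalClosure
        rw [e.apply_symm_apply]
        exact T.graph.le_topologicalClosure (T.mem_graph u)
      have := (Submodule.mem_orthogonal' K z).1 hz _ hu
      rw [WithLp.prod_inner_apply] at this
      change ⟪(e z).1, (u : F)⟫_ℂ + ⟪(e z).2, T u⟫_ℂ = 0 at this
      exact eq_neg_of_add_eq_zero_right this
    -- Von Neumann's argument: z = (z₁, z₂) satisfies T*z₁ = z₂ and T*z₂ = -z₁, so these two
    -- combinations are deficiency vectors for c = ±i. Both vanish, hence z = 0.
    have h3 : ∀ c : ℂ, c * c = -1 → (e z).2 + (starRingEnd ℂ c) • (e z).1 = 0 := by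
      intro c hc
      refine hdef c hc _ fun u => ?_
      rw [inner_add_left, inner_add_left, inner_smul_left, inner_smul_left, h1, h2,
        Complex.conj_conj]
      linear_combination (-⟪(e z).1, (u : F)⟫_ℂ) * hc
    have hp := h3 Complex.I Complex.I_mul_I
    have hm := h3 (-Complex.I) (by simp)
    have hz2 : (e z).2 = 0 := by
      have h4 : (2 : ℂ) • (e z).2 = 0 := by
        have := congrArg₂ (· + ·) hp hm
        simp only [map_neg, neg_smul, add_zero] at this
        rw [two_smul]
        rw [← this]
        abel
      exact (smul_eq_zero.1 h4).resolve_left two_ne_zero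
    have hz1 : (e z).1 = 0 := by
      rw [hz2, zero_add] at hp
      exact (smul_eq_zero.1 hp).resolve_left (by simp)
    have hz0 : e z = 0 := Prod.ext hz1 hz2
    rw [hx', hz0, add_zero]
    exact hk
  · exact Submodule.topologicalClosure_minimal _ (LinearPMap.le_graph_of_le hle)
      (LinearPMap.adjoint_isClosed hd)

end EssentialSelfAdjointness

/-! ### Graded `ℓ²` spaces and Carleman's criterion -/

section Graded

variable {ι : Type*}

/-- The vectors of `ℓ²(ι)` that are supported in `P`. -/
def supportedOn (P : Set ι) : Submodule ℂ ℓ²(ι, ℂ) where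
  carrier := {v | ∀ i, v i ≠ 0 → i ∈ P}
  zero_mem' := fun i h => (h rfl).elim
  add_mem' := by
    intro v w hv hw i h
    by_contra hi
    have h1 : v i = 0 := by_contra fun h => hi (hv i h)
    have h2 : w i = 0 := by_contra fun h => hi (hw i h)
    exact h (by simp [h1, h2])
  smul_mem' := by
    intro c v hv i h
    exact hv i fun h0 => h (by simp [h0])

theorem supportedOn_mono {P Q : Set ι} (h : P ⊆ Q) : supportedOn P ≤ supportedOn Q :=
  fun _ hv i hi => h (hv i hi)

theorem inner_eq_zero_of_supportedOn {P Q : Set ι} (h : Disjoint P Q) {u v : ℓ²(ι, ℂ)}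
    (hu : u ∈ supportedOn P) (hv : v ∈ supportedOn Q) : ⟪u, v⟫_ℂ = 0 := by
  rw [lp.inner_eq_tsum]
  refine (tsum_congr fun i => ?_).trans tsum_zero
  by_cases h1 : u i = 0
  · simp [h1]
  by_cases h2 : v i = 0
  · simp [h2]
  exact (Set.disjoint_left.1 h (hu i h1) (hv i h2)).elim

theorem single_mem_supportedOn [DecidableEq ι] {P : Set ι} {i : ι} (hi : i ∈ P) (c : ℂ) :
    (lp.single 2 i c : ℓ²(ι, ℂ)) ∈ supportedOn P := by
  intro j hj
  by_cases h : j = i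
  · rwa [h]
  · exact (hj (lp.single_apply_ne (E := fun _ : ι => ℂ) 2 i c h)).elim

open Classical in
/-- The restriction of a vector of `ℓ²(ι)` to a finite set of coordinates. -/
noncomputable def restrict (s : Finset ι) (v : ℓ²(ι, ℂ)) : ℓ²(ι, ℂ) :=
  ∑ i ∈ s, lp.single 2 i (v i)

open Classical in
theorem restrict_apply (s : Finset ι) (v : ℓ²(ι, ℂ)) (i : ι) :
    restrict s v i = if i ∈ s then v i else 0 := by
  rw [restrict, lp.coeFn_sum, Finset.sum_apply]
  simp only [lp.coeFn_single, Finset.sum_pi_single]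

theorem restrict_mem_supportedOn (s : Finset ι) (v : ℓ²(ι, ℂ)) :
    restrict s v ∈ supportedOn (s : Set ι) := by
  intro i hi
  rw [restrict_apply] at hi
  by_contra h
  exact hi (if_neg h)

theorem eq_restrict_of_supportedOn {s : Finset ι} {v : ℓ²(ι, ℂ)}
    (hv : v ∈ supportedOn (s : Set ι)) : restrict s v = v := by
  ext i
  rw [restrict_apply]
  split_ifs with h
  · rfl
  · by_contra h0
    exact h (hv i (Ne.symm h0))

theorem dense_of_single_mem {D : Submodule ℂ ℓ²(ι, ℂ)}
    (h : ∀ P : Set ι, P.Finite → supportedOn P ≤ D) : Dense (D : Set ℓ²(ι, ℂ)) := by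
  classical
  intro v
  have hs := lp.hasSum_single (p := 2) (by norm_num) v
  refine mem_closure_of_tendsto hs (Filter.Eventually.of_forall fun s => ?_)
  exact h s s.finite_toSet (restrict_mem_supportedOn s v)

theorem inner_restrict_self (s : Finset ι) (v : ℓ²(ι, ℂ)) :
    ⟪v, restrict s v⟫_ℂ = ((‖restrict s v‖ ^ 2 : ℝ) : ℂ) := by
  have h : ⟪v, restrict s v⟫_ℂ = ⟪restrict s v, restrict s v⟫_ℂ := by
    rw [lp.inner_eq_tsum, lp.inner_eq_tsum]
    refine tsum_congr fun i => ?_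
    rw [restrict_apply]
    split_ifs <;> simp
  rw [h, inner_self_eq_norm_sq_to_K]
  norm_cast

theorem norm_sq_restrict (s : Finset ι) (v : ℓ²(ι, ℂ)) :
    ‖restrict s v‖ ^ 2 = ∑ i ∈ s, ‖v i‖ ^ 2 := by
  classical
  have := lp.norm_sum_single (p := 2) (by norm_num) (fun i => v i) s
  simpa [restrict] using this

theorem norm_sq_restrict_le (s : Finset ι) (v : ℓ²(ι, ℂ)) : ‖restrict s v‖ ^ 2 ≤ ‖v‖ ^ 2 := by
  rw [norm_sq_restrict]
  have := lp.sum_rpow_le_norm_rpow (p := 2) (by norm_num) v s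
  simpa using this

variable {w : ι → ℕ}

/-- The band estimate in Carleman's criterion. -/
theorem norm_sq_restrict_le_of_band (hw : ∀ m, {i | w i ≤ m}.Finite)
    (D : Submodule ℂ ℓ²(ι, ℂ)) (hD : ∀ P : Set ι, P.Finite → supportedOn P ≤ D)
    (T : D →ₗ[ℂ] ℓ²(ι, ℂ)) (hs : ∀ u v : D, ⟪T u, (v : ℓ²(ι, ℂ))⟫_ℂ = ⟪(u : ℓ²(ι, ℂ)), T v⟫_ℂ)
    {C : ℝ} (hC : 0 ≤ C) (B : ℕ)
    (hband : ∀ m, ∀ v : D, (v : ℓ²(ι, ℂ)) ∈ supportedOn {i | w i = m} →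
      T v ∈ supportedOn {i | w i ≤ m + B})
    (hbound : ∀ m m', m ≠ m' → ∀ v : D, (v : ℓ²(ι, ℂ)) ∈ supportedOn {i | w i = m} →
      ∀ u ∈ supportedOn {i | w i = m'}, ‖⟪u, T v⟫_ℂ‖ ≤ C * (m + 1) * ‖u‖ * ‖v‖)
    {c : ℂ} (hc : c * c = -1) {ψ : ℓ²(ι, ℂ)}
    (hψ : ∀ u : D, ⟪ψ, T u⟫_ℂ = c * ⟪ψ, (u : ℓ²(ι, ℂ))⟫_ℂ) (n : ℕ) :
    ‖restrict (hw (n + B)).toFinset ψ‖ ^ 2 ≤ (B + 1) * B * (C * (n + B + 1)) *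
      ∑ j ∈ Finset.range (2 * B + 1),
        ‖restrict ((hw (n + j)).toFinset.filter fun i => w i = n + j) ψ‖ ^ 2 := by
  classical
  set layer : ℕ → ℓ²(ι, ℂ) :=
    fun m => restrict ((hw m).toFinset.filter fun i => w i = m) ψ with hlayer
  have layer_apply : ∀ m i, layer m i = if w i = m then ψ i else 0 := by
    intro m i
    simp only [hlayer, restrict_apply, Finset.mem_filter, Set.Finite.mem_toFinset,
      Set.mem_ofPred_eq]
    by_cases h : w i = m
    · simp [h]
    · simp [h]
  have layer_mem : ∀ m, layer m ∈ supportedOn {i | w i = m} := by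
    intro m i hi
    rw [layer_apply] at hi
    by_contra h
    exact hi (if_neg h)
  have hfin : ∀ m, {i | w i = m}.Finite := fun m => (hw m).subset fun i hi => le_of_eq hi
  have layerD : ∀ m, layer m ∈ D := fun m => hD _ (hfin m) (layer_mem m)
  have sum_layer : ∀ (s : Finset ℕ) i, (∑ m ∈ s, layer m) i = if w i ∈ s then ψ i else 0 := by
    intro s i
    rw [lp.coeFn_sum, Finset.sum_apply]
    simp only [layer_apply]
    rw [Finset.sum_ite_eq]
  set P : ℓ²(ι, ℂ) := restrict (hw (n + B)).toFinset ψ with hP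
  have P_apply : ∀ i, P i = if w i ≤ n + B then ψ i else 0 := by
    intro i
    rw [hP, restrict_apply]
    simp
  have hPsum : P = ∑ m ∈ Finset.range (n + B + 1), layer m := by
    ext i
    rw [sum_layer, P_apply]
    simp
  let Pd : D := ∑ m ∈ Finset.range (n + B + 1), ⟨layer m, layerD m⟩
  have hPd : (Pd : ℓ²(ι, ℂ)) = P := by
    rw [hPsum]
    simp [Pd]
  have hTP : T Pd = ∑ m ∈ Finset.range (n + B + 1), T ⟨layer m, layerD m⟩ := map_sum _ _ _
  -- the imaginary part of `⟪ψ - P, T P⟫` has absolute value `‖P‖²`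
  have hX : ‖P‖ ^ 2 ≤ ‖⟪ψ - P, T Pd⟫_ℂ‖ := by
    have h1 : ⟪ψ, T Pd⟫_ℂ = c * ((‖P‖ ^ 2 : ℝ) : ℂ) := by
      rw [hψ, hPd, hP, inner_restrict_self]
    have h2 : (⟪P, T Pd⟫_ℂ).im = 0 := by
      have := hs Pd Pd
      rw [hPd, ← inner_conj_symm] at this
      exact Complex.conj_eq_iff_im.1 this
    have hci : |c.im| = 1 := by
      have h3 : (c - Complex.I) * (c + Complex.I) = 0 := by
        linear_combination hc - Complex.I_mul_I
      rcases mul_eq_zero.1 h3 with h | h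
      · rw [sub_eq_zero.1 h]
        simp
      · rw [eq_neg_of_add_eq_zero_left h]
        simp
    calc ‖P‖ ^ 2 = |(⟪ψ - P, T Pd⟫_ℂ).im| := by
          rw [inner_sub_left, Complex.sub_im, h2, h1, Complex.im_mul_ofReal, sub_zero, abs_mul, hci,
            one_mul, abs_of_nonneg (by positivity)]
      _ ≤ _ := Complex.abs_im_le_norm _
  -- From weights at most n + B, `T` reaches at most n + 2B, so only B layers of ψ - P are seen.
  have hsplit : ∀ m ∈ Finset.range (n + B + 1), ⟪ψ - P, T ⟨layer m, layerD m⟩⟫_ℂ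
      = ∑ m' ∈ Finset.Ioc (n + B) (n + 2 * B), ⟪layer m', T ⟨layer m, layerD m⟩⟫_ℂ := by
    intro m hm
    rw [← sum_inner, ← sub_eq_zero, ← inner_sub_left]
    refine inner_eq_zero_of_supportedOn (P := {i | n + 2 * B < w i}) (Q := {i | w i ≤ m + B})
      ?_ ?_ (hband m _ (layer_mem m))
    · rw [Set.disjoint_left]
      intro i h1 h2
      have h1' : n + 2 * B < w i := h1
      have h2' : w i ≤ m + B := h2
      have := Finset.mem_range.1 hm
      omega
    · intro i hi
      by_contra h
      have h' : ¬ (n + 2 * B < w i) := h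
      apply hi
      rw [lp.coeFn_sub, Pi.sub_apply, lp.coeFn_sub, Pi.sub_apply, sum_layer, P_apply]
      by_cases h3 : w i ≤ n + B
      · have h4 : w i ∉ Finset.Ioc (n + B) (n + 2 * B) := by
          rw [Finset.mem_Ioc]
          omega
        rw [if_pos h3, if_neg h4]
        ring
      · have h4 : w i ∈ Finset.Ioc (n + B) (n + 2 * B) := by
          rw [Finset.mem_Ioc]
          omega
        rw [if_neg h3, if_pos h4]
        ring
  set S : ℝ := ∑ j ∈ Finset.range (2 * B + 1), ‖layer (n + j)‖ ^ 2 with hS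
  have hS0 : 0 ≤ S := Finset.sum_nonneg fun j _ => by positivity
  have hle : ∀ m, n ≤ m → m ≤ n + 2 * B → ‖layer m‖ ^ 2 ≤ S := by
    intro m h1 h2
    obtain ⟨j, rfl⟩ := Nat.exists_eq_add_of_le h1
    exact Finset.single_le_sum (f := fun j => ‖layer (n + j)‖ ^ 2)
      (fun j _ => by positivity) (Finset.mem_range.2 (by omega))
  -- Layers below n cannot reach beyond n + B. This leaves at most (B + 1)B pairs of layers, all
  -- within [n, n + 2B], which explains the constant.
  have hterm : ∀ m ∈ Finset.range (n + B + 1), ∀ m' ∈ Finset.Ioc (n + B) (n + 2 * B),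
      ‖⟪layer m', T ⟨layer m, layerD m⟩⟫_ℂ‖
        ≤ if n ≤ m then C * (n + B + 1) * S else 0 := by
    intro m hm m' hm'
    rw [Finset.mem_range] at hm
    rw [Finset.mem_Ioc] at hm'
    split_ifs with h
    · refine (hbound m m' (by omega) _ (layer_mem m) _ (layer_mem m')).trans ?_
      have h1 := hle m h (by omega)
      have h2 := hle m' (by omega) (by omega)
      have h3 : ‖layer m'‖ * ‖layer m‖ ≤ S := by
        nlinarith [sq_nonneg (‖layer m'‖ - ‖layer m‖)]
      have h4 : (m : ℝ) + 1 ≤ n + B + 1 := by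
        have : (m : ℝ) ≤ n + B := by exact_mod_cast (by omega : m ≤ n + B)
        linarith
      rw [mul_assoc]
      gcongr
      exact h3
    · rw [inner_eq_zero_of_supportedOn (P := {i | w i = m'}) (Q := {i | w i ≤ m + B}) ?_
        (layer_mem m') (hband m _ (layer_mem m)), norm_zero]
      rw [Set.disjoint_left]
      intro i h1 h2
      have h1' : w i = m' := h1
      have h2' : w i ≤ m + B := h2
      omega
  refine hX.trans ?_
  rw [hTP, inner_sum, Finset.sum_congr rfl hsplit]
  refine (norm_sum_le _ _).trans ?_
  calc ∑ m ∈ Finset.range (n + B + 1),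
        ‖∑ m' ∈ Finset.Ioc (n + B) (n + 2 * B), ⟪layer m', T ⟨layer m, layerD m⟩⟫_ℂ‖
      ≤ ∑ m ∈ Finset.range (n + B + 1),
          (if n ≤ m then (B : ℝ) * (C * (n + B + 1) * S) else 0) := by
        refine Finset.sum_le_sum fun m hm => ?_
        refine (norm_sum_le _ _).trans ?_
        refine (Finset.sum_le_sum (hterm m hm)).trans ?_
        rw [Finset.sum_const, Nat.card_Ioc]
        have : n + 2 * B - (n + B) = B := by omega
        rw [this]
        split_ifs <;> simp
    _ = (B + 1) * B * (C * (n + B + 1)) * S := by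
        rw [← Finset.sum_filter, Finset.sum_const]
        have : (Finset.range (n + B + 1)).filter (fun m => n ≤ m) = Finset.Ico n (n + B + 1) := by
          ext m
          simp only [Finset.mem_filter, Finset.mem_range, Finset.mem_Ico]
          omega
        rw [this, Nat.card_Ico]
        have : n + B + 1 - n = B + 1 := by omega
        rw [this, nsmul_eq_mul]
        push_cast
        ring

/-- Carleman's criterion for block band operators whose blocks grow at most linearly: the
deficiency spaces vanish. -/
theorem eq_zero_of_band (hw : ∀ m, {i | w i ≤ m}.Finite)
    (D : Submodule ℂ ℓ²(ι, ℂ)) (hD : ∀ P : Set ι, P.Finite → supportedOn P ≤ D)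
    (T : D →ₗ[ℂ] ℓ²(ι, ℂ)) (hs : ∀ u v : D, ⟪T u, (v : ℓ²(ι, ℂ))⟫_ℂ = ⟪(u : ℓ²(ι, ℂ)), T v⟫_ℂ)
    {C : ℝ} (hC : 0 ≤ C) (B : ℕ)
    (hband : ∀ m, ∀ v : D, (v : ℓ²(ι, ℂ)) ∈ supportedOn {i | w i = m} →
      T v ∈ supportedOn {i | w i ≤ m + B})
    (hbound : ∀ m m', m ≠ m' → ∀ v : D, (v : ℓ²(ι, ℂ)) ∈ supportedOn {i | w i = m} →
      ∀ u ∈ supportedOn {i | w i = m'}, ‖⟪u, T v⟫_ℂ‖ ≤ C * (m + 1) * ‖u‖ * ‖v‖)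
    {c : ℂ} (hc : c * c = -1) {ψ : ℓ²(ι, ℂ)}
    (hψ : ∀ u : D, ⟪ψ, T u⟫_ℂ = c * ⟪ψ, (u : ℓ²(ι, ℂ))⟫_ℂ) : ψ = 0 := by
  classical
  by_contra hne
  have hex : ∃ i, ψ i ≠ 0 := by
    by_contra! h
    exact hne (lp.ext (funext h))
  obtain ⟨i₀, hi₀⟩ := hex
  set a : ℕ → ℝ := fun m => ‖restrict ((hw m).toFinset.filter fun i => w i = m) ψ‖ ^ 2 with ha
  have ha0 : ∀ m, 0 ≤ a m := fun m => by positivity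
  have hsum : Summable a := by
    refine summable_of_sum_range_le (c := ‖ψ‖ ^ 2) ha0 fun n => ?_
    refine le_trans (le_of_eq ?_) (norm_sq_restrict_le
      ((Finset.range n).biUnion fun m => (hw m).toFinset.filter fun i => w i = m) ψ)
    rw [norm_sq_restrict, Finset.sum_biUnion]
    · exact Finset.sum_congr rfl fun m _ => norm_sq_restrict _ _
    · intro m _ m' _ hmm
      refine Finset.disjoint_left.2 fun i h1 h2 => hmm ?_
      rw [← (Finset.mem_filter.1 h1).2, ← (Finset.mem_filter.1 h2).2]
  set K : ℝ := (B + 1) * B * C with hK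
  have hK0 : 0 ≤ K := by positivity
  have hS : Summable fun n => ∑ j ∈ Finset.range (2 * B + 1), a (n + j) :=
    summable_sum fun j _ => (summable_nat_add_iff (f := a) j).2 hsum
  have key : ∀ n, w i₀ ≤ n →
      ‖ψ i₀‖ ^ 2 ≤ K * (n + B + 1) * ∑ j ∈ Finset.range (2 * B + 1), a (n + j) := by
    intro n hn
    have h := norm_sq_restrict_le_of_band hw D hD T hs hC B hband hbound hc hψ n
    refine le_trans ?_ (h.trans (le_of_eq (by rw [hK]; ring)))
    rw [norm_sq_restrict]
    refine Finset.single_le_sum (f := fun i => ‖ψ i‖ ^ 2) (fun j _ => by positivity) ?_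
    rw [Set.Finite.mem_toFinset]
    exact hn.trans (Nat.le_add_right _ _)
  have hpos : 0 < ‖ψ i₀‖ ^ 2 := by positivity
  -- The sum over n of the masses in [n, n + 2B] converges, because each layer is counted at most 2B
  -- + 1 times. By `key` it dominates a constant times a tail of the harmonic series.
  have hnot := Real.not_summable_one_div_natCast
  apply hnot
  rw [← summable_nat_add_iff (w i₀ + B + 1)]
  have hS' := ((summable_nat_add_iff (w i₀)).2 hS).mul_left (K / ‖ψ i₀‖ ^ 2)
  refine Summable.of_nonneg_of_le (fun k => by positivity) (fun k => ?_) hS'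
  have h := key (k + w i₀) (Nat.le_add_left _ _)
  have hx : (0 : ℝ) < ((k + (w i₀ + B + 1) : ℕ) : ℝ) := by positivity
  rw [div_mul_eq_mul_div, div_le_div_iff₀ hx hpos, one_mul]
  refine h.trans (le_of_eq ?_)
  push_cast
  ring

/-- Block band operators whose blocks grow at most linearly are essentially self-adjoint. -/
theorem isEssentiallySelfAdjointOn_of_band (hw : ∀ m, {i | w i ≤ m}.Finite)
    (A : ℓ²(ι, ℂ) →ₗ.[ℂ] ℓ²(ι, ℂ)) (D : Submodule ℂ ℓ²(ι, ℂ))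
    (hD : ∀ P : Set ι, P.Finite → supportedOn P ≤ D) (hdom : D ≤ A.domain)
    (hs : ∀ u (hu : u ∈ D) v (hv : v ∈ D),
      ⟪A ⟨u, hdom hu⟩, v⟫_ℂ = ⟪u, A ⟨v, hdom hv⟩⟫_ℂ)
    {C : ℝ} (hC : 0 ≤ C) (B : ℕ)
    (hband : ∀ m, ∀ v (hv : v ∈ D), v ∈ supportedOn {i | w i = m} →
      A ⟨v, hdom hv⟩ ∈ supportedOn {i | w i ≤ m + B})
    (hbound : ∀ m m', m ≠ m' → ∀ v (hv : v ∈ D), v ∈ supportedOn {i | w i = m} →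
      ∀ u ∈ supportedOn {i | w i = m'}, ‖⟪u, A ⟨v, hdom hv⟩⟫_ℂ‖ ≤ C * (m + 1) * ‖u‖ * ‖v‖) :
    IsEssentiallySelfAdjointOn A D := by
  have hdense := dense_of_single_mem hD
  have hsym : (A.domRestrict D).IsFormalAdjoint (A.domRestrict D) := by
    rintro ⟨u, hu⟩ ⟨v, hv⟩
    exact hs u hu.1 v hv.1
  refine ⟨hdense, hdom, hsym, ?_⟩
  refine isSelfAdjoint_closure_of_deficiency _ (hdense.mono ?_) hsym fun c hc ψ hψ => ?_
  · exact fun v hv => ⟨hv, hdom hv⟩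
  · exact eq_zero_of_band hw D hD (A.toFun.comp (Submodule.inclusion hdom))
      (fun u v => hs u u.2 v v.2) hC B (fun m v hv => hband m v v.2 hv)
      (fun m m' hm v hv u hu => hbound m m' hm v v.2 hv u hu) hc
      (fun u => hψ ⟨u, u.2, hdom u.2⟩)

end Graded

end Mattis

open scoped InnerProductSpace lp

namespace Mattis

/-! ### Canonical anticommutation relations -/

section CAR

variable {M : Type*} [LinearOrder M]

theorem annihilate_apply (m : M) (f : ℓ²(Finset M, ℂ)) (S : Finset M) :
    annihilate m f S = if m ∈ S then 0 else ((jwSign m S : ℤ) : ℂ) * f (insert m S) := rfl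

theorem jwSign_insert_self (m : M) (S : Finset M) : jwSign m (insert m S) = jwSign m S := by
  simp [jwSign, Finset.filter_insert]

theorem jwSign_erase_self (m : M) (S : Finset M) : jwSign m (S.erase m) = jwSign m S := by
  simp [jwSign, Finset.filter_erase]

theorem jwSign_insert {m m' : M} {S : Finset M} (h : m' ∉ S) :
    jwSign m (insert m' S) = if m' < m then -jwSign m S else jwSign m S := by
  unfold jwSign
  rw [Finset.filter_insert]
  split_ifs
  · rw [Finset.card_insert_of_notMem (by simp [h]), pow_succ]
    simp
  · rfl

theorem jwSign_erase {m m' : M} {S : Finset M} (h : m' ∈ S) :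
    jwSign m (S.erase m') = if m' < m then -jwSign m S else jwSign m S := by
  have := jwSign_insert (m := m) (Finset.notMem_erase m' S)
  rw [Finset.insert_erase h] at this
  rw [this]
  split_ifs <;> simp

/-- The creation operator, the adjoint of `annihilate`. -/
noncomputable def create (m : M) : ℓ²(Finset M, ℂ) →L[ℂ] ℓ²(Finset M, ℂ) :=
  ContinuousLinearMap.adjoint (annihilate m)

theorem jwSign_mul_self (m : M) (S : Finset M) :
    ((jwSign m S : ℤ) : ℂ) * ((jwSign m S : ℤ) : ℂ) = 1 := by
  rcases Int.units_eq_one_or (jwSign m S) with h | h <;> simp [h]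

theorem annihilate_single (m : M) (S : Finset M) :
    annihilate m (lp.single 2 S (1 : ℂ)) =
      if m ∈ S then lp.single 2 (S.erase m) ((jwSign m S : ℤ) : ℂ) else 0 := by
  ext T
  rw [annihilate_apply, lp.single_apply]
  by_cases hS : m ∈ S
  · rw [if_pos hS, lp.single_apply]
    by_cases hT : m ∈ T
    · rw [if_pos hT, Pi.single_eq_of_ne]
      rintro rfl
      simp at hT
    · rw [if_neg hT]
      by_cases h : T = S.erase m
      · subst h
        rw [Finset.insert_erase hS, Pi.single_eq_same, Pi.single_eq_same, mul_one,
          jwSign_erase_self]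
      · rw [Pi.single_eq_of_ne h, Pi.single_eq_of_ne, mul_zero]
        rintro rfl
        exact h (Finset.erase_insert hT).symm
  · rw [if_neg hS]
    split_ifs with hT
    · rfl
    · rw [Pi.single_eq_of_ne, mul_zero]
      · rfl
      rintro rfl
      simp at hS

theorem create_apply (m : M) (f : ℓ²(Finset M, ℂ)) (S : Finset M) :
    create m f S = if m ∈ S then ((jwSign m S : ℤ) : ℂ) * f (S.erase m) else 0 := by
  have h : ∀ g : ℓ²(Finset M, ℂ), ∀ T, g T = ⟪(lp.single 2 T (1 : ℂ) : ℓ²(Finset M, ℂ)), g⟫_ℂ := by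
    intro g T
    rw [lp.inner_single_left]
    simp
  rw [h, create, ContinuousLinearMap.adjoint_inner_right, annihilate_single]
  split_ifs
  · rw [lp.inner_single_left]
    simp [mul_comm]
  · simp

theorem annihilate_anticomm (m m' : M) :
    annihilate m * annihilate m' + annihilate m' * annihilate m = 0 := by
  ext f S
  change annihilate m (annihilate m' f) S + annihilate m' (annihilate m f) S = 0
  simp only [annihilate_apply]
  by_cases h : m = m'
  · subst h
    simp
  by_cases hm : m ∈ S
  · simp [hm]
  by_cases hm' : m' ∈ S
  · simp [hm']
  have h1 : m' ∉ insert m S := by simp [hm', Ne.symm h]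
  have h2 : m ∉ insert m' S := by simp [hm, h]
  rw [if_neg hm, if_neg hm', if_neg h1, if_neg h2, jwSign_insert hm, jwSign_insert hm',
    Finset.insert_comm]
  rcases lt_or_gt_of_ne h with hlt | hlt
  · rw [if_pos hlt, if_neg hlt.not_gt]
    push_cast
    ring
  · rw [if_pos hlt, if_neg hlt.not_gt]
    push_cast
    ring

theorem create_mul_annihilate_add (m m' : M) :
    create m * annihilate m' + annihilate m' * create m = if m = m' then 1 else 0 := by
  ext f S
  have h0 : (if m = m' then (1 : ℓ²(Finset M, ℂ) →L[ℂ] ℓ²(Finset M, ℂ)) else 0) f S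
      = if m = m' then f S else 0 := by
    split_ifs <;> rfl
  rw [h0]
  change create m (annihilate m' f) S + annihilate m' (create m f) S = _
  simp only [annihilate_apply, create_apply]
  by_cases h : m = m'
  · subst h
    by_cases hm : m ∈ S
    · rw [if_pos hm, if_neg (Finset.notMem_erase m S), if_pos hm, Finset.insert_erase hm,
        jwSign_erase_self, ← mul_assoc, jwSign_mul_self]
      simp
    · rw [if_neg hm, if_neg hm, if_pos (Finset.mem_insert_self m S), Finset.erase_insert hm,
        jwSign_insert_self, ← mul_assoc, jwSign_mul_self]
      simp
  · rw [if_neg h]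
    by_cases hm : m ∈ S
    · by_cases hm' : m' ∈ S
      · have h1 : m' ∈ S.erase m := by simp [hm', Ne.symm h]
        simp [hm', h1]
      · have h1 : m' ∉ S.erase m := by simp [hm']
        have h2 : m ∈ insert m' S := by simp [hm]
        rw [if_pos hm, if_neg h1, if_neg hm', if_pos h2, jwSign_erase hm, jwSign_insert hm',
          Finset.erase_insert_of_ne (Ne.symm h)]
        rcases lt_or_gt_of_ne h with hlt | hlt
        · rw [if_pos hlt, if_neg hlt.not_gt]
          push_cast
          ring
        · rw [if_pos hlt, if_neg hlt.not_gt]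
          push_cast
          ring
    · have h2 : m ∉ insert m' S := by simp [hm, h]
      simp [hm, h2]

theorem create_anticomm (m m' : M) : create m * create m' + create m' * create m = 0 := by
  have h := congrArg ContinuousLinearMap.adjoint (annihilate_anticomm m' m)
  have h1 : ∀ A B : ℓ²(Finset M, ℂ) →L[ℂ] ℓ²(Finset M, ℂ), ContinuousLinearMap.adjoint (A * B)
      = ContinuousLinearMap.adjoint B * ContinuousLinearMap.adjoint A :=
    fun A B => ContinuousLinearMap.adjoint_comp A B
  rw [map_add, h1, h1, map_zero] at h
  exact h

end CAR

/-! ### Fermion operators relative to the Dirac sea -/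

variable {N : ℕ}

/-- The relabelling of momenta after which a species has positive energies exactly at the
nonnegative labels. -/
def relabel (r : ℤˣ) (k : ℤ) : ℤ := if r = 1 then k else -1 - k

theorem relabel_relabel (r : ℤˣ) (k : ℤ) : relabel r (relabel r k) = k := by
  unfold relabel
  split_ifs <;> ring

theorem relabel_add (r : ℤˣ) (k p : ℤ) : relabel r (k + p) = relabel r k + r * p := by
  rcases Int.units_eq_one_or r with rfl | rfl
  · simp [relabel]
  · have : (-1 : ℤˣ) ≠ 1 := by decide
    simp [relabel, this]
    ring

theorem relabel_injective (r : ℤˣ) : Function.Injective (relabel r) :=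
  Function.LeftInverse.injective (relabel_relabel r)

theorem natAbs_relabel (r : ℤˣ) (k : ℤ) :
    (2 * relabel r k + 1).natAbs = (2 * k + 1).natAbs := by
  unfold relabel
  split_ifs <;> omega

theorem relabel_mem_window (r : ℤˣ) (k M : ℤ) :
    (-M ≤ relabel r k ∧ relabel r k < M) ↔ (-M ≤ k ∧ k < M) := by
  unfold relabel
  split_ifs <;> omega

/-- The mode of the species `A` with relabelled momentum `k`. -/
def orbital (A : Species N) (k : ℤ) : Mode N := mode A (relabel (ofLex A).1 k)

theorem orbital_inj {A B : Species N} {k l : ℤ} : orbital A k = orbital B l ↔ A = B ∧ k = l := by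
  constructor
  · intro h
    have h1 : A = B := congrArg (fun m : Mode N => (ofLex m).1) h
    subst h1
    exact ⟨rfl, relabel_injective _ (congrArg (fun m : Mode N => (ofLex m).2) h)⟩
  · rintro ⟨rfl, rfl⟩
    rfl

/-- The fermion operators in terms of the relabelled momenta: `fermi A k` annihilates an
excitation if `0 ≤ k` and creates one if `k < 0`. -/
noncomputable def fermi (A : Species N) (k : ℤ) : Fock N →L[ℂ] Fock N :=
  if 0 ≤ k then annihilate (orbital A k) else create (orbital A k)

/-- The adjoint of `fermi A k`. -/
noncomputable def fermiDag (A : Species N) (k : ℤ) : Fock N →L[ℂ] Fock N :=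
  if 0 ≤ k then create (orbital A k) else annihilate (orbital A k)

theorem adjoint_fermi (A : Species N) (k : ℤ) :
    ContinuousLinearMap.adjoint (fermi A k) = fermiDag A k := by
  unfold fermi fermiDag
  split_ifs
  · rfl
  · exact ContinuousLinearMap.adjoint_adjoint _

theorem fermiDag_inner (A : Species N) (k : ℤ) (u v : Fock N) :
    ⟪fermiDag A k u, v⟫_ℂ = ⟪u, fermi A k v⟫_ℂ := by
  rw [← adjoint_fermi, ContinuousLinearMap.adjoint_inner_left]

theorem fermi_inner (A : Species N) (k : ℤ) (u v : Fock N) :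
    ⟪fermi A k u, v⟫_ℂ = ⟪u, fermiDag A k v⟫_ℂ := by
  rw [← adjoint_fermi, ContinuousLinearMap.adjoint_inner_right]

theorem fermionC_eq_fermi (r s : ℤˣ) (x : Pos N) (n : ℤ) :
    fermionC r s x n = fermi (species r s x) (relabel r n) := by
  have h : 0 < (r : ℤ) * (2 * n + 1) ↔ 0 ≤ relabel r n := by
    rcases Int.units_eq_one_or r with rfl | rfl
    · simp [relabel]
    · have : (-1 : ℤˣ) ≠ 1 := by decide
      simp [relabel, this]
      omega
  have h2 : orbital (species r s x) (relabel r n) = mode (species r s x) n := by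
    unfold orbital
    exact congrArg _ (relabel_relabel r n)
  unfold fermionC fermi
  rw [h2]
  by_cases h0 : 0 ≤ relabel r n
  · rw [if_pos h0, if_pos (h.2 h0)]
  · rw [if_neg h0, if_neg (mt h.1 h0), create]

theorem annihilate_mul_create_add {M : Type*} [LinearOrder M] (m m' : M) :
    annihilate m * create m' + create m' * annihilate m = if m = m' then 1 else 0 := by
  rw [add_comm, create_mul_annihilate_add]
  exact if_congr eq_comm rfl rfl

/-- In the mixed cases one label is nonnegative and the other negative, so the two orbitals differ
and no contraction appears. -/
theorem fermi_anticomm (A B : Species N) (k l : ℤ) :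
    fermi A k * fermi B l + fermi B l * fermi A k = 0 := by
  unfold fermi
  split_ifs
  · exact annihilate_anticomm _ _
  · rw [annihilate_mul_create_add, if_neg]
    rw [orbital_inj]
    omega
  · rw [create_mul_annihilate_add, if_neg]
    rw [orbital_inj]
    omega
  · exact create_anticomm _ _

theorem fermiDag_anticomm (A B : Species N) (k l : ℤ) :
    fermiDag A k * fermiDag B l + fermiDag B l * fermiDag A k = 0 := by
  unfold fermiDag
  split_ifs
  · exact create_anticomm _ _
  · rw [create_mul_annihilate_add, if_neg]
    rw [orbital_inj]
    omega
  · rw [annihilate_mul_create_add, if_neg]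
    rw [orbital_inj]
    omega
  · exact annihilate_anticomm _ _

theorem fermi_mul_fermiDag_add (A B : Species N) (k l : ℤ) :
    fermi A k * fermiDag B l + fermiDag B l * fermi A k = if A = B ∧ k = l then 1 else 0 := by
  unfold fermi fermiDag
  split_ifs with h1 h2 h3 h3 h2 h3 h3
  · rw [annihilate_mul_create_add, if_pos (orbital_inj.2 h3)]
  · rw [annihilate_mul_create_add, if_neg (mt orbital_inj.1 h3)]
  · omega
  · exact annihilate_anticomm _ _
  · omega
  · exact create_anticomm _ _
  · rw [create_mul_annihilate_add, if_pos (orbital_inj.2 h3)]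
  · rw [create_mul_annihilate_add, if_neg (mt orbital_inj.1 h3)]

/-! ### The energy grading -/

/-- Twice the energy of a set of excitations, in units of `2π/L`. -/
def weight (S : Finset (Mode N)) : ℕ := ∑ m ∈ S, (2 * (ofLex m).2 + 1).natAbs

/-- The vectors of weight `m`. -/
noncomputable def graded (N : ℕ) (m : ℤ) : Submodule ℂ (Fock N) :=
  supportedOn {S | (weight S : ℤ) = m}

/-- The vectors whose excitations have labels in `[-M, M)`. -/
noncomputable def window (N : ℕ) (M : ℕ) : Submodule ℂ (Fock N) :=
  supportedOn {S | ∀ m ∈ S, -(M : ℤ) ≤ (ofLex m).2 ∧ (ofLex m).2 < M}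

theorem weight_erase {A : Species N} {k : ℤ} {S : Finset (Mode N)} (h : orbital A k ∈ S) :
    (weight (S.erase (orbital A k)) : ℤ) = weight S - (2 * k + 1).natAbs := by
  have h1 := Finset.add_sum_erase S (fun m => (2 * (ofLex m).2 + 1).natAbs) h
  have h2 : (2 * (ofLex (orbital A k)).2 + 1).natAbs = (2 * k + 1).natAbs := natAbs_relabel _ _
  unfold weight
  rw [← h1, ← h2]
  push_cast
  ring

theorem weight_insert {A : Species N} {k : ℤ} {S : Finset (Mode N)} (h : orbital A k ∉ S) :
    (weight (insert (orbital A k) S) : ℤ) = weight S + (2 * k + 1).natAbs := by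
  have h1 := weight_erase (Finset.mem_insert_self (orbital A k) S)
  rw [Finset.erase_insert h] at h1
  linarith

theorem annihilate_ne_zero {m : Mode N} {v : Fock N} {S : Finset (Mode N)}
    (h : annihilate m v S ≠ 0) : m ∉ S ∧ v (insert m S) ≠ 0 := by
  rw [annihilate_apply] at h
  split_ifs at h with h1
  · exact (h rfl).elim
  · exact ⟨h1, fun h2 => h (by rw [h2, mul_zero])⟩

theorem create_ne_zero {m : Mode N} {v : Fock N} {S : Finset (Mode N)}
    (h : create m v S ≠ 0) : m ∈ S ∧ v (S.erase m) ≠ 0 := by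
  rw [create_apply] at h
  split_ifs at h with h1
  · exact ⟨h1, fun h2 => h (by rw [h2, mul_zero])⟩
  · exact (h rfl).elim

theorem annihilate_mem_graded {A : Species N} {k m : ℤ} {v : Fock N} (hv : v ∈ graded N m) :
    annihilate (orbital A k) v ∈ graded N (m - (2 * k + 1).natAbs) := by
  intro S hS
  obtain ⟨h1, h2⟩ := annihilate_ne_zero hS
  have h3 : (weight (insert (orbital A k) S) : ℤ) = m := hv _ h2
  rw [weight_insert h1] at h3
  change (weight S : ℤ) = _
  omega

theorem create_mem_graded {A : Species N} {k m : ℤ} {v : Fock N} (hv : v ∈ graded N m) :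
    create (orbital A k) v ∈ graded N (m + (2 * k + 1).natAbs) := by
  intro S hS
  obtain ⟨h1, h2⟩ := create_ne_zero hS
  have h3 : (weight (S.erase (orbital A k)) : ℤ) = m := hv _ h2
  rw [weight_erase h1] at h3
  change (weight S : ℤ) = _
  omega

/-- One signed formula covers both cases: for k < 0 the operator creates a hole of weight |2k + 1| =
-(2k + 1). -/
theorem fermi_mem_graded {A : Species N} {k m : ℤ} {v : Fock N} (hv : v ∈ graded N m) :
    fermi A k v ∈ graded N (m - (2 * k + 1)) := by
  unfold fermi
  split_ifs with h
  · convert annihilate_mem_graded hv using 2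
    omega
  · convert create_mem_graded hv using 2
    omega

theorem fermiDag_mem_graded {A : Species N} {k m : ℤ} {v : Fock N} (hv : v ∈ graded N m) :
    fermiDag A k v ∈ graded N (m + (2 * k + 1)) := by
  unfold fermiDag
  split_ifs with h
  · convert create_mem_graded hv using 2
    omega
  · convert annihilate_mem_graded hv using 2
    omega

theorem orbital_mem_window {A : Species N} {k M : ℤ} :
    (-M ≤ (ofLex (orbital A k)).2 ∧ (ofLex (orbital A k)).2 < M) ↔ (-M ≤ k ∧ k < M) :=
  relabel_mem_window _ _ _

theorem window_mono {M M' : ℕ} (h : M ≤ M') : window N M ≤ window N M' := by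
  refine supportedOn_mono fun S hS m hm => ?_
  have := hS m hm
  omega

theorem annihilate_mem_window {m : Mode N} {M : ℕ} {v : Fock N} (hv : v ∈ window N M) :
    annihilate m v ∈ window N M := by
  intro S hS m' hm'
  obtain ⟨-, h2⟩ := annihilate_ne_zero hS
  exact hv _ h2 m' (Finset.mem_insert_of_mem hm')

theorem create_mem_window {A : Species N} {k : ℤ} {M : ℕ} {v : Fock N} (hv : v ∈ window N M)
    (h1 : -(M : ℤ) ≤ k) (h2 : k < M) : create (orbital A k) v ∈ window N M := by
  intro S hS m' hm'
  obtain ⟨-, h3⟩ := create_ne_zero hS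
  by_cases h : m' = orbital A k
  · rw [h]
    exact orbital_mem_window.2 ⟨h1, h2⟩
  · exact hv _ h3 m' (Finset.mem_erase.2 ⟨h, hm'⟩)

theorem fermi_mem_window {A : Species N} {k : ℤ} {M : ℕ} {v : Fock N} (hv : v ∈ window N M)
    (h1 : -(M : ℤ) ≤ k) (h2 : k < M) : fermi A k v ∈ window N M := by
  unfold fermi
  split_ifs
  · exact annihilate_mem_window hv
  · exact create_mem_window hv h1 h2

theorem fermiDag_mem_window {A : Species N} {k : ℤ} {M : ℕ} {v : Fock N} (hv : v ∈ window N M)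
    (h1 : -(M : ℤ) ≤ k) (h2 : k < M) : fermiDag A k v ∈ window N M := by
  unfold fermiDag
  split_ifs
  · exact create_mem_window hv h1 h2
  · exact annihilate_mem_window hv

theorem annihilate_eq_zero {A : Species N} {k : ℤ} {M : ℕ} {v : Fock N} (hv : v ∈ window N M)
    (h : ¬ (-(M : ℤ) ≤ k ∧ k < M)) : annihilate (orbital A k) v = 0 := by
  ext S
  by_contra h0
  obtain ⟨-, h2⟩ := annihilate_ne_zero h0
  exact h (orbital_mem_window.1 (hv _ h2 _ (Finset.mem_insert_self _ _)))

theorem fermi_eq_zero {A : Species N} {k : ℤ} {M : ℕ} {v : Fock N} (hv : v ∈ window N M)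
    (h : (M : ℤ) ≤ k) : fermi A k v = 0 := by
  unfold fermi
  rw [if_pos (by omega)]
  exact annihilate_eq_zero hv (by omega)

theorem fermiDag_eq_zero {A : Species N} {k : ℤ} {M : ℕ} {v : Fock N} (hv : v ∈ window N M)
    (h : k < -(M : ℤ)) : fermiDag A k v = 0 := by
  unfold fermiDag
  rw [if_neg (by omega)]
  exact annihilate_eq_zero hv (by omega)

theorem vacuum_mem_window : vacuum N ∈ window N 0 :=
  single_mem_supportedOn (by intro m hm; simp at hm) _

/-- Vectors with finitely many nonzero coordinates. -/
noncomputable def finiteVectors (N : ℕ) : Submodule ℂ (Fock N) where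
  carrier := {v | ∃ M, v ∈ window N M}
  zero_mem' := ⟨0, zero_mem _⟩
  add_mem' := by
    rintro v w ⟨M, hv⟩ ⟨M', hw⟩
    exact ⟨max M M', add_mem (window_mono (le_max_left _ _) hv)
      (window_mono (le_max_right _ _) hw)⟩
  smul_mem' := by
    rintro c v ⟨M, hv⟩
    exact ⟨M, Submodule.smul_mem _ c hv⟩

theorem window_le_finiteVectors (M : ℕ) : window N M ≤ finiteVectors N := fun _ hv => ⟨M, hv⟩

theorem natAbs_le_weight {S : Finset (Mode N)} {m : Mode N} (h : m ∈ S) :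
    (2 * (ofLex m).2 + 1).natAbs ≤ weight S :=
  Finset.single_le_sum (f := fun m : Mode N => (2 * (ofLex m).2 + 1).natAbs)
    (fun _ _ => Nat.zero_le _) h

theorem graded_le_window (m : ℕ) : graded N m ≤ window N m := by
  refine supportedOn_mono fun S hS m' hm' => ?_
  have h1 := natAbs_le_weight hm'
  have h2 : (weight S : ℤ) = m := hS
  omega

theorem graded_le_finiteVectors (m : ℕ) : graded N m ≤ finiteVectors N :=
  (graded_le_window m).trans (window_le_finiteVectors _)

theorem graded_eq_bot {m : ℤ} (hm : m < 0) {v : Fock N} (hv : v ∈ graded N m) : v = 0 := by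
  ext S
  by_contra h
  have : (weight S : ℤ) = m := hv S h
  omega

theorem finite_window_modes (M : ℕ) :
    {m : Mode N | -(M : ℤ) ≤ (ofLex m).2 ∧ (ofLex m).2 < M}.Finite := by
  have : Finite (Species N) := inferInstanceAs (Finite (ℤˣ × ℤˣ × Pos N))
  have h := (Set.finite_univ (α := Species N)).prod (Set.finite_Icc (-(M : ℤ)) M)
  refine (h.image toLex).subset fun m hm => ⟨ofLex m, ⟨Set.mem_univ _, ?_⟩, rfl⟩
  have h1 : -(M : ℤ) ≤ (ofLex m).2 ∧ (ofLex m).2 < M := hm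
  exact ⟨h1.1, h1.2.le⟩

theorem finite_window (M : ℕ) :
    {S : Finset (Mode N) | ∀ m ∈ S, -(M : ℤ) ≤ (ofLex m).2 ∧ (ofLex m).2 < M}.Finite := by
  refine ((finite_window_modes M).toFinset.powerset.finite_toSet).subset fun S hS => ?_
  rw [Finset.mem_coe, Finset.mem_powerset]
  intro m hm
  rw [Set.Finite.mem_toFinset]
  exact hS m hm

/-- Every mode contributes at least 1 to the weight and there are finitely many species, so bounded
weight confines the configuration to finitely many modes. -/
theorem finite_weight_le (m : ℕ) : {S : Finset (Mode N) | weight S ≤ m}.Finite := by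
  refine (finite_window m).subset fun S hS m' hm' => ?_
  have h1 := natAbs_le_weight hm'
  have h2 : weight S ≤ m := hS
  omega

theorem exists_window (S : Finset (Mode N)) :
    ∃ M : ℕ, ∀ m ∈ S, -(M : ℤ) ≤ (ofLex m).2 ∧ (ofLex m).2 < M := by
  refine ⟨weight S, fun m hm => ?_⟩
  have h1 := natAbs_le_weight hm
  omega

theorem supportedOn_le_finiteVectors {P : Set (Finset (Mode N))} (hP : P.Finite) :
    supportedOn P ≤ finiteVectors N := by
  choose f hf using exists_window (N := N)
  obtain ⟨M, hM⟩ := (hP.image f).bddAbove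
  refine (supportedOn_mono fun S hS m hm => ?_).trans (window_le_finiteVectors M)
  have h1 := hf S m hm
  have h2 := hM (Set.mem_image_of_mem f hS)
  omega

theorem dense_finiteVectors : Dense (finiteVectors N : Set (Fock N)) :=
  dense_of_single_mem fun _ => supportedOn_le_finiteVectors

end Mattis

namespace Mattis

/-! ### Bilinears in a finite number of fermion operators -/

section FermionAlgebra

variable {R : Type*} [Ring R] {ι : Type*} [DecidableEq ι] {c d : ι → R}

/-- The quartic parts of the two normal-ordered products agree, so only the single contractions
survive. -/
theorem bilinear_commutator
    (hc : ∀ k l, c k * c l + c l * c k = 0) (hd : ∀ k l, d k * d l + d l * d k = 0)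
    (hcd : ∀ k l, c k * d l + d l * c k = if k = l then 1 else 0) (i j k l : ι) :
    (d i * c j) * (d k * c l) - (d k * c l) * (d i * c j)
      = (if j = k then d i * c l else 0) - (if i = l then d k * c j else 0) := by
  have h1 : c j * d k = (if j = k then 1 else 0) - d k * c j := eq_sub_of_add_eq (hcd j k)
  have h2 : c l * d i = (if l = i then 1 else 0) - d i * c l := eq_sub_of_add_eq (hcd l i)
  have h3 : c j * c l = -(c l * c j) := eq_neg_of_add_eq_zero_left (hc j l)
  have h4 : d i * d k = -(d k * d i) := eq_neg_of_add_eq_zero_left (hd i k)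
  have e1 : (d i * c j) * (d k * c l)
      = (if j = k then d i * c l else 0) - d k * d i * (c l * c j) := by
    calc (d i * c j) * (d k * c l) = d i * (c j * d k) * c l := by noncomm_ring
      _ = d i * (if j = k then 1 else 0) * c l - (d i * d k) * (c j * c l) := by
          rw [h1]; noncomm_ring
      _ = _ := by
          rw [h3, h4]
          split_ifs <;> noncomm_ring
  have e2 : (d k * c l) * (d i * c j)
      = (if i = l then d k * c j else 0) - d k * d i * (c l * c j) := by
    calc (d k * c l) * (d i * c j) = d k * (c l * d i) * c j := by noncomm_ring
      _ = d k * (if l = i then 1 else 0) * c j - (d k * d i) * (c l * c j) := by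
          rw [h2]; noncomm_ring
      _ = _ := by
          rw [if_congr (eq_comm (a := l)) rfl rfl]
          split_ifs <;> noncomm_ring
  rw [e1, e2]
  abel

end FermionAlgebra

/-! ### Densities of a finite chain and the Kronig identity. -/

section Chain

variable {R : Type*} [Ring R] {c d : ℤ → R}

/-- The density `∑ d_k c_{k+p}` of a finite chain. -/
def chainDensity (c d : ℤ → R) (W : Finset ℤ) (p : ℤ) : R :=
  ∑ k ∈ W, ∑ l ∈ W, if l - k = p then d k * c l else 0

theorem sum_pair_comm (W : Finset ℤ) (f : ℤ → ℤ → ℤ → ℤ → R) :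
    ∑ i ∈ W, ∑ j ∈ W, ∑ k ∈ W, ∑ l ∈ W, f i j k l
      = ∑ k ∈ W, ∑ l ∈ W, ∑ i ∈ W, ∑ j ∈ W, f i j k l := by
  rw [Finset.sum_congr rfl fun i _ => Finset.sum_comm, Finset.sum_comm]
  refine Finset.sum_congr rfl fun k _ => ?_
  rw [Finset.sum_congr rfl fun i _ => Finset.sum_comm, Finset.sum_comm]

theorem chainDensity_mul (W : Finset ℤ) (a b : ℤ) :
    chainDensity c d W a * chainDensity c d W b
      = ∑ i ∈ W, ∑ j ∈ W, ∑ k ∈ W, ∑ l ∈ W,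
        if j - i = a ∧ l - k = b then (d i * c j) * (d k * c l) else 0 := by
  unfold chainDensity
  rw [Finset.sum_mul]
  refine Finset.sum_congr rfl fun i _ => ?_
  rw [Finset.sum_mul]
  refine Finset.sum_congr rfl fun j _ => ?_
  rw [Finset.mul_sum]
  refine Finset.sum_congr rfl fun k _ => ?_
  rw [Finset.mul_sum]
  refine Finset.sum_congr rfl fun l _ => ?_
  by_cases h1 : j - i = a <;> by_cases h2 : l - k = b <;> simp [h1, h2]

/-- In each order of the factors the hop by p + q goes through an intermediate site, i + p or i + q.
Without a cutoff the two contributions would cancel; in a finite chain only the membership of these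
sites in `W` distinguishes them. -/
theorem chainDensity_mul_sub
    (hc : ∀ k l, c k * c l + c l * c k = 0) (hd : ∀ k l, d k * d l + d l * d k = 0)
    (hcd : ∀ k l, c k * d l + d l * c k = if k = l then 1 else 0) (W : Finset ℤ) (p q : ℤ) :
    chainDensity c d W p * chainDensity c d W q - chainDensity c d W q * chainDensity c d W p
      = ∑ i ∈ W, ∑ l ∈ W, if l - i = p + q then
          (if i + p ∈ W then d i * c l else 0) - (if i + q ∈ W then d i * c l else 0) else 0 := by
  have e' : chainDensity c d W q * chainDensity c d W p
      = ∑ i ∈ W, ∑ j ∈ W, ∑ k ∈ W, ∑ l ∈ W,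
        if j - i = p ∧ l - k = q then (d k * c l) * (d i * c j) else 0 := by
    rw [chainDensity_mul, sum_pair_comm]
    refine Finset.sum_congr rfl fun i _ => Finset.sum_congr rfl fun j _ =>
      Finset.sum_congr rfl fun k _ => Finset.sum_congr rfl fun l _ => ?_
    exact if_congr and_comm rfl rfl
  rw [chainDensity_mul, e', ← Finset.sum_sub_distrib]
  simp_rw [← Finset.sum_sub_distrib]
  have h : ∀ i j k l : ℤ,
      ((if j - i = p ∧ l - k = q then (d i * c j) * (d k * c l) else 0)
        - if j - i = p ∧ l - k = q then (d k * c l) * (d i * c j) else 0)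
      = (if j = k then (if j - i = p ∧ l - k = q then d i * c l else 0) else 0)
        - (if i = l then (if j - i = p ∧ l - k = q then d k * c j else 0) else 0) := by
    intro i j k l
    by_cases h0 : j - i = p ∧ l - k = q
    · simp only [if_pos h0]
      exact bilinear_commutator hc hd hcd i j k l
    · simp only [if_neg h0, ite_self]
  simp_rw [h, Finset.sum_sub_distrib]
  have s1 : ∑ i ∈ W, ∑ j ∈ W, ∑ k ∈ W, ∑ l ∈ W,
        (if j = k then (if j - i = p ∧ l - k = q then d i * c l else 0) else 0)
      = ∑ i ∈ W, ∑ l ∈ W, if l - i = p + q then (if i + p ∈ W then d i * c l else 0) else 0 := by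
    refine Finset.sum_congr rfl fun i _ => ?_
    rw [Finset.sum_congr rfl fun j _ => Finset.sum_comm, Finset.sum_comm]
    refine Finset.sum_congr rfl fun l _ => ?_
    have : ∀ j ∈ W, (∑ k ∈ W,
        if j = k then (if j - i = p ∧ l - k = q then d i * c l else 0) else 0)
        = if i + p = j then (if l - i = p + q then d i * c l else 0) else 0 := by
      intro j hj
      rw [Finset.sum_ite_eq, if_pos hj]
      rw [← ite_and]
      refine if_congr ?_ rfl rfl
      omega
    rw [Finset.sum_congr rfl this, Finset.sum_ite_eq]
    split_ifs <;> rfl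
  have s2 : ∑ i ∈ W, ∑ j ∈ W, ∑ k ∈ W, ∑ l ∈ W,
        (if i = l then (if j - i = p ∧ l - k = q then d k * c j else 0) else 0)
      = ∑ i ∈ W, ∑ l ∈ W, if l - i = p + q then (if i + q ∈ W then d i * c l else 0) else 0 := by
    rw [Finset.sum_congr rfl fun i _ => Finset.sum_comm, Finset.sum_comm]
    refine Finset.sum_congr rfl fun k _ => ?_
    rw [Finset.sum_comm]
    refine Finset.sum_congr rfl fun j _ => ?_
    have : ∀ i ∈ W, (∑ l ∈ W,
        if i = l then (if j - i = p ∧ l - k = q then d k * c j else 0) else 0)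
        = if k + q = i then (if j - k = p + q then d k * c j else 0) else 0 := by
      intro i hi
      rw [Finset.sum_ite_eq, if_pos hi]
      rw [← ite_and]
      refine if_congr ?_ rfl rfl
      omega
    rw [Finset.sum_congr rfl this, Finset.sum_ite_eq]
    split_ifs <;> rfl
  rw [s1, s2, ← Finset.sum_sub_distrib]
  refine Finset.sum_congr rfl fun i _ => ?_
  rw [← Finset.sum_sub_distrib]
  refine Finset.sum_congr rfl fun l _ => ?_
  split_ifs <;> simp

/-- On an interval, the densities at positive momenta commute. -/
theorem chainDensity_comm
    (hc : ∀ k l, c k * c l + c l * c k = 0) (hd : ∀ k l, d k * d l + d l * d k = 0)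
    (hcd : ∀ k l, c k * d l + d l * c k = if k = l then 1 else 0) (a b : ℤ) {p q : ℤ}
    (hp : 0 < p) (hq : 0 < q) :
    chainDensity c d (Finset.Ico a b) p * chainDensity c d (Finset.Ico a b) q
      = chainDensity c d (Finset.Ico a b) q * chainDensity c d (Finset.Ico a b) p := by
  rw [← sub_eq_zero, chainDensity_mul_sub hc hd hcd]
  -- For p, q > 0 both intermediate sites lie between i and l, hence in the interval, and the
  -- difference vanishes.
  refine Finset.sum_eq_zero fun i hi => Finset.sum_eq_zero fun l hl => ?_
  rw [Finset.mem_Ico] at hi hl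
  split_ifs with h h1 h2 h2
  · simp
  · exact (h2 (Finset.mem_Ico.2 (by omega))).elim
  · exact (h1 (Finset.mem_Ico.2 (by omega))).elim
  · simp
  · rfl

/-- The Kronig identity for a finite chain. -/
theorem kronig_chain
    (hc : ∀ k l, c k * c l + c l * c k = 0) (hd : ∀ k l, d k * d l + d l * d k = 0)
    (hcd : ∀ k l, c k * d l + d l * c k = if k = l then 1 else 0) (M : ℕ)
    (h2 : ∀ x : R, x + x = 0 → x = 0) :
    2 * ∑ p ∈ Finset.Ioo (0 : ℤ) (2 * M),
        chainDensity c d (Finset.Ico (-M : ℤ) M) (-p) * chainDensity c d (Finset.Ico (-M : ℤ) M) p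
      = (∑ k ∈ Finset.Ico (-M : ℤ) M, (2 * (k + M) + 1) • (d k * c k))
        - (∑ k ∈ Finset.Ico (-M : ℤ) M, d k * c k) ^ 2 := by
  set W := Finset.Ico (-M : ℤ) M with hW
  have hW' : ∀ k, k ∈ W ↔ -(M : ℤ) ≤ k ∧ k < M := fun k => Finset.mem_Ico
  -- The quartic term restricted to momentum conservation, antisymmetric in (a, b) and in (e, g).
  let X : ℤ → ℤ → ℤ → ℤ → R := fun a b e g =>
    if a + b = e + g then d a * d b * (c e * c g) else 0
  have hXab : ∀ a b e g, X b a e g = -X a b e g := by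
    intro a b e g
    simp only [X, add_comm b a, eq_neg_of_add_eq_zero_left (hd b a)]
    split_ifs <;> simp
  have hXeg : ∀ a b e g, X a b g e = -X a b e g := by
    intro a b e g
    simp only [X, add_comm g e, eq_neg_of_add_eq_zero_left (hc g e)]
    split_ifs <;> simp
  -- Summing over p removes the individual shifts and leaves the condition p = a - g > 0; the range
  -- (0, 2M) contains every such difference in the window.
  have step1 : ∑ p ∈ Finset.Ioo (0 : ℤ) (2 * M), chainDensity c d W (-p) * chainDensity c d W p
      = ∑ a ∈ W, ∑ g ∈ W, ∑ b ∈ W, ∑ e ∈ W,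
        if g < a ∧ a + b = e + g then (d a * c g) * (d b * c e) else 0 := by
    simp only [chainDensity_mul]
    rw [Finset.sum_comm]
    refine Finset.sum_congr rfl fun a ha => ?_
    rw [Finset.sum_comm]
    refine Finset.sum_congr rfl fun g hg => ?_
    rw [Finset.sum_comm]
    refine Finset.sum_congr rfl fun b _ => ?_
    rw [Finset.sum_comm]
    refine Finset.sum_congr rfl fun e _ => ?_
    rw [hW'] at ha hg
    have : ∀ p ∈ Finset.Ioo (0 : ℤ) (2 * M),
        (if g - a = -p ∧ e - b = p then (d a * c g) * (d b * c e) else 0)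
        = if a - g = p then (if a + b = e + g then (d a * c g) * (d b * c e) else 0) else 0 := by
      intro p _
      rw [← ite_and]
      exact if_congr (by omega) rfl rfl
    rw [Finset.sum_congr rfl this, Finset.sum_ite_eq, ← ite_and]
    refine if_congr ?_ rfl rfl
    rw [Finset.mem_Ioo]
    omega
  have step2 : ∀ a g b e : ℤ, (if g < a ∧ a + b = e + g then (d a * c g) * (d b * c e) else 0)
      = (if g < a ∧ a = e ∧ g = b then d a * c a else 0) + if g < a then X a b e g else 0 := by
    intro a g b e
    by_cases h : g < a ∧ a + b = e + g
    · have e1 : (d a * c g) * (d b * c e)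
          = (if g = b then d a * c e else 0) + d a * d b * (c e * c g) := by
        have h1 : c g * d b = (if g = b then 1 else 0) - d b * c g := eq_sub_of_add_eq (hcd g b)
        have h3 : c g * c e = -(c e * c g) := eq_neg_of_add_eq_zero_left (hc g e)
        calc (d a * c g) * (d b * c e) = d a * (c g * d b) * c e := by noncomm_ring
          _ = d a * (if g = b then 1 else 0) * c e - d a * d b * (c g * c e) := by
              rw [h1]; noncomm_ring
          _ = _ := by
              rw [h3]
              split_ifs <;> noncomm_ring
      simp only [X]
      rw [if_pos h, if_pos h.1, if_pos h.2, e1]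
      by_cases hgb : g = b
      · have : a = e := by omega
        subst this
        rw [if_pos hgb, if_pos ⟨h.1, rfl, hgb⟩]
      · rw [if_neg hgb, if_neg fun h => hgb h.2.2]
    · rw [if_neg h, if_neg (by omega)]
      simp only [X]
      rw [← ite_and, if_neg h, add_zero]
  have step3 : ∑ a ∈ W, ∑ g ∈ W, ∑ b ∈ W, ∑ e ∈ W,
      (if g < a ∧ a = e ∧ g = b then d a * c a else 0)
      = ∑ a ∈ W, (a + M) • (d a * c a) := by
    refine Finset.sum_congr rfl fun a ha => ?_
    have : ∀ g ∈ W, (∑ b ∈ W, ∑ e ∈ W, if g < a ∧ a = e ∧ g = b then d a * c a else 0)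
        = if g < a then d a * c a else 0 := by
      intro g hg
      simp only [ite_and, apply_ite]
      split_ifs with h
      · rw [Finset.sum_congr rfl fun b _ => Finset.sum_ite_eq W a _]
        simp [ha, hg]
      · simp
    rw [Finset.sum_congr rfl this, ← Finset.sum_filter, Finset.sum_const]
    have hfil : W.filter (fun g => g < a) = Finset.Ico (-M : ℤ) a := by
      ext g
      rw [Finset.mem_filter, hW', Finset.mem_Ico]
      rw [hW'] at ha
      omega
    rw [hfil, Int.card_Ico, ← natCast_zsmul]
    congr 1
    rw [hW'] at ha
    omega
  -- Antisymmetry only shows that the sum equals its negative; the absence of 2-torsion gives zero.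
  have step4 : ∑ a ∈ W, ∑ b ∈ W, (∑ g ∈ W, ∑ e ∈ W, X a b e g) = 0 := by
    apply h2
    nth_rw 1 [Finset.sum_comm]
    simp only [← Finset.sum_add_distrib]
    refine Finset.sum_eq_zero fun a _ => Finset.sum_eq_zero fun b _ => Finset.sum_eq_zero
      fun g _ => Finset.sum_eq_zero fun e _ => ?_
    rw [hXab]
    simp
  have step5 : ∑ a ∈ W, ∑ b ∈ W, ∑ g ∈ W, ∑ e ∈ W, (if a = e then X a b e g else 0)
      = ∑ a ∈ W, d a * c a - (∑ a ∈ W, d a * c a) ^ 2 := by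
    rw [sq, Finset.sum_mul_sum, ← Finset.sum_sub_distrib]
    refine Finset.sum_congr rfl fun a ha => ?_
    have : ∀ b ∈ W, (∑ g ∈ W, ∑ e ∈ W, if a = e then X a b e g else 0)
        = (if a = b then d a * c b else 0) - (d a * c a) * (d b * c b) := by
      intro b hb
      have h3 : ∀ g ∈ W, (∑ e ∈ W, if a = e then X a b e g else 0)
          = if b = g then d a * d b * (c a * c b) else 0 := by
        intro g _
        rw [Finset.sum_ite_eq, if_pos ha]
        simp only [X]
        by_cases hbg : b = g
        · rw [if_pos (by rw [hbg]), if_pos hbg, hbg]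
        · rw [if_neg (by omega), if_neg hbg]
      rw [Finset.sum_congr rfl h3, Finset.sum_ite_eq, if_pos hb]
      have h1 : d b * c a = (if a = b then 1 else 0) - c a * d b :=
        eq_sub_of_add_eq' (hcd a b)
      calc d a * d b * (c a * c b) = d a * (d b * c a) * c b := by noncomm_ring
        _ = _ := by
          rw [h1]
          split_ifs <;> noncomm_ring
    rw [Finset.sum_congr rfl this, Finset.sum_sub_distrib, Finset.sum_ite_eq, if_pos ha]
  -- Exchanging e and g turns the condition g < a into e < a; exchanging a and b turns it into g <
  -- b, which by momentum conservation is a < e. Each exchange costs a sign, so twice the sum is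
  -- minus the part of the vanishing total with a ≠ e, that is, the part with a = e.
  have step6 : 2 * ∑ a ∈ W, ∑ g ∈ W, ∑ b ∈ W, ∑ e ∈ W, (if g < a then X a b e g else 0)
      = ∑ a ∈ W, d a * c a - (∑ a ∈ W, d a * c a) ^ 2 := by
    have r0 : ∑ a ∈ W, ∑ g ∈ W, ∑ b ∈ W, ∑ e ∈ W, (if g < a then X a b e g else 0)
        = ∑ a ∈ W, ∑ b ∈ W, ∑ g ∈ W, ∑ e ∈ W, (if g < a then X a b e g else 0) :=
      Finset.sum_congr rfl fun a _ => Finset.sum_comm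
    have r1 : ∑ a ∈ W, ∑ b ∈ W, ∑ g ∈ W, ∑ e ∈ W, (if g < a then X a b e g else 0)
        = -∑ a ∈ W, ∑ b ∈ W, ∑ g ∈ W, ∑ e ∈ W, (if e < a then X a b e g else 0) := by
      simp only [← Finset.sum_neg_distrib]
      refine Finset.sum_congr rfl fun a _ => Finset.sum_congr rfl fun b _ => ?_
      rw [Finset.sum_comm]
      refine Finset.sum_congr rfl fun g _ => Finset.sum_congr rfl fun e _ => ?_
      rw [hXeg]
      split_ifs <;> simp
    have r2 : ∑ a ∈ W, ∑ b ∈ W, ∑ g ∈ W, ∑ e ∈ W, (if g < a then X a b e g else 0)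
        = -∑ a ∈ W, ∑ b ∈ W, ∑ g ∈ W, ∑ e ∈ W, (if a < e then X a b e g else 0) := by
      rw [Finset.sum_comm]
      simp only [← Finset.sum_neg_distrib]
      refine Finset.sum_congr rfl fun a _ => Finset.sum_congr rfl fun b _ =>
        Finset.sum_congr rfl fun g _ => Finset.sum_congr rfl fun e _ => ?_
      rw [hXab]
      simp only [X]
      by_cases h : a + b = e + g
      · simp only [if_pos h]
        by_cases h' : g < b
        · rw [if_pos h', if_pos (by omega)]
        · rw [if_neg h', if_neg (by omega), neg_zero]
      · simp [h]
    rw [r0, two_mul]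
    nth_rw 1 [r1]
    rw [r2, ← step5, ← neg_add, neg_eq_iff_add_eq_zero]
    refine Eq.trans ?_ step4
    simp only [← Finset.sum_add_distrib]
    refine Finset.sum_congr rfl fun a _ => Finset.sum_congr rfl fun b _ =>
      Finset.sum_congr rfl fun g _ => Finset.sum_congr rfl fun e _ => ?_
    rcases lt_trichotomy a e with h | h | h
    · simp [h, h.not_gt, h.ne]
    · simp [h]
    · simp [h, h.not_gt, h.ne']
  rw [step1]
  simp only [step2, Finset.sum_add_distrib]
  rw [step3, mul_add, step6, ← add_sub_assoc, Finset.mul_sum, ← Finset.sum_add_distrib]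
  congr 1
  refine Finset.sum_congr rfl fun a _ => ?_
  simp only [zsmul_eq_mul]
  push_cast
  noncomm_ring

end Chain

end Mattis

open scoped InnerProductSpace lp

namespace Mattis

/-! ### Occupation numbers and coordinatewise estimates. -/

theorem create_annihilate_apply {M : Type*} [LinearOrder M] (m : M) (v : ℓ²(Finset M, ℂ))
    (S : Finset M) : create m (annihilate m v) S = if m ∈ S then v S else 0 := by
  rw [create_apply, annihilate_apply]
  by_cases hS : m ∈ S
  · rw [if_pos hS, if_pos hS, if_neg (Finset.notMem_erase _ _), Finset.insert_erase hS,
      jwSign_erase_self, ← mul_assoc, jwSign_mul_self, one_mul]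
  · rw [if_neg hS, if_neg hS]

theorem annihilate_create_apply {M : Type*} [LinearOrder M] (m : M) (v : ℓ²(Finset M, ℂ))
    (S : Finset M) : annihilate m (create m v) S = if m ∈ S then 0 else v S := by
  rw [annihilate_apply, create_apply]
  split_ifs with hS h
  · rfl
  · rw [Finset.erase_insert hS, jwSign_insert_self, ← mul_assoc, jwSign_mul_self, one_mul]
  · exact (h (Finset.mem_insert_self _ _)).elim

theorem re_inner_ofReal_mul_self (z : ℂ) (c : ℝ) : (⟪z, (c : ℂ) * z⟫_ℂ).re = c * ‖z‖ ^ 2 := by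
  have h : ⟪z, (c : ℂ) * z⟫_ℂ = ((c * ‖z‖ ^ 2 : ℝ) : ℂ) := by
    rw [← smul_eq_mul, inner_smul_right, inner_self_eq_norm_sq_to_K]
    push_cast
    rfl
  rw [h, Complex.ofReal_re]

/-- Integrated form of a pointwise bound; it turns bounds on the eigenvalues of a diagonal operator
into bounds on its quadratic form. -/
theorem re_inner_le_of_pointwise {ι : Type*} {u g v : ℓ²(ι, ℂ)} {C : ℝ}
    (h : ∀ i, (⟪u i, g i⟫_ℂ).re ≤ C * ‖v i‖ ^ 2) : (⟪u, g⟫_ℂ).re ≤ C * ‖v‖ ^ 2 := by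
  have h1 := Complex.hasSum_re (lp.hasSum_inner (𝕜 := ℂ) u g)
  have h2 := Complex.hasSum_re (lp.hasSum_inner (𝕜 := ℂ) v v)
  have h3 : (⟪v, v⟫_ℂ).re = ‖v‖ ^ 2 := by
    rw [inner_self_eq_norm_sq_to_K]
    norm_cast
  rw [h3] at h2
  refine hasSum_le (fun i => ?_) h1 (h2.mul_left C)
  refine (h i).trans (le_of_eq ?_)
  rw [inner_self_eq_norm_sq_to_K]
  norm_cast

variable {N : ℕ}

/-! ### Normal ordered pairs -/

/-- The normal ordered product of `fermiDag A k` and `fermi B l`. -/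
noncomputable def normalPair (A : Species N) (k : ℤ) (B : Species N) (l : ℤ) :
    Fock N →L[ℂ] Fock N :=
  fermiDag A k * fermi B l - ⟪vacuum N, fermiDag A k (fermi B l (vacuum N))⟫_ℂ • 1

theorem normalPair_apply (A : Species N) (k : ℤ) (B : Species N) (l : ℤ) (v : Fock N) :
    normalPair A k B l v = fermiDag A k (fermi B l v)
      - ⟪vacuum N, fermiDag A k (fermi B l (vacuum N))⟫_ℂ • v := rfl

theorem norm_vacuum : ‖vacuum N‖ = 1 := by
  rw [vacuum, lp.norm_single (by norm_num)]
  simp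

theorem vacuum_mem_graded : vacuum N ∈ graded N 0 :=
  single_mem_supportedOn (by simp [weight]) _

theorem fermi_vacuum {A : Species N} {k : ℤ} (h : 0 ≤ k) : fermi A k (vacuum N) = 0 :=
  fermi_eq_zero vacuum_mem_window (by simpa using h)

theorem fermiDag_vacuum {A : Species N} {k : ℤ} (h : k < 0) : fermiDag A k (vacuum N) = 0 :=
  fermiDag_eq_zero vacuum_mem_window (by simpa using h)

theorem fermiDag_fermi_apply (A B : Species N) (k l : ℤ) (v : Fock N) :
    fermiDag A k (fermi B l v) = (if A = B ∧ k = l then v else 0) - fermi B l (fermiDag A k v) := by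
  have h := DFunLike.congr_fun (fermi_mul_fermiDag_add B A l k) v
  change fermi B l (fermiDag A k v) + fermiDag A k (fermi B l v) = _ at h
  rw [eq_sub_iff_add_eq, add_comm, h]
  by_cases h1 : A = B ∧ k = l
  · rw [if_pos h1, if_pos ⟨h1.1.symm, h1.2.symm⟩]
    rfl
  · rw [if_neg h1, if_neg fun h2 => h1 ⟨h2.1.symm, h2.2.symm⟩]
    rfl

theorem normalPair_eq_zero_of_le {A B : Species N} {k l : ℤ} {M : ℕ} {v : Fock N}
    (hv : v ∈ window N M) (h : (M : ℤ) ≤ l) : normalPair A k B l v = 0 := by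
  rw [normalPair_apply, fermi_eq_zero hv h, fermi_vacuum (by omega)]
  simp

/-- Deep in the sea `fermiDag` kills both `v` and the vacuum. Anticommuting it to the right leaves
only the contraction, which the subtracted expectation value cancels. -/
theorem normalPair_eq_zero_of_lt {A B : Species N} {k l : ℤ} {M : ℕ} {v : Fock N}
    (hv : v ∈ window N M) (h : k < -(M : ℤ)) : normalPair A k B l v = 0 := by
  rw [normalPair_apply, fermiDag_fermi_apply, fermiDag_fermi_apply, fermiDag_eq_zero hv h,
    fermiDag_vacuum (by omega)]
  split_ifs <;> simp [norm_vacuum]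

theorem vacuum_expectation_eq_zero {A B : Species N} {k l : ℤ} (h : k ≠ l) :
    ⟪vacuum N, fermiDag A k (fermi B l (vacuum N))⟫_ℂ = 0 := by
  refine inner_eq_zero_of_supportedOn ?_ vacuum_mem_graded
    (fermiDag_mem_graded (fermi_mem_graded vacuum_mem_graded))
  rw [Set.disjoint_left]
  intro S h1 h2
  have h1' : (weight S : ℤ) = 0 := h1
  have h2' : (weight S : ℤ) = 0 - (2 * l + 1) + (2 * k + 1) := h2
  omega

theorem normalPair_of_ne {A B : Species N} {k l : ℤ} (h : k ≠ l) :
    normalPair A k B l = fermiDag A k * fermi B l := by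
  rw [normalPair, vacuum_expectation_eq_zero h, zero_smul, sub_zero]

theorem normalPair_self (A : Species N) (k : ℤ) :
    normalPair A k A k = fermiDag A k * fermi A k - (if k < 0 then 1 else 0) := by
  have h : ⟪vacuum N, fermiDag A k (fermi A k (vacuum N))⟫_ℂ = if k < 0 then 1 else 0 := by
    split_ifs with h
    · rw [fermiDag_fermi_apply, fermiDag_vacuum h]
      simp [norm_vacuum]
    · rw [fermi_vacuum (by omega)]
      simp
  rw [normalPair, h]
  split_ifs <;> simp

theorem normalPair_mem_graded {A B : Species N} {k l m : ℤ} {v : Fock N} (hv : v ∈ graded N m) :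
    normalPair A k B l v ∈ graded N (m + 2 * (k - l)) := by
  have h1 : fermiDag A k (fermi B l v) ∈ graded N (m + 2 * (k - l)) := by
    convert fermiDag_mem_graded (fermi_mem_graded hv) using 2
    ring
  by_cases h : k = l
  · subst h
    refine sub_mem h1 (Submodule.smul_mem _ _ ?_)
    simpa using hv
  · rw [normalPair_of_ne h]
    exact h1

theorem normalPair_mem_window {A B : Species N} {k l : ℤ} {M M' : ℕ} {v : Fock N}
    (hv : v ∈ window N M) (hM : M ≤ M') (h1 : -(M' : ℤ) ≤ k) (h2 : k < M') (h3 : -(M' : ℤ) ≤ l)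
    (h4 : l < M') : normalPair A k B l v ∈ window N M' :=
  sub_mem (fermiDag_mem_window (fermi_mem_window (window_mono hM hv) h3 h4) h1 h2)
    (Submodule.smul_mem _ _ (window_mono hM hv))

theorem normalPair_inner (A B : Species N) (k l : ℤ) (u v : Fock N) :
    ⟪normalPair A k B l u, v⟫_ℂ = ⟪u, normalPair B l A k v⟫_ℂ := by
  rw [normalPair_apply, normalPair_apply, inner_sub_left, inner_sub_right, fermiDag_inner,
    fermi_inner, inner_smul_left, inner_smul_right, inner_conj_symm, fermiDag_inner, fermi_inner]

theorem normalPair_mem_finiteVectors {A B : Species N} {k l : ℤ} {v : Fock N}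
    (hv : v ∈ finiteVectors N) : normalPair A k B l v ∈ finiteVectors N := by
  obtain ⟨M, hM⟩ := hv
  exact ⟨M + k.natAbs + l.natAbs + 1, normalPair_mem_window hM (by omega) (by omega) (by omega)
    (by omega) (by omega)⟩

theorem graded_le_finiteVectors' (m : ℤ) : graded N m ≤ finiteVectors N := by
  intro v hv
  by_cases h : 0 ≤ m
  · lift m to ℕ using h
    exact graded_le_finiteVectors m hv
  · rw [graded_eq_bot (by omega) hv]
    exact zero_mem _

/-! ### One-dimensional densities -/

/-- The density `∑ₖ :c_A(k)† c_A(k + p):` of the species `A` (in relabelled momenta). -/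
noncomputable def rho (A : Species N) (p : ℤ) (v : Fock N) : Fock N :=
  ∑ᶠ k : ℤ, normalPair A k A (k + p) v

/-- Labels k < -M and k + p ≥ M contribute nothing, so the `finsum` is a genuine finite sum rather
than its default value. The freedom in `s` allows sums for several vectors to be taken over a common
range. -/
theorem rho_eq_sum {A : Species N} {p : ℤ} {M : ℕ} {v : Fock N} (hv : v ∈ window N M)
    {s : Finset ℤ} (hs : Finset.Ico (-(M : ℤ)) (M - p) ⊆ s) :
    rho A p v = ∑ k ∈ s, normalPair A k A (k + p) v := by
  refine finsum_eq_sum_of_support_subset _ fun k hk => hs ?_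
  rw [Finset.mem_Ico]
  by_contra h
  apply hk
  by_cases h1 : k < -(M : ℤ)
  · exact normalPair_eq_zero_of_lt hv h1
  · exact normalPair_eq_zero_of_le hv (by omega)

theorem rho_mem_graded {A : Species N} {p m : ℤ} {v : Fock N} (hv : v ∈ graded N m) :
    rho A p v ∈ graded N (m - 2 * p) := by
  obtain ⟨M, hM⟩ := graded_le_finiteVectors' m hv
  rw [rho_eq_sum hM subset_rfl]
  refine Submodule.sum_mem _ fun k _ => ?_
  convert normalPair_mem_graded hv using 2
  ring

theorem rho_mem_finiteVectors {A : Species N} {p : ℤ} {v : Fock N} (hv : v ∈ finiteVectors N) :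
    rho A p v ∈ finiteVectors N := by
  obtain ⟨M, hM⟩ := hv
  rw [rho_eq_sum hM subset_rfl]
  exact Submodule.sum_mem _ fun k _ => normalPair_mem_finiteVectors ⟨M, hM⟩

theorem rho_inner {A : Species N} {p : ℤ} {u v : Fock N} (hu : u ∈ finiteVectors N)
    (hv : v ∈ finiteVectors N) : ⟪rho A p u, v⟫_ℂ = ⟪u, rho A (-p) v⟫_ℂ := by
  obtain ⟨M, hM⟩ := hu
  obtain ⟨M', hM'⟩ := hv
  -- Large enough for both vectors, with room for the reindexing k ↦ k + p that matches each pair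
  -- with its adjoint.
  set K : ℤ := M + M' + p.natAbs with hK
  rw [rho_eq_sum hM (s := Finset.Ico (-K) K) (Finset.Ico_subset_Ico (by omega) (by omega)),
    rho_eq_sum hM' (s := (Finset.Ico (-K) K).map (Equiv.addRight p).toEmbedding), sum_inner,
    inner_sum, Finset.sum_map]
  · refine Finset.sum_congr rfl fun k _ => ?_
    rw [normalPair_inner]
    simp
  · intro k hk
    rw [Finset.mem_Ico] at hk
    rw [Finset.mem_map]
    refine ⟨k - p, Finset.mem_Ico.2 (by omega), by simp⟩

/-- The finite chain of the modes of the species `A` in a window. -/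
noncomputable def windowDensity (A : Species N) (M : ℕ) (p : ℤ) : Fock N →L[ℂ] Fock N :=
  chainDensity (fermi A) (fermiDag A) (Finset.Ico (-(M : ℤ)) M) p

theorem fermi_car (A : Species N) (k l : ℤ) :
    fermi A k * fermiDag A l + fermiDag A l * fermi A k = if k = l then 1 else 0 := by
  rw [fermi_mul_fermiDag_add]
  simp

theorem windowDensity_apply (A : Species N) (M : ℕ) (p : ℤ) (v : Fock N) :
    windowDensity A M p v = ∑ k ∈ Finset.Ico (-(M : ℤ)) M, ∑ l ∈ Finset.Ico (-(M : ℤ)) M,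
      if l - k = p then fermiDag A k (fermi A l v) else 0 := by
  unfold windowDensity chainDensity
  rw [sum_apply]
  refine Finset.sum_congr rfl fun k _ => ?_
  rw [sum_apply]
  refine Finset.sum_congr rfl fun l _ => ?_
  split_ifs <;> rfl

/-- A lowering density moves excitations towards the Fermi level and never leaves the window, so the
finite chain reproduces it exactly; as p ≠ 0, no vacuum term is subtracted. For negative p this
would fail at the edges of the window. -/
theorem rho_eq_windowDensity {A : Species N} {p : ℤ} (hp : 0 < p) {M : ℕ} {v : Fock N}
    (hv : v ∈ window N M) : rho A p v = windowDensity A M p v := by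
  rw [rho_eq_sum hv (s := Finset.Ico (-(M : ℤ)) M)
    (Finset.Ico_subset_Ico le_rfl (by omega)), windowDensity_apply]
  refine Finset.sum_congr rfl fun k hk => ?_
  have h : ∀ l ∈ Finset.Ico (-(M : ℤ)) M,
      (if l - k = p then fermiDag A k (fermi A l v) else 0)
        = if k + p = l then fermiDag A k (fermi A (k + p) v) else 0 := by
    intro l _
    by_cases h : l = k + p
    · rw [if_pos (by omega), if_pos h.symm, h]
    · rw [if_neg (by omega), if_neg (Ne.symm h)]
  rw [Finset.sum_congr rfl h, Finset.sum_ite_eq]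
  rw [Finset.mem_Ico] at hk
  split_ifs with h1
  · rw [normalPair_of_ne (by omega)]
    rfl
  · rw [Finset.mem_Ico] at h1
    exact normalPair_eq_zero_of_le hv (by omega)

theorem windowDensity_inner (A : Species N) (M : ℕ) (p : ℤ) (u v : Fock N) :
    ⟪windowDensity A M p u, v⟫_ℂ = ⟪u, windowDensity A M (-p) v⟫_ℂ := by
  rw [windowDensity_apply, windowDensity_apply, Finset.sum_comm]
  simp only [sum_inner, inner_sum]
  refine Finset.sum_congr rfl fun l _ => Finset.sum_congr rfl fun k _ => ?_
  by_cases h : l - k = p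
  · rw [if_pos h, if_pos (by omega), fermiDag_inner, fermi_inner]
  · rw [if_neg h, if_neg (by omega), inner_zero_left, inner_zero_right]

theorem windowDensity_mem_window {A : Species N} {M : ℕ} {p : ℤ} {v : Fock N}
    (hv : v ∈ window N M) : windowDensity A M p v ∈ window N M := by
  rw [windowDensity_apply]
  refine Submodule.sum_mem _ fun k hk => Submodule.sum_mem _ fun l hl => ?_
  rw [Finset.mem_Ico] at hk hl
  split_ifs
  · exact fermiDag_mem_window (fermi_mem_window hv hl.1 hl.2) hk.1 hk.2
  · exact zero_mem _

theorem bilinear_comm_of_ne {A B : Species N} (h : A ≠ B) (i j k l : ℤ) :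
    (fermiDag A i * fermi A j) * (fermiDag B k * fermi B l)
      = (fermiDag B k * fermi B l) * (fermiDag A i * fermi A j) := by
  have h1 : fermi A j * fermiDag B k = -(fermiDag B k * fermi A j) :=
    eq_neg_of_add_eq_zero_left (by rw [fermi_mul_fermiDag_add, if_neg fun h' => h h'.1])
  have h2 : fermi A j * fermi B l = -(fermi B l * fermi A j) :=
    eq_neg_of_add_eq_zero_left (fermi_anticomm _ _ _ _)
  have h3 : fermiDag A i * fermiDag B k = -(fermiDag B k * fermiDag A i) :=
    eq_neg_of_add_eq_zero_left (fermiDag_anticomm _ _ _ _)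
  have h4 : fermiDag A i * fermi B l = -(fermi B l * fermiDag A i) :=
    eq_neg_of_add_eq_zero_right (by
      rw [fermi_mul_fermiDag_add, if_neg fun h' => h h'.1.symm])
  calc (fermiDag A i * fermi A j) * (fermiDag B k * fermi B l)
      = fermiDag A i * (fermi A j * fermiDag B k) * fermi B l := by noncomm_ring
    _ = -((fermiDag A i * fermiDag B k) * (fermi A j * fermi B l)) := by rw [h1]; noncomm_ring
    _ = -(fermiDag B k * (fermiDag A i * fermi B l) * fermi A j) := by
        rw [h2, h3]; noncomm_ring
    _ = _ := by rw [h4]; noncomm_ring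

theorem windowDensity_comm (A B : Species N) (M : ℕ) {p q : ℤ} (hp : 0 < p) (hq : 0 < q) :
    windowDensity A M p * windowDensity B M q = windowDensity B M q * windowDensity A M p := by
  by_cases h : A = B
  · subst h
    exact chainDensity_comm (fermi_anticomm A A) (fermiDag_anticomm A A) (fermi_car A) _ _ hp hq
  · change Commute _ _
    refine Commute.sum_left _ _ _ fun i _ => Commute.sum_left _ _ _ fun j _ =>
      Commute.sum_right _ _ _ fun k _ => Commute.sum_right _ _ _ fun l _ => ?_
    split_ifs
    · exact bilinear_comm_of_ne h i j k l
    · exact Commute.zero_right _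
    · exact Commute.zero_left _
    · exact Commute.zero_left _

/-- The lowering densities commute. -/
theorem rho_comm {A B : Species N} {p q : ℤ} (hp : 0 < p) (hq : 0 < q) {v : Fock N}
    (hv : v ∈ finiteVectors N) : rho A p (rho B q v) = rho B q (rho A p v) := by
  obtain ⟨M, hM⟩ := hv
  rw [rho_eq_windowDensity hq hM, rho_eq_windowDensity hp hM,
    rho_eq_windowDensity hp (windowDensity_mem_window hM),
    rho_eq_windowDensity hq (windowDensity_mem_window hM)]
  exact DFunLike.congr_fun (windowDensity_comm A B M hp hq) v

/-- The raising densities commute. -/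
theorem rho_neg_comm {A B : Species N} {p q : ℤ} (hp : 0 < p) (hq : 0 < q) {v : Fock N}
    (hv : v ∈ finiteVectors N) : rho A (-p) (rho B (-q) v) = rho B (-q) (rho A (-p) v) := by
  -- Raising densities leave every window, so their commutation is obtained from that of the
  -- lowering ones by taking adjoints.
  refine dense_finiteVectors.eq_of_inner_right ℂ fun u hu => ?_
  rw [← rho_inner hu (rho_mem_finiteVectors hv), ← rho_inner (rho_mem_finiteVectors hu) hv,
    ← rho_inner hu (rho_mem_finiteVectors hv), ← rho_inner (rho_mem_finiteVectors hu) hv,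
    rho_comm hp hq hu]

/-! ### The Kronig identity -/

open Classical in
/-- The occupied modes of the species `A` in a window, if the set of excitations is `S`. -/
noncomputable def occupied (A : Species N) (M : ℕ) (S : Finset (Mode N)) : Finset ℤ :=
  (Finset.Ico (-(M : ℤ)) M).filter fun k => (0 ≤ k ↔ orbital A k ∈ S)

theorem mem_occupied {A : Species N} {M : ℕ} {S : Finset (Mode N)} {k : ℤ} :
    k ∈ occupied A M S ↔ (-(M : ℤ) ≤ k ∧ k < M) ∧ (0 ≤ k ↔ orbital A k ∈ S) := by
  classical
  unfold occupied
  rw [Finset.mem_filter, Finset.mem_Ico]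

open Classical in
theorem number_apply (A : Species N) (k : ℤ) (v : Fock N) (S : Finset (Mode N)) :
    fermiDag A k (fermi A k v) S = if (0 ≤ k ↔ orbital A k ∈ S) then v S else 0 := by
  unfold fermi fermiDag
  by_cases hk : 0 ≤ k
  · simp only [hk, true_iff]
    refine (create_annihilate_apply _ v S).trans ?_
    split_ifs <;> rfl
  · simp only [hk, false_iff]
    refine (annihilate_create_apply _ v S).trans ?_
    by_cases hS : orbital A k ∈ S <;> simp [hS]

theorem sum_number_apply (A : Species N) (M : ℕ) (f : ℤ → ℤ) (v : Fock N)
    (S : Finset (Mode N)) :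
    (∑ k ∈ Finset.Ico (-(M : ℤ)) M, f k • (fermiDag A k * fermi A k)) v S
      = ((∑ k ∈ occupied A M S, f k : ℤ) : ℂ) * v S := by
  classical
  have h : ∀ k, ((f k • (fermiDag A k * fermi A k)) v) S
      = if (0 ≤ k ↔ orbital A k ∈ S) then (f k : ℂ) * v S else 0 := by
    intro k
    rw [← Int.cast_smul_eq_zsmul ℂ]
    change (f k : ℂ) * (fermiDag A k (fermi A k v) S) = _
    rw [number_apply]
    split_ifs <;> simp
  rw [sum_apply, lp.coeFn_sum, Finset.sum_apply, Finset.sum_congr rfl fun k _ => h k,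
    ← Finset.sum_filter, ← Finset.sum_mul]
  push_cast
  rfl

theorem windowDensity_zero (A : Species N) (M : ℕ) :
    windowDensity A M 0 = ∑ k ∈ Finset.Ico (-(M : ℤ)) M, (1 : ℤ) • (fermiDag A k * fermi A k) := by
  unfold windowDensity chainDensity
  refine Finset.sum_congr rfl fun k hk => ?_
  have h : ∀ l ∈ Finset.Ico (-(M : ℤ)) M, (if l - k = 0 then fermiDag A k * fermi A l else 0)
      = if k = l then fermiDag A k * fermi A l else 0 :=
    fun l _ => if_congr (by omega) rfl rfl
  rw [Finset.sum_congr rfl h, Finset.sum_ite_eq, if_pos hk, one_smul]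

theorem windowDensity_zero_apply (A : Species N) (M : ℕ) (v : Fock N) (S : Finset (Mode N)) :
    windowDensity A M 0 v S = ((occupied A M S).card : ℂ) * v S := by
  rw [windowDensity_zero, sum_number_apply]
  simp

/-- At zero momentum the density is the charge: the occupied levels in the window, less the M levels
filled in the Dirac sea. -/
theorem rho_zero_apply {A : Species N} {M : ℕ} {v : Fock N} (hv : v ∈ window N M)
    (S : Finset (Mode N)) :
    rho A 0 v S = (((occupied A M S).card : ℂ) - M) * v S := by
  have h : rho A 0 v = windowDensity A M 0 v - (M : ℂ) • v := by
    rw [rho_eq_sum hv (s := Finset.Ico (-(M : ℤ)) M) (Finset.Ico_subset_Ico le_rfl (by omega)),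
      windowDensity_zero]
    have h1 : ∀ k : ℤ, normalPair A k A (k + 0) v
        = ((1 : ℤ) • (fermiDag A k * fermi A k)) v - if k < 0 then v else 0 := by
      intro k
      rw [add_zero, normalPair_self, one_smul]
      split_ifs <;> rfl
    rw [Finset.sum_congr rfl fun k _ => h1 k, Finset.sum_sub_distrib, sum_apply,
      ← Finset.sum_filter, Finset.sum_const]
    have h2 : (Finset.Ico (-(M : ℤ)) M).filter (fun k => k < 0) = Finset.Ico (-(M : ℤ)) 0 := by
      ext k
      simp only [Finset.mem_filter, Finset.mem_Ico]
      omega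
    rw [h2, Int.card_Ico, ← Nat.cast_smul_eq_nsmul ℂ]
    simp
  rw [h, lp.coeFn_sub, Pi.sub_apply, windowDensity_zero_apply, lp.coeFn_smul, Pi.smul_apply,
    smul_eq_mul]
  ring

/-- The deficit of a finite configuration of a chain relative to the configuration with the same
number of particles and minimal energy. -/
noncomputable def excess (A : Species N) (M : ℕ) (S : Finset (Mode N)) : ℤ :=
  ∑ k ∈ occupied A M S, (2 * (k + M) + 1) - ((occupied A M S).card : ℤ) ^ 2

/-- The Kronig identity on vectors. -/
theorem kronig_window (A : Species N) (M : ℕ) (v : Fock N) (S : Finset (Mode N)) :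
    ((2 : ℂ) • ∑ p ∈ Finset.Ioo (0 : ℤ) (2 * M), windowDensity A M (-p) (windowDensity A M p v)) S
      = (excess A M S : ℂ) * v S := by
  have hdouble : ∀ x : Fock N →L[ℂ] Fock N, x + x = 0 → x = 0 := fun x hx => by
    rw [← two_smul ℂ] at hx
    exact (smul_eq_zero.1 hx).resolve_left two_ne_zero
  have h := kronig_chain (fermi_anticomm A A) (fermiDag_anticomm A A) (fermi_car A) M hdouble
  have h0 : ∑ k ∈ Finset.Ico (-(M : ℤ)) M, fermiDag A k * fermi A k = windowDensity A M 0 := by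
    rw [windowDensity_zero]
    exact Finset.sum_congr rfl fun k _ => (one_smul _ _).symm
  rw [h0] at h
  have h1 := congrArg (fun T : Fock N →L[ℂ] Fock N => T v S) h
  have e1 : ((2 : Fock N →L[ℂ] Fock N) * ∑ p ∈ Finset.Ioo (0 : ℤ) (2 * M),
      windowDensity A M (-p) * windowDensity A M p) v
      = (2 : ℂ) • ∑ p ∈ Finset.Ioo (0 : ℤ) (2 * M),
        windowDensity A M (-p) (windowDensity A M p v) := by
    rw [two_mul, two_smul]
    change (∑ p ∈ Finset.Ioo (0 : ℤ) (2 * M), windowDensity A M (-p) * windowDensity A M p) v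
      + (∑ p ∈ Finset.Ioo (0 : ℤ) (2 * M), windowDensity A M (-p) * windowDensity A M p) v = _
    rw [sum_apply]
    rfl
  change ((2 : Fock N →L[ℂ] Fock N) * ∑ p ∈ Finset.Ioo (0 : ℤ) (2 * M),
      windowDensity A M (-p) * windowDensity A M p) v S
    = (∑ k ∈ Finset.Ico (-(M : ℤ)) M, (2 * (k + M) + 1) • (fermiDag A k * fermi A k)) v S
      - (windowDensity A M 0 ^ 2) v S at h1
  have e2 : (windowDensity A M 0 ^ 2) v = windowDensity A M 0 (windowDensity A M 0 v) := by
    rw [sq]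
    rfl
  rw [e1, e2, sum_number_apply, windowDensity_zero_apply, windowDensity_zero_apply] at h1
  rw [h1, excess]
  push_cast
  ring

/-- A finite set of integers `≥ -M` has at least the energy of an initial segment. -/
theorem card_sq_le_sum (M : ℕ) (O : Finset ℤ) (hO : ∀ k ∈ O, -(M : ℤ) ≤ k) :
    (O.card : ℤ) ^ 2 ≤ ∑ k ∈ O, (2 * (k + M) + 1) ∧
      ((O.card : ℤ) ^ 2 = ∑ k ∈ O, (2 * (k + M) + 1) → ∀ k, k ∈ O ↔ -(M : ℤ) ≤ k ∧ k < O.card - M) := by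
  induction hn : O.card generalizing O with
  | zero =>
    rw [Finset.card_eq_zero] at hn
    subst hn
    refine ⟨by simp, fun _ k => ?_⟩
    simp
  | succ n ih =>
    have hne : O.Nonempty := by
      rw [← Finset.card_pos]
      omega
    have hmax := O.max'_mem hne
    set m := O.max' hne with hm
    have hcard : (O.erase m).card = n := by
      rw [Finset.card_erase_of_mem hmax]
      omega
    obtain ⟨h1, h2⟩ := ih (O.erase m) (fun k hk => hO k (Finset.mem_of_mem_erase hk)) hcard
    have hsum := Finset.add_sum_erase O (fun k => 2 * (k + (M : ℤ)) + 1) hmax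
    have hsub : O ⊆ Finset.Icc (-(M : ℤ)) m := fun k hk =>
      Finset.mem_Icc.2 ⟨hO k hk, O.le_max' k hk⟩
    have hcard2 := Finset.card_le_card hsub
    rw [Int.card_Icc, hn] at hcard2
    -- The n + 1 elements of `O` all lie in [-M, m]. Hence the largest one contributes at least 2n +
    -- 1 = (n + 1)² - n², with equality only for an initial segment.
    have hmn : (n : ℤ) ≤ m + M := by omega
    push_cast
    rw [← hsum]
    refine ⟨by nlinarith, fun h k => ?_⟩
    have h3 : (n : ℤ) = m + M := by nlinarith
    have h4 := h2 (by nlinarith) k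
    rw [Finset.mem_erase] at h4
    by_cases hk : k = m
    · rw [hk]
      exact ⟨fun _ => by omega, fun _ => hmax⟩
    · constructor
      · intro h5
        have := h4.1 ⟨hk, h5⟩
        omega
      · intro h5
        exact (h4.2 (by omega)).2

theorem excess_nonneg (A : Species N) (M : ℕ) (S : Finset (Mode N)) : 0 ≤ excess A M S :=
  sub_nonneg.2 (card_sq_le_sum M _ fun _ hk => (mem_occupied.1 hk).1.1).1

theorem mem_occupied_of_excess_eq_zero {A : Species N} {M : ℕ} {S : Finset (Mode N)}
    (h : excess A M S = 0) (k : ℤ) :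
    k ∈ occupied A M S ↔ -(M : ℤ) ≤ k ∧ k < (occupied A M S).card - M :=
  (card_sq_le_sum M _ fun _ hk => (mem_occupied.1 hk).1.1).2 (sub_eq_zero.1 h).symm k

/-- The energy of a configuration bounds the square of the charge plus the excess. -/
theorem excess_add_sq_le_weight (A : Species N) (M : ℕ) (S : Finset (Mode N)) :
    excess A M S + ((occupied A M S).card - M : ℤ) ^ 2 ≤ weight S := by
  classical
  set W := Finset.Ico (-(M : ℤ)) M with hW
  have hE : ∑ k ∈ W, (if orbital A k ∈ S then |2 * k + 1| else 0) ≤ (weight S : ℤ) := by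
    rw [← Finset.sum_filter]
    have h1 : ((weight S : ℕ) : ℤ) = ∑ m ∈ S, |2 * (ofLex m).2 + 1| := by
      unfold weight
      push_cast
      rfl
    have h2 : ∑ k ∈ W.filter (fun k => orbital A k ∈ S), |2 * k + 1|
        = ∑ m ∈ (W.filter (fun k => orbital A k ∈ S)).image (orbital A),
            |2 * (ofLex m).2 + 1| := by
      rw [Finset.sum_image (g := orbital A) fun k _ l _ h => (orbital_inj.1 h).2]
      refine Finset.sum_congr rfl fun k _ => ?_
      rw [Int.abs_eq_natAbs, Int.abs_eq_natAbs]
      exact congrArg Nat.cast (natAbs_relabel _ k).symm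
    rw [h1, h2]
    refine Finset.sum_le_sum_of_subset_of_nonneg (fun m hm => ?_) fun _ _ _ => abs_nonneg _
    obtain ⟨k, hk, rfl⟩ := Finset.mem_image.1 hm
    exact (Finset.mem_filter.1 hk).2
  have hsum : ∑ k ∈ occupied A M S, (2 * (k + M) + 1)
      = ∑ k ∈ W, (if (0 ≤ k ↔ orbital A k ∈ S) then (2 * (k + M) + 1) else 0) :=
    Finset.sum_filter _ _
  have hcard : ((occupied A M S).card : ℤ)
      = ∑ k ∈ W, (if (0 ≤ k ↔ orbital A k ∈ S) then 1 else 0) := by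
    rw [← Finset.sum_filter, Finset.sum_const]
    simp [occupied, hW]
  have hgauss : ∀ n : ℕ, ∑ k ∈ Finset.Ico (-(n : ℤ)) n, (if k < 0 then (2 * k + 1) else 0)
      = -(n : ℤ) ^ 2 ∧ ∑ k ∈ Finset.Ico (-(n : ℤ)) n, (if k < 0 then (1 : ℤ) else 0) = n := by
    intro n
    induction n with
    | zero => simp
    | succ n ih =>
      have h3 : Finset.Ico (-((n + 1 : ℕ) : ℤ)) ((n + 1 : ℕ) : ℤ)
          = insert (-(n : ℤ) - 1) (insert (n : ℤ) (Finset.Ico (-(n : ℤ)) n)) := by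
        ext k
        simp only [Finset.mem_insert, Finset.mem_Ico]
        omega
      rw [h3, Finset.sum_insert (by simp), Finset.sum_insert (by simp), ih.1,
        Finset.sum_insert (by simp), Finset.sum_insert (by simp), ih.2]
      rw [if_pos (by omega), if_neg (by omega), if_pos (by omega), if_neg (by omega)]
      push_cast
      constructor <;> ring
  obtain ⟨g1, g2⟩ := hgauss M
  -- Energies are moved from the bottom of the window to the Fermi level: an occupied k ≥ 0 is an
  -- excitation, and an occupied k < 0 is a sea level without a hole. With the sea energy -M², the
  -- excess plus the squared charge is then exactly the weight of this species inside the window.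
  have hid : ∑ k ∈ occupied A M S, (2 * (k + M) + 1)
      = ∑ k ∈ W, (if orbital A k ∈ S then |2 * k + 1| else 0)
        + ∑ k ∈ W, (if k < 0 then (2 * k + 1) else 0)
        + 2 * M * ((occupied A M S).card : ℤ) := by
    rw [hsum, hcard, Finset.mul_sum, ← Finset.sum_add_distrib, ← Finset.sum_add_distrib]
    refine Finset.sum_congr rfl fun k _ => ?_
    by_cases hk : 0 ≤ k <;> by_cases hS : orbital A k ∈ S
    · simp only [hk, hS, if_true, iff_self, if_neg (not_lt.2 hk)]
      rw [abs_of_nonneg (by omega)]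
      ring
    · simp [hk, hS]
    · have : |2 * k + 1| = -(2 * k + 1) := abs_of_neg (by omega)
      simp [hk, hS, this, lt_of_not_ge hk]
    · simp only [hk, hS, if_true, iff_self, if_false, lt_of_not_ge hk]
      ring
  unfold excess
  rw [hid, g1]
  nlinarith

theorem two_mul_sum_norm_sq_windowDensity (A : Species N) (M : ℕ) (v : Fock N) :
    2 * ∑ p ∈ Finset.Ioo (0 : ℤ) (2 * M), ‖windowDensity A M p v‖ ^ 2
      = (⟪v, (2 : ℂ) • ∑ p ∈ Finset.Ioo (0 : ℤ) (2 * M),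
          windowDensity A M (-p) (windowDensity A M p v)⟫_ℂ).re := by
  have h : ∀ p, ⟪v, windowDensity A M (-p) (windowDensity A M p v)⟫_ℂ
      = ((‖windowDensity A M p v‖ ^ 2 : ℝ) : ℂ) := by
    intro p
    rw [← windowDensity_inner, inner_self_eq_norm_sq_to_K]
    norm_cast
  rw [inner_smul_right, inner_sum, Finset.sum_congr rfl fun p _ => h p]
  rw [← Complex.ofReal_sum, show (2 : ℂ) = ((2 : ℝ) : ℂ) by norm_num, ← Complex.ofReal_mul,
    Complex.ofReal_re]

/-- A single term of the nonnegative sum in the Kronig identity is bounded by the whole sum, whose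
quadratic form is the mean excess, at most the weight. -/
theorem norm_rho_sq_le_of_pos {A : Species N} {p : ℤ} (hp : 0 < p) {m : ℤ} {v : Fock N}
    (hv : v ∈ graded N m) : ‖rho A p v‖ ^ 2 ≤ m * ‖v‖ ^ 2 := by
  obtain ⟨M₀, hM₀⟩ := graded_le_finiteVectors' m hv
  obtain ⟨M, hMM, hpM⟩ : ∃ M, M₀ ≤ M ∧ p < 2 * M := ⟨M₀ + p.natAbs, by omega, by omega⟩
  have hM := window_mono hMM hM₀
  rw [rho_eq_windowDensity hp hM]
  have h1 : ‖windowDensity A M p v‖ ^ 2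
      ≤ ∑ p ∈ Finset.Ioo (0 : ℤ) (2 * M), ‖windowDensity A M p v‖ ^ 2 :=
    Finset.single_le_sum (f := fun p => ‖windowDensity A M p v‖ ^ 2) (fun _ _ => by positivity)
      (Finset.mem_Ioo.2 ⟨hp, hpM⟩)
  have h2 := two_mul_sum_norm_sq_windowDensity A M v
  have h3 : (⟪v, (2 : ℂ) • ∑ p ∈ Finset.Ioo (0 : ℤ) (2 * M),
      windowDensity A M (-p) (windowDensity A M p v)⟫_ℂ).re ≤ m * ‖v‖ ^ 2 := by
    refine re_inner_le_of_pointwise fun S => ?_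
    rw [kronig_window]
    by_cases hS : v S = 0
    · simp [hS]
    have hw : (weight S : ℤ) = m := hv S hS
    have h4 := excess_add_sq_le_weight A M S
    have h5 : excess A M S ≤ m := by nlinarith [sq_nonneg ((occupied A M S).card - M : ℤ)]
    have h6 : (⟪v S, (excess A M S : ℂ) * v S⟫_ℂ).re = excess A M S * ‖v S‖ ^ 2 := by
      rw [← re_inner_ofReal_mul_self]
      push_cast
      rfl
    rw [h6]
    have h7 : (excess A M S : ℝ) ≤ m := by exact_mod_cast h5
    gcongr
  have h8 : 0 ≤ ∑ p ∈ Finset.Ioo (0 : ℤ) (2 * M), ‖windowDensity A M p v‖ ^ 2 := by positivity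
  linarith

theorem norm_rho_zero_sq_le {A : Species N} {m : ℤ} {v : Fock N}
    (hv : v ∈ graded N m) : ‖rho A 0 v‖ ^ 2 ≤ m * ‖v‖ ^ 2 := by
  obtain ⟨M, hM⟩ := graded_le_finiteVectors' m hv
  have h : (⟪rho A 0 v, rho A 0 v⟫_ℂ).re = ‖rho A 0 v‖ ^ 2 := by
    rw [inner_self_eq_norm_sq_to_K]
    norm_cast
  rw [← h]
  refine re_inner_le_of_pointwise fun S => ?_
  rw [rho_zero_apply hM]
  by_cases hS : v S = 0
  · simp [hS]
  have hw : (weight S : ℤ) = m := hv S hS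
  have h4 := excess_add_sq_le_weight A M S
  have h5 := excess_nonneg A M S
  have h6 : ((occupied A M S).card - M : ℤ) ^ 2 ≤ m := by linarith
  have h7 : (((occupied A M S).card : ℝ) - M) ^ 2 ≤ m := by exact_mod_cast h6
  have h8 : (((occupied A M S).card : ℂ) - M) = (((occupied A M S).card - M : ℝ) : ℂ) := by
    push_cast
    rfl
  have h9 := re_inner_ofReal_mul_self ((((occupied A M S).card : ℂ) - M) * v S) 1
  rw [Complex.ofReal_one, one_mul, one_mul] at h9
  rw [h9, norm_mul, mul_pow, h8, Complex.norm_real, Real.norm_eq_abs, sq_abs]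
  gcongr

/-- The densities are bounded by the square root of the energy. -/
theorem norm_rho_sq_le {A : Species N} {p m : ℤ} {v : Fock N}
    (hv : v ∈ graded N m) : ‖rho A p v‖ ^ 2 ≤ (m + 2 * |p|) * ‖v‖ ^ 2 := by
  have hv0 : 0 ≤ ‖v‖ ^ 2 := by positivity
  have hp0 : (0 : ℝ) ≤ |(p : ℝ)| := abs_nonneg _
  rcases lt_trichotomy p 0 with hp | rfl | hp
  -- For a raising density, u has weight m - 2p and ‖u‖² = ⟪v, ρ(-p)u⟫; the lowering bound applied
  -- to u, after division by ‖u‖², gives the claim.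
  · set u := rho A p v with hu
    have hum : u ∈ graded N (m - 2 * p) := rho_mem_graded hv
    have h1 := norm_rho_sq_le_of_pos (A := A) (p := -p) (by omega) hum
    have h2 : ‖u‖ ^ 2 ≤ ‖v‖ * ‖rho A (-p) u‖ := by
      have h3 : ⟪u, u⟫_ℂ = ⟪v, rho A (-p) u⟫_ℂ :=
        rho_inner (graded_le_finiteVectors' _ hv) (graded_le_finiteVectors' _ hum)
      have h4 : ‖⟪u, u⟫_ℂ‖ = ‖u‖ ^ 2 := by
        rw [inner_self_eq_norm_sq_to_K]
        norm_cast
        simp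
      rw [← h4, h3]
      exact norm_inner_le_norm _ _
    have hab : |(p : ℝ)| = -p := abs_of_neg (by exact_mod_cast hp)
    push_cast at h1 ⊢
    rw [hab]
    by_cases hu0 : ‖u‖ = 0
    · rw [hu0]
      have hm : (0 : ℝ) ≤ m ∨ v = 0 := by
        by_cases hm : 0 ≤ m
        · exact Or.inl (by exact_mod_cast hm)
        · exact Or.inr (graded_eq_bot (by omega) hv)
      rcases hm with hm | hm
      · have : (p : ℝ) < 0 := by exact_mod_cast hp
        have : (0 : ℝ) ≤ (m + 2 * -p) := by linarith
        rw [zero_pow two_ne_zero]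
        exact mul_nonneg this hv0
      · rw [hm]
        simp
    · have hupos : 0 < ‖u‖ ^ 2 := by positivity
      have h5 : (‖u‖ ^ 2) ^ 2 ≤ ‖v‖ ^ 2 * ((m - 2 * p) * ‖u‖ ^ 2) := by
        calc (‖u‖ ^ 2) ^ 2 ≤ (‖v‖ * ‖rho A (-p) u‖) ^ 2 := by gcongr
          _ = ‖v‖ ^ 2 * ‖rho A (-p) u‖ ^ 2 := by ring
          _ ≤ _ := by gcongr
      nlinarith
  · simpa using norm_rho_zero_sq_le hv
  · have h1 := norm_rho_sq_le_of_pos (A := A) hp hv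
    push_cast
    nlinarith

/-- A vector annihilated by all lowering densities is supported on configurations in which each
species is in its ground state. -/
theorem excess_eq_zero_of_rho_eq_zero {A : Species N} {M : ℕ} {v : Fock N} (hv : v ∈ window N M)
    (h : ∀ p : ℤ, 0 < p → rho A p v = 0) {S : Finset (Mode N)} (hS : v S ≠ 0) :
    excess A M S = 0 := by
  have h1 := kronig_window A M v S
  rw [Finset.sum_eq_zero, smul_zero] at h1
  · have h2 := (mul_eq_zero.1 h1.symm).resolve_right hS
    exact Int.cast_eq_zero.1 h2
  · intro p hp
    rw [← rho_eq_windowDensity (Finset.mem_Ioo.1 hp).1 hv, h p (Finset.mem_Ioo.1 hp).1, map_zero]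

end Mattis

open scoped InnerProductSpace lp ComplexConjugate

namespace Mattis

/-! ### Series of partially defined operators. -/

section OpSum

variable {F : Type*} [NormedAddCommGroup F] [InnerProductSpace ℂ F]

theorem opSum_apply_of_hasSum {ι : Type*} {T : ι → F →ₗ.[ℂ] F} {v x : F}
    (h : ∀ i, v ∈ (T i).domain) (hs : HasSum (fun i => T i ⟨v, h i⟩) x) :
    ∃ hv : v ∈ (opSum T).domain, opSum T ⟨v, hv⟩ = x :=
  ⟨⟨h, hs.summable⟩, hs.tsum_eq⟩

theorem hasSum_opSum {ι : Type*} {T : ι → F →ₗ.[ℂ] F} {v : F} (hv : v ∈ (opSum T).domain) :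
    ∃ h : ∀ i, v ∈ (T i).domain, HasSum (fun i => T i ⟨v, h i⟩) (opSum T ⟨v, hv⟩) := by
  obtain ⟨h, hs⟩ := id hv
  exact ⟨h, hs.hasSum⟩

theorem mem_ofBounded_domain (T : F →L[ℂ] F) (v : F) : v ∈ (ofBounded T).domain :=
  Submodule.mem_top

theorem ofBounded_apply (T : F →L[ℂ] F) (v : (ofBounded T).domain) : ofBounded T v = T v := rfl

/-- Both series converge unconditionally, so they may be paired with a fixed vector term by term and
reindexed by σ. No common core is needed. -/
theorem opSum_formalAdjoint {ι κ : Type*} {T : ι → F →ₗ.[ℂ] F} {T' : κ → F →ₗ.[ℂ] F} (σ : κ ≃ ι)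
    {u w : F}
    (h : ∀ i (hu : u ∈ (T (σ i)).domain) (hw : w ∈ (T' i).domain),
      ⟪T (σ i) ⟨u, hu⟩, w⟫_ℂ = ⟪u, T' i ⟨w, hw⟩⟫_ℂ)
    (hu : u ∈ (opSum T).domain) (hw : w ∈ (opSum T').domain) :
    ⟪opSum T ⟨u, hu⟩, w⟫_ℂ = ⟪u, opSum T' ⟨w, hw⟩⟫_ℂ := by
  obtain ⟨hu', h1⟩ := hasSum_opSum hu
  obtain ⟨hw', h2⟩ := hasSum_opSum hw
  have h3 := ((innerSL ℂ w).hasSum (σ.hasSum_iff.2 h1)).star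
  have h4 := (innerSL ℂ u).hasSum h2
  have h5 : (fun i => star ((innerSL ℂ w) (T (σ i) ⟨u, hu' (σ i)⟩)))
      = fun i => (innerSL ℂ u) (T' i ⟨w, hw' i⟩) :=
    funext fun i => (inner_conj_symm _ _).trans (h i (hu' (σ i)) (hw' i))
  have h6 := h3.unique (h5 ▸ h4)
  rw [← inner_conj_symm]
  exact h6

theorem opSum_symm {ι : Type*} {T : ι → F →ₗ.[ℂ] F} {u w : F}
    (h : ∀ i (hu : u ∈ (T i).domain) (hw : w ∈ (T i).domain),
      ⟪T i ⟨u, hu⟩, w⟫_ℂ = ⟪u, T i ⟨w, hw⟩⟫_ℂ)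
    (hu : u ∈ (opSum T).domain) (hw : w ∈ (opSum T).domain) :
    ⟪opSum T ⟨u, hu⟩, w⟫_ℂ = ⟪u, opSum T ⟨w, hw⟩⟫_ℂ :=
  opSum_formalAdjoint (Equiv.refl ι) h hu hw

/-- Each coordinate is a continuous functional, so it vanishes on the sum if it vanishes on all
terms. -/
theorem opSum_mem_supportedOn {ι κ : Type*} {T : ι → ℓ²(κ, ℂ) →ₗ.[ℂ] ℓ²(κ, ℂ)} {w : ℓ²(κ, ℂ)}
    {P : Set κ} (h : ∀ i (hw : w ∈ (T i).domain), T i ⟨w, hw⟩ ∈ supportedOn P)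
    (hw : w ∈ (opSum T).domain) : opSum T ⟨w, hw⟩ ∈ supportedOn P := by
  classical
  obtain ⟨hw', h2⟩ := hasSum_opSum hw
  intro j hj
  by_contra hjP
  apply hj
  have h1 : ∀ v : ℓ²(κ, ℂ), v j = ⟪(lp.single 2 j (1 : ℂ) : ℓ²(κ, ℂ)), v⟫_ℂ := by
    intro v
    rw [lp.inner_single_left]
    simp
  have h3 := (innerSL ℂ (lp.single 2 j (1 : ℂ) : ℓ²(κ, ℂ))).hasSum h2
  rw [h1]
  refine h3.unique ?_
  have h4 : (fun i => (innerSL ℂ (lp.single 2 j (1 : ℂ) : ℓ²(κ, ℂ))) (T i ⟨w, hw' i⟩))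
      = fun _ => 0 := by
    funext i
    refine (h1 _).symm.trans ?_
    by_contra h5
    exact hjP (h i (hw' i) j h5)
  exact h4 ▸ hasSum_zero

end OpSum

variable {N : ℕ}

/-! ### Fourier analysis on the lattice -/

/-- The character `exp(2πi m / N)`. -/
noncomputable def wave (N : ℕ) (m : ℤ) : ℂ := Complex.exp (2 * Real.pi * Complex.I * m / N)

theorem wave_add (m n : ℤ) : wave N (m + n) = wave N m * wave N n := by
  rw [wave, wave, wave, ← Complex.exp_add]
  congr 1
  push_cast
  ring

theorem wave_zero : wave N 0 = 1 := by simp [wave]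

theorem conj_wave (m : ℤ) : conj (wave N m) = wave N (-m) := by
  rw [wave, wave, ← Complex.exp_conj]
  congr 1
  have h2 : conj (2 : ℂ) = 2 := map_ofNat _ 2
  simp [Complex.conj_ofReal, h2]

theorem wave_mul_natCast (hN : N ≠ 0) (n : ℤ) : wave N (N * n) = 1 := by
  rw [wave, Complex.exp_eq_one_iff]
  refine ⟨n, ?_⟩
  have : (N : ℂ) ≠ 0 := Nat.cast_ne_zero.2 hN
  push_cast
  field_simp

theorem norm_wave (m : ℤ) : ‖wave N m‖ = 1 := by
  have h : (2 * Real.pi * Complex.I * m / N : ℂ) = ((2 * Real.pi * m / N : ℝ) : ℂ) * Complex.I := by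
    push_cast
    ring
  rw [wave, h, Complex.norm_exp_ofReal_mul_I]

theorem wave_eq_one_iff (hN : N ≠ 0) {m : ℤ} : wave N m = 1 ↔ ∃ n : ℤ, m = N * n := by
  constructor
  · intro h
    rw [wave, Complex.exp_eq_one_iff] at h
    obtain ⟨n, hn⟩ := h
    refine ⟨n, ?_⟩
    have h1 : (N : ℂ) ≠ 0 := Nat.cast_ne_zero.2 hN
    have h2 : (2 * Real.pi * Complex.I : ℂ) ≠ 0 := Complex.two_pi_I_ne_zero
    rw [div_eq_iff h1] at hn
    have h3 : (2 * Real.pi * Complex.I : ℂ) * m = (2 * Real.pi * Complex.I) * (N * n) := by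
      rw [hn]
      ring
    exact_mod_cast mul_left_cancel₀ h2 h3
  · rintro ⟨n, rfl⟩
    exact wave_mul_natCast hN n

/-- A geometric sum over the N-th roots of unity, recentred because the positions run from -(N-1)/2
to (N-1)/2. The bound on d excludes nonzero multiples of N. -/
theorem sum_wave (hN : Odd N) {d : ℤ} (hd : |d| < N) :
    ∑ j : Pos N, wave N (j.1 * d) = if d = 0 then (N : ℂ) else 0 := by
  obtain ⟨h, rfl⟩ := hN
  set N := 2 * h + 1 with hNdef
  have hN0 : N ≠ 0 := by omega
  have h1 : ∑ j : Pos N, wave N (j.1 * d)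
      = ∑ i ∈ Finset.range N, wave N (-(h * d)) * (wave N d) ^ i := by
    refine Finset.sum_bij' (fun j _ => (j.1 + h).toNat)
      (fun i hi => ⟨i - h, by rw [Finset.mem_range] at hi; omega⟩) ?_ ?_ ?_ ?_ ?_
    · intro j _
      have := j.2
      rw [Finset.mem_range]
      omega
    · exact fun _ _ => Finset.mem_univ _
    · intro j _
      have := j.2
      apply Subtype.ext
      simp only
      omega
    · intro i hi
      simp
    · intro j _
      have := j.2
      have hpow : ∀ n : ℕ, wave N d ^ n = wave N (n * d) := by
        intro n
        induction n with
        | zero => simp [wave_zero]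
        | succ n ih =>
          rw [pow_succ, ih, ← wave_add]
          congr 1
          push_cast
          ring
      rw [hpow, ← wave_add]
      congr 1
      have h2 : ((j.1 + h).toNat : ℤ) = j.1 + h := Int.toNat_of_nonneg (by omega)
      rw [h2]
      ring
  rw [h1, ← Finset.mul_sum]
  split_ifs with h0
  · subst h0
    simp [wave_zero]
  · have hne : wave N d ≠ 1 := by
      rw [Ne, wave_eq_one_iff hN0]
      rintro ⟨n, hn⟩
      have hn0 : n ≠ 0 := by
        rintro rfl
        simp at hn
        exact h0 hn
      rw [hn, abs_mul] at hd
      have h3 : 1 ≤ |n| := Int.one_le_abs hn0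
      have h4 : |(N : ℤ)| = N := abs_of_nonneg (by omega)
      rw [h4] at hd
      nlinarith
    have hpowN : wave N d ^ N = 1 := by
      rw [wave, ← Complex.exp_nat_mul, Complex.exp_eq_one_iff]
      refine ⟨d, ?_⟩
      have : (N : ℂ) ≠ 0 := Nat.cast_ne_zero.2 hN0
      field_simp
    rw [geom_sum_eq hne, hpowN]
    simp

/-- The labels in `Pos N` form a complete residue system modulo N; this makes the umklapp sum in the
densities pick exactly one partner. -/
theorem existsUnique_pos (hN : Odd N) (q : ℤ) :
    ∃ j : Pos N, ∀ j' : Pos N, (∃ n : ℤ, q = j'.1 + N * n) ↔ j = j' := by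
  obtain ⟨h, rfl⟩ := hN
  have h1 := Int.emod_nonneg (q + h) (b := 2 * h + 1) (by omega)
  have h2 := Int.emod_lt_of_pos (q + h) (b := 2 * h + 1) (by omega)
  have h3 := Int.emod_add_mul_ediv (q + h) (2 * h + 1)
  set e := (q + h) % (2 * h + 1) with he
  set f := (q + h) / (2 * h + 1) with hf
  refine ⟨⟨e - h, by push_cast; omega, by push_cast; omega⟩, fun j' => ?_⟩
  have hj := j'.2
  push_cast at hj ⊢
  constructor
  · rintro ⟨n, hn⟩
    apply Subtype.ext
    change e - h = j'.1
    have h4 : (2 * (h : ℤ) + 1) * (n - f) = e - h - j'.1 := by linarith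
    have h5 : n - f = 0 := by
      by_contra h6
      rcases lt_or_gt_of_ne h6 with h7 | h7
      · nlinarith
      · nlinarith
    rw [h5] at h4
    linarith
  · rintro rfl
    exact ⟨f, by simp only; linarith⟩

theorem abs_sub_lt_of_pos (x y : Pos N) : |x.1 - y.1| < N := by
  have hx := x.2
  have hy := y.2
  rw [abs_lt]
  omega

/-! ### The fermion bilinears -/

/-- Normal ordering of bounded operators. -/
noncomputable def normalOrder : (Fock N →L[ℂ] Fock N) →ₗ[ℂ] (Fock N →L[ℂ] Fock N) where
  toFun T := T - ⟪vacuum N, T (vacuum N)⟫_ℂ • 1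
  map_add' S T := by
    simp only [add_apply, inner_add_right, add_smul]
    abel
  map_smul' c T := by
    simp only [smul_apply, inner_smul_right, RingHom.id_apply, smul_sub, mul_smul]

theorem normalOrder_pair (A B : Species N) (k l : ℤ) :
    normalOrder (fermiDag A k * fermi B l) = normalPair A k B l := rfl

/-- The phase of the term `x` in the fermion field operator. -/
noncomputable def fieldPhase (N : ℕ) (κ x : ℤ) : ℂ :=
  Complex.exp (-(Real.pi * Complex.I * x / N)) * wave N (-(κ * x))

theorem fieldPhase_add (κ κ' x : ℤ) :
    fieldPhase N (κ + κ') x = fieldPhase N κ x * wave N (-(κ' * x)) := by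
  unfold fieldPhase
  rw [mul_assoc (Complex.exp _), ← wave_add]
  congr 2
  ring

theorem units_ne_neg (s : ℤˣ) : s ≠ -s := by
  rcases Int.units_eq_one_or s with rfl | rfl <;> decide

theorem psi_eq {a : ℝ} (ha : 0 < a) (hN : N ≠ 0) (r s : ℤˣ) (k : FermiMomentum N s) :
    psi a r s k = ((boxLength a N / (2 * Real.pi) * √(a / boxLength a N) : ℝ) : ℂ) •
      ∑ x : Pos N, fieldPhase N (k.1 (-s)) x.1 • fermi (species r s x) (relabel r (k.1 s)) := by
  unfold psi
  congr 1
  refine Finset.sum_congr rfl fun x _ => ?_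
  rw [fermionC_eq_fermi]
  congr 1
  rw [fieldPhase, wave, ← Complex.exp_add]
  congr 1
  have h1 : (N : ℂ) ≠ 0 := Nat.cast_ne_zero.2 hN
  have h2 : (a : ℂ) ≠ 0 := Complex.ofReal_ne_zero.2 ha.ne'
  unfold fermiComp boxLength
  push_cast
  field_simp
  ring

theorem bilinear_eq {a : ℝ} (ha : 0 < a) (hN : N ≠ 0) (r s : ℤˣ) (k₁ k₂ : FermiMomentum N s) :
    bilinear a r s k₁ k₂ = (((boxLength a N / (2 * Real.pi)) ^ 2 * (a / boxLength a N) : ℝ) : ℂ) •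
      ∑ x : Pos N, ∑ y : Pos N,
        (conj (fieldPhase N (k₁.1 (-s)) x.1) * fieldPhase N (k₂.1 (-s)) y.1) •
          normalPair (species r s x) (relabel r (k₁.1 s)) (species r s y) (relabel r (k₂.1 s)) := by
  have hb : bilinear a r s k₁ k₂
      = normalOrder (ContinuousLinearMap.adjoint (psi a r s k₁) * psi a r s k₂) := rfl
  have hL : 0 ≤ a / boxLength a N := by
    unfold boxLength
    positivity
  have hadj : ContinuousLinearMap.adjoint (psi a r s k₁)
      = ((boxLength a N / (2 * Real.pi) * √(a / boxLength a N) : ℝ) : ℂ) •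
      ∑ x : Pos N, conj (fieldPhase N (k₁.1 (-s)) x.1) •
        fermiDag (species r s x) (relabel r (k₁.1 s)) := by
    rw [psi_eq ha hN, map_smulₛₗ, map_sum]
    simp only [map_smulₛₗ, adjoint_fermi, Complex.conj_ofReal]
  rw [hb, hadj, psi_eq ha hN, smul_mul_smul_comm, map_smul, Finset.sum_mul_sum, map_sum]
  congr 1
  · rw [← Complex.ofReal_mul]
    congr 1
    have h := Real.mul_self_sqrt hL
    rw [mul_mul_mul_comm, h]
    ring
  · refine Finset.sum_congr rfl fun x _ => ?_
    rw [map_sum]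
    refine Finset.sum_congr rfl fun y _ => ?_
    rw [smul_mul_smul_comm, map_smul, normalOrder_pair]

theorem bilinear_inner (a : ℝ) (r s : ℤˣ) (k₁ k₂ : FermiMomentum N s) (u v : Fock N) :
    ⟪bilinear a r s k₁ k₂ u, v⟫_ℂ = ⟪u, bilinear a r s k₂ k₁ v⟫_ℂ := by
  have h : ∀ k₁ k₂ : FermiMomentum N s, ∀ w, bilinear a r s k₁ k₂ w
      = ContinuousLinearMap.adjoint (psi a r s k₁) (psi a r s k₂ w)
        - ⟪vacuum N, ContinuousLinearMap.adjoint (psi a r s k₁) (psi a r s k₂ (vacuum N))⟫_ℂ • w :=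
    fun _ _ _ => rfl
  rw [h, h, inner_sub_left, inner_sub_right, inner_smul_left, inner_smul_right, inner_conj_symm]
  simp only [ContinuousLinearMap.adjoint_inner_left, ContinuousLinearMap.adjoint_inner_right]

theorem bilinear_mem_graded {a : ℝ} (ha : 0 < a) (hN : N ≠ 0) {r s : ℤˣ}
    {k₁ k₂ : FermiMomentum N s} {m : ℤ} {v : Fock N} (hv : v ∈ graded N m) :
    bilinear a r s k₁ k₂ v ∈ graded N (m + 2 * (relabel r (k₁.1 s) - relabel r (k₂.1 s))) := by
  rw [bilinear_eq ha hN, smul_apply, sum_apply]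
  refine Submodule.smul_mem _ _ (Submodule.sum_mem _ fun x _ => ?_)
  rw [sum_apply]
  refine Submodule.sum_mem _ fun y _ => ?_
  rw [smul_apply]
  exact Submodule.smul_mem _ _ (normalPair_mem_graded hv)

theorem bilinear_eq_zero {a : ℝ} (ha : 0 < a) (hN : N ≠ 0) {r s : ℤˣ}
    {k₁ k₂ : FermiMomentum N s} {M : ℕ} {v : Fock N} (hv : v ∈ window N M)
    (h : relabel r (k₁.1 s) < -(M : ℤ) ∨ (M : ℤ) ≤ relabel r (k₂.1 s)) :
    bilinear a r s k₁ k₂ v = 0 := by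
  rw [bilinear_eq ha hN, smul_apply, sum_apply, Finset.sum_eq_zero, smul_zero]
  intro x _
  rw [sum_apply]
  refine Finset.sum_eq_zero fun y _ => ?_
  rw [smul_apply]
  rcases h with h | h
  · rw [normalPair_eq_zero_of_lt hv h, smul_zero]
  · rw [normalPair_eq_zero_of_le hv h, smul_zero]

/-- The momenta in `Λ_s^*` in terms of the relabelled component along `s` and a lattice label. -/
noncomputable def momentumEquiv (hN : Odd N) (r s : ℤˣ) : ℤ × Pos N ≃ FermiMomentum N s where
  -- For N = 2h + 1 the transverse labels run over [-h - 1, h - 1] because of the half-integer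
  -- shift, while `Pos N` is [-h, h]; hence the offset by one.
  toFun q := ⟨fun t => if t = s then relabel r q.1 else q.2.1 - 1, by
    have h := q.2.2
    have h0 : -s ≠ s := (units_ne_neg s).symm
    obtain ⟨h, rfl⟩ := hN
    simp only [if_neg h0]
    omega⟩
  invFun κ := (relabel r (κ.1 s), ⟨κ.1 (-s) + 1, by
    have h := κ.2
    obtain ⟨h, rfl⟩ := hN
    omega⟩)
  left_inv q := by
    have h0 : -s ≠ s := (units_ne_neg s).symm
    ext
    · simp [relabel_relabel]
    · simp [h0]
  right_inv κ := by
    apply Subtype.ext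
    funext t
    by_cases h : t = s
    · simp [h, relabel_relabel]
    · have h1 : t = -s := (Int.units_ne_iff_eq_neg.1 h)
      simp [h1, (units_ne_neg s).symm]

theorem momentumEquiv_same (hN : Odd N) (r s : ℤˣ) (q : ℤ × Pos N) :
    (momentumEquiv hN r s q).1 s = relabel r q.1 := if_pos rfl

theorem momentumEquiv_other (hN : Odd N) (r s : ℤˣ) (q : ℤ × Pos N) :
    (momentumEquiv hN r s q).1 (-s) = q.2.1 - 1 := if_neg (units_ne_neg s).symm

/-- Umklapp acts only on the transverse component, so the condition splits into an exact shift along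
s, whose sign is changed by the relabelling if r = -, and a congruence modulo N. -/
theorem momentum_condition (hN : Odd N) (r s : ℤˣ) (p : ℤˣ → ℤ) (q₁ q₂ : ℤ × Pos N) :
    (∃ n : ℤ, ∀ t : ℤˣ, (momentumEquiv hN r s q₁).1 t + p t
      = (momentumEquiv hN r s q₂).1 t + (if t = -s then N * n else 0))
    ↔ q₂.1 = q₁.1 + r * p s ∧ ∃ n : ℤ, q₁.2.1 + p (-s) = q₂.2.1 + N * n := by
  have h0 : s ≠ -s := units_ne_neg s
  constructor
  · rintro ⟨n, hn⟩
    have h1 := hn s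
    have h2 := hn (-s)
    rw [momentumEquiv_same, momentumEquiv_same, if_neg h0, add_zero] at h1
    rw [momentumEquiv_other, momentumEquiv_other, if_pos rfl] at h2
    refine ⟨?_, n, by linarith⟩
    have h3 := congrArg (relabel r) h1
    rw [relabel_add, relabel_relabel, relabel_relabel] at h3
    exact h3.symm
  · rintro ⟨h1, n, hn⟩
    refine ⟨n, fun t => ?_⟩
    by_cases h : t = s
    · subst h
      rw [momentumEquiv_same, momentumEquiv_same, if_neg h0, add_zero, h1, relabel_add,
        ← mul_assoc]
      rcases Int.units_eq_one_or r with rfl | rfl <;> simp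
    · have ht : t = -s := Int.units_ne_iff_eq_neg.1 h
      subst ht
      rw [momentumEquiv_other, momentumEquiv_other, if_pos rfl]
      linarith

open Classical in
/-- Orthogonality of the plane waves. -/
theorem sum_fieldPhase (hN : Odd N) (q : ℤ) (x y : Pos N) :
    ∑ j : Pos N, ∑ j' : Pos N, (if ∃ n : ℤ, j.1 + q = j'.1 + N * n then
      conj (fieldPhase N (j.1 - 1) x.1) * fieldPhase N (j'.1 - 1) y.1 else 0)
      = if x = y then (N : ℂ) * wave N (-(q * x.1)) else 0 := by
  have hN0 : N ≠ 0 := by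
    rintro rfl
    simp at hN
  -- Exactly one j' is congruent to j + q, and the umklapp multiple of N does not change the phase.
  -- What remains is a character in j with frequency x - y.
  have h1 : ∀ j : Pos N, ∑ j' : Pos N, (if ∃ n : ℤ, j.1 + q = j'.1 + N * n then
      conj (fieldPhase N (j.1 - 1) x.1) * fieldPhase N (j'.1 - 1) y.1 else 0)
      = conj (fieldPhase N (-1) x.1) * fieldPhase N (-1) y.1 * wave N (-(q * y.1))
        * wave N (j.1 * (x.1 - y.1)) := by
    intro j
    obtain ⟨j₀, hj₀⟩ := existsUnique_pos hN (j.1 + q)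
    simp only [hj₀]
    rw [Finset.sum_ite_eq, if_pos (Finset.mem_univ _)]
    obtain ⟨n, hn⟩ := (hj₀ j₀).2 rfl
    have h2 : j₀.1 = j.1 + q - N * n := by linarith
    have h3 : fieldPhase N (j₀.1 - 1) y.1
        = fieldPhase N (-1) y.1 * wave N (-((j.1 + q) * y.1)) := by
      have h4 : j₀.1 - 1 = -1 + (j.1 + q - N * n) := by
        rw [h2]
        ring
      have h4' : -((j.1 + q - N * n) * y.1) = -((j.1 + q) * y.1) + N * (n * y.1) := by ring
      rw [h4, fieldPhase_add, h4', wave_add _ (N * _), wave_mul_natCast hN0, mul_one]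
    have h5 : fieldPhase N (j.1 - 1) x.1 = fieldPhase N (-1) x.1 * wave N (-(j.1 * x.1)) := by
      rw [← fieldPhase_add]
      congr 1
      ring
    rw [h3, h5, map_mul, conj_wave, neg_neg]
    have h6 : wave N (j.1 * x.1) * wave N (-((j.1 + q) * y.1))
        = wave N (-(q * y.1)) * wave N (j.1 * (x.1 - y.1)) := by
      rw [← wave_add, ← wave_add]
      congr 1
      ring
    linear_combination (conj (fieldPhase N (-1) x.1) * fieldPhase N (-1) y.1) * h6
  rw [Finset.sum_congr rfl fun j _ => h1 j, ← Finset.mul_sum, sum_wave hN (abs_sub_lt_of_pos x y)]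
  by_cases hxy : x = y
  · subst hxy
    rw [if_pos (sub_self _), if_pos rfl]
    have h7 : conj (fieldPhase N (-1) x.1) * fieldPhase N (-1) x.1 = 1 := by
      have h8 : (-(Real.pi * Complex.I * x.1 / N) : ℂ)
          = ((-(Real.pi * x.1 / N) : ℝ) : ℂ) * Complex.I := by
        push_cast
        ring
      rw [Complex.conj_mul', fieldPhase, norm_mul, norm_wave, h8, Complex.norm_exp_ofReal_mul_I]
      simp
    rw [h7]
    ring
  · rw [if_neg (fun h => hxy (Subtype.ext (sub_eq_zero.1 h))), if_neg hxy, mul_zero]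

/-! ### The densities on vectors with finitely many nonzero coordinates -/

/-- The Fourier transform of the one-dimensional densities. -/
noncomputable def planeDensity (r s : ℤˣ) (p : ℤˣ → ℤ) (v : Fock N) : Fock N :=
  ∑ x : Pos N, wave N (-(p (-s) * x.1)) • rho (species r s x) (r * p s) v

open Classical in
/-- The terms of the series that defines the densities, in the variables of `momentumEquiv`. -/
noncomputable def densityTerm (r s : ℤˣ) (p : ℤˣ → ℤ) (v : Fock N)
    (q : (ℤ × Pos N) × (ℤ × Pos N)) : Fock N :=
  if q.2.1 = q.1.1 + r * p s then
    ∑ x : Pos N, ∑ y : Pos N, (((1 / N : ℝ) : ℂ) *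
      (if ∃ n : ℤ, q.1.2.1 + p (-s) = q.2.2.1 + N * n then
        conj (fieldPhase N (q.1.2.1 - 1) x.1) * fieldPhase N (q.2.2.1 - 1) y.1 else 0)) •
      normalPair (species r s x) q.1.1 (species r s y) q.2.1 v
  else 0

/-- On a window only finitely many momentum pairs act nontrivially, so the series converges. The
prefactors (2π/L)²(L/2π)²(a/L) combine to 1/N, and orthogonality of the transverse plane waves
collapses the two position sums to one. -/
theorem mem_density_domain_and_apply {a : ℝ} (ha : 0 < a) (hN : Odd N) (r s : ℤˣ) (p : ℤˣ → ℤ)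
    {v : Fock N} (hv : v ∈ finiteVectors N) :
    ∃ h : v ∈ (density a r s p).domain, density a r s p ⟨v, h⟩ = planeDensity r s p v := by
  classical
  have hN0 : N ≠ 0 := by
    rintro rfl
    simp at hN
  obtain ⟨M, hM⟩ := hv
  refine opSum_apply_of_hasSum (fun _ => mem_ofBounded_domain _ _) ?_
  set P : ℤ := r * p s with hP
  set K := Finset.Ico (-(M : ℤ)) (M - P) with hK
  set K' := K.map (Equiv.addRight P).toEmbedding with hK'
  let e := momentumEquiv hN r s
  rw [← (Equiv.prodCongr e e).hasSum_iff]
  have hterm : ∀ q : (ℤ × Pos N) × (ℤ × Pos N),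
      ((fun i => ofBounded
        (if ∃ n : ℤ, ∀ t : ℤˣ, i.1.1 t + p t = i.2.1 t + (if t = -s then N * n else 0) then
          (((2 * Real.pi / boxLength a N) ^ 2 : ℝ) : ℂ) • bilinear a r s i.1 i.2
        else 0) ⟨v, mem_ofBounded_domain _ _⟩) ∘ (Equiv.prodCongr e e)) q
      = densityTerm r s p v q := by
    intro q
    have hc := momentum_condition hN r s p q.1 q.2
    change (if ∃ n : ℤ, ∀ t : ℤˣ, (e q.1).1 t + p t
          = (e q.2).1 t + (if t = -s then N * n else 0) then
          (((2 * Real.pi / boxLength a N) ^ 2 : ℝ) : ℂ) • bilinear a r s (e q.1) (e q.2)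
        else 0) v = _
    unfold densityTerm
    by_cases h1 : q.2.1 = q.1.1 + P
    · rw [if_pos h1]
      by_cases h2 : ∃ n : ℤ, q.1.2.1 + p (-s) = q.2.2.1 + N * n
      · rw [if_pos (hc.2 ⟨h1, h2⟩), smul_apply, bilinear_eq ha hN0, smul_apply, smul_smul,
          sum_apply, Finset.smul_sum]
        refine Finset.sum_congr rfl fun x _ => ?_
        rw [sum_apply, Finset.smul_sum]
        refine Finset.sum_congr rfl fun y _ => ?_
        rw [if_pos h2, smul_apply, smul_smul]
        simp only [e, momentumEquiv_same, momentumEquiv_other, relabel_relabel]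
        congr 2
        rw [← Complex.ofReal_mul]
        congr 1
        have h3 : (N : ℝ) ≠ 0 := Nat.cast_ne_zero.2 hN0
        unfold boxLength
        have := Real.pi_ne_zero
        field_simp
      · rw [if_neg fun h => h2 (hc.1 h).2]
        symm
        refine Finset.sum_eq_zero fun x _ => Finset.sum_eq_zero fun y _ => ?_
        rw [if_neg h2, mul_zero, zero_smul]
    · rw [if_neg h1, if_neg fun h => h1 (hc.1 h).1]
      rfl
  have hzero : ∀ q : (ℤ × Pos N) × (ℤ × Pos N),
      q ∉ (K ×ˢ Finset.univ) ×ˢ (K' ×ˢ Finset.univ) →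
      densityTerm r s p v q = 0 := by
    intro q hq
    unfold densityTerm
    by_cases h1 : q.2.1 = q.1.1 + P
    · rw [if_pos h1]
      have h2 : q.1.1 ∉ K := by
        intro h3
        apply hq
        simp only [Finset.mem_product, Finset.mem_univ, and_true]
        exact ⟨h3, Finset.mem_map.2 ⟨q.1.1, h3, h1.symm⟩⟩
      refine Finset.sum_eq_zero fun x _ => Finset.sum_eq_zero fun y _ => ?_
      rw [hK, Finset.mem_Ico] at h2
      by_cases h3 : q.1.1 < -(M : ℤ)
      · rw [normalPair_eq_zero_of_lt hM h3, smul_zero]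
      · rw [normalPair_eq_zero_of_le hM (by omega), smul_zero]
    · rw [if_neg h1]
  have hval : planeDensity r s p v = ∑ q ∈ (K ×ˢ Finset.univ) ×ˢ (K' ×ˢ Finset.univ),
      densityTerm r s p v q := by
    have hN1 : (N : ℂ) ≠ 0 := Nat.cast_ne_zero.2 hN0
    rw [Finset.sum_product, Finset.sum_product]
    simp only [Finset.sum_product, densityTerm]
    have inner : ∀ k ∈ K, (∑ j : Pos N, ∑ l ∈ K', ∑ j' : Pos N,
        (if l = k + P then ∑ x : Pos N, ∑ y : Pos N, (((1 / N : ℝ) : ℂ) *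
            (if ∃ n : ℤ, j.1 + p (-s) = j'.1 + N * n then
              conj (fieldPhase N (j.1 - 1) x.1) * fieldPhase N (j'.1 - 1) y.1 else 0)) •
            normalPair (species r s x) k (species r s y) l v
        else 0))
        = ∑ x : Pos N, wave N (-(p (-s) * x.1)) •
            normalPair (species r s x) k (species r s x) (k + P) v := by
      intro k hk
      have hkP : k + P ∈ K' := Finset.mem_map.2 ⟨k, hk, rfl⟩
      have e1 : ∀ j : Pos N, (∑ l ∈ K', ∑ j' : Pos N,
        (if l = k + P then ∑ x : Pos N, ∑ y : Pos N, (((1 / N : ℝ) : ℂ) *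
            (if ∃ n : ℤ, j.1 + p (-s) = j'.1 + N * n then
              conj (fieldPhase N (j.1 - 1) x.1) * fieldPhase N (j'.1 - 1) y.1 else 0)) •
            normalPair (species r s x) k (species r s y) l v
        else 0))
        = ∑ j' : Pos N, ∑ x : Pos N, ∑ y : Pos N, (((1 / N : ℝ) : ℂ) *
            (if ∃ n : ℤ, j.1 + p (-s) = j'.1 + N * n then
              conj (fieldPhase N (j.1 - 1) x.1) * fieldPhase N (j'.1 - 1) y.1 else 0)) •
            normalPair (species r s x) k (species r s y) (k + P) v := by
        intro j
        rw [Finset.sum_comm]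
        refine Finset.sum_congr rfl fun j' _ => ?_
        rw [Finset.sum_ite_eq', if_pos hkP]
      rw [Finset.sum_congr rfl fun j _ => e1 j]
      have e2 : ∀ j : Pos N, ∑ j' : Pos N, ∑ x : Pos N, ∑ y : Pos N, (((1 / N : ℝ) : ℂ) *
            (if ∃ n : ℤ, j.1 + p (-s) = j'.1 + N * n then
              conj (fieldPhase N (j.1 - 1) x.1) * fieldPhase N (j'.1 - 1) y.1 else 0)) •
            normalPair (species r s x) k (species r s y) (k + P) v
          = ∑ x : Pos N, ∑ y : Pos N, (∑ j' : Pos N, (((1 / N : ℝ) : ℂ) *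
            (if ∃ n : ℤ, j.1 + p (-s) = j'.1 + N * n then
              conj (fieldPhase N (j.1 - 1) x.1) * fieldPhase N (j'.1 - 1) y.1 else 0))) •
            normalPair (species r s x) k (species r s y) (k + P) v := by
        intro j
        rw [Finset.sum_comm]
        refine Finset.sum_congr rfl fun x _ => ?_
        rw [Finset.sum_comm]
        exact Finset.sum_congr rfl fun y _ => (Finset.sum_smul).symm
      rw [Finset.sum_congr rfl fun j _ => e2 j, Finset.sum_comm]
      refine Finset.sum_congr rfl fun x _ => ?_
      rw [Finset.sum_comm]
      have e3 : ∀ y : Pos N, ∑ j : Pos N, (∑ j' : Pos N, (((1 / N : ℝ) : ℂ) *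
            (if ∃ n : ℤ, j.1 + p (-s) = j'.1 + N * n then
              conj (fieldPhase N (j.1 - 1) x.1) * fieldPhase N (j'.1 - 1) y.1 else 0))) •
            normalPair (species r s x) k (species r s y) (k + P) v
          = if x = y then wave N (-(p (-s) * x.1)) •
            normalPair (species r s x) k (species r s y) (k + P) v else 0 := by
        intro y
        rw [← Finset.sum_smul]
        simp only [← Finset.mul_sum]
        rw [sum_fieldPhase hN]
        split_ifs with hxy
        · congr 1
          push_cast
          field_simp
        · simp
      rw [Finset.sum_congr rfl fun y _ => e3 y, Finset.sum_ite_eq, if_pos (Finset.mem_univ _)]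
    rw [Finset.sum_congr rfl inner, Finset.sum_comm, planeDensity]
    refine Finset.sum_congr rfl fun x _ => ?_
    rw [← Finset.smul_sum, rho_eq_sum hM subset_rfl]
  rw [hval]
  refine (iff_of_eq (congrArg (fun f => HasSum f _) (funext hterm))).2 ?_
  exact hasSum_sum_of_ne_finset_zero hzero

-- The two series match term by term after k₁ and k₂ are exchanged and n is replaced by -n. The
-- identity is needed on the full natural domains, since adjoints are later tested against all of
-- them.
open Classical in
theorem density_formalAdjoint {a : ℝ} {r s : ℤˣ} {p : ℤˣ → ℤ} {u w : Fock N}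
    (hu : u ∈ (density a r s (-p)).domain) (hw : w ∈ (density a r s p).domain) :
    ⟪density a r s (-p) ⟨u, hu⟩, w⟫_ℂ = ⟪u, density a r s p ⟨w, hw⟩⟫_ℂ := by
  refine opSum_formalAdjoint (Equiv.prodComm _ _) (fun k _ _ => ?_) hu hw
  rw [ofBounded_apply, ofBounded_apply]
  have hc : (∃ n : ℤ, ∀ t : ℤˣ, k.2.1 t + (-p) t = k.1.1 t + (if t = -s then N * n else 0))
      ↔ ∃ n : ℤ, ∀ t : ℤˣ, k.1.1 t + p t = k.2.1 t + (if t = -s then N * n else 0) := by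
    constructor <;>
    · rintro ⟨n, hn⟩
      refine ⟨-n, fun t => ?_⟩
      have h := hn t
      rw [Pi.neg_apply] at *
      split_ifs at h ⊢ <;> linarith
  change ⟪(if ∃ n : ℤ, ∀ t : ℤˣ, k.2.1 t + (-p) t = k.1.1 t + (if t = -s then N * n else 0) then
      (((2 * Real.pi / boxLength a N) ^ 2 : ℝ) : ℂ) • bilinear a r s k.2 k.1 else 0) u, w⟫_ℂ = _
  by_cases h : ∃ n : ℤ, ∀ t : ℤˣ, k.1.1 t + p t = k.2.1 t + (if t = -s then N * n else 0)
  · rw [if_pos h, if_pos (hc.2 h), smul_apply, smul_apply, inner_smul_left, inner_smul_right,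
      Complex.conj_ofReal, bilinear_inner]
  · rw [if_neg h, if_neg (mt hc.1 h)]
    simp

theorem planeDensity_mem_finiteVectors {r s : ℤˣ} {p : ℤˣ → ℤ} {v : Fock N}
    (hv : v ∈ finiteVectors N) : planeDensity r s p v ∈ finiteVectors N :=
  Submodule.sum_mem _ fun _ _ => Submodule.smul_mem _ _ (rho_mem_finiteVectors hv)

theorem planeDensity_mem_graded {r s : ℤˣ} {p : ℤˣ → ℤ} {m : ℤ} {v : Fock N}
    (hv : v ∈ graded N m) : planeDensity r s p v ∈ graded N (m - 2 * (r * p s)) :=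
  Submodule.sum_mem _ fun _ _ => Submodule.smul_mem _ _ (rho_mem_graded hv)

theorem planeDensity_inner {r s : ℤˣ} {p : ℤˣ → ℤ} {u v : Fock N} (hu : u ∈ finiteVectors N)
    (hv : v ∈ finiteVectors N) :
    ⟪planeDensity r s p u, v⟫_ℂ = ⟪u, planeDensity r s (-p) v⟫_ℂ := by
  unfold planeDensity
  rw [sum_inner, inner_sum]
  refine Finset.sum_congr rfl fun x _ => ?_
  rw [inner_smul_left, inner_smul_right, rho_inner hu hv, conj_wave]
  simp

theorem card_pos (hN : Odd N) : Fintype.card (Pos N) = N := by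
  have h := sum_wave hN (d := 0) (by simpa using hN.pos)
  simp only [mul_zero, wave_zero, Finset.sum_const, if_true] at h
  rw [nsmul_one, Finset.card_univ] at h
  exact_mod_cast h

theorem norm_planeDensity_le (hN : Odd N) {r s : ℤˣ} {p : ℤˣ → ℤ} {m : ℤ} {v : Fock N}
    (hv : v ∈ graded N m) :
    ‖planeDensity r s p v‖ ≤ N * (√(m + 2 * |p s|) * ‖v‖) := by
  have h : ∀ x : Pos N, ‖wave N (-(p (-s) * x.1)) • rho (species r s x) (r * p s) v‖
      ≤ √(m + 2 * |p s|) * ‖v‖ := by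
    intro x
    rw [norm_smul, norm_wave, one_mul]
    have h1 := norm_rho_sq_le (A := species r s x) (p := r * p s) hv
    have h2 : |((r * p s : ℤ) : ℝ)| = |(p s : ℝ)| := by
      rcases Int.units_eq_one_or r with rfl | rfl <;> simp
    rw [Int.cast_abs, h2] at h1
    push_cast
    have h3 := Real.sqrt_le_sqrt h1
    rw [Real.sqrt_sq (norm_nonneg _), Real.sqrt_mul' _ (by positivity),
      Real.sqrt_sq (norm_nonneg _)] at h3
    exact h3
  refine (norm_sum_le _ _).trans ((Finset.sum_le_sum fun x _ => h x).trans (le_of_eq ?_))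
  rw [Finset.sum_const, Finset.card_univ, card_pos hN, nsmul_eq_mul]

/-! ### The free Hamiltonian -/

theorem mem_freeHamiltonian_domain {v a : ℝ} (ha : 0 < a) (hN : Odd N) {w : Fock N}
    (hw : w ∈ finiteVectors N) : w ∈ (freeHamiltonian v a N).domain := by
  have hN0 : N ≠ 0 := by
    rintro rfl
    simp at hN
  obtain ⟨M, hM⟩ := hw
  refine ⟨fun _ => mem_ofBounded_domain _ _, ?_⟩
  refine summable_of_hasFiniteSupport ?_
  have hfin : (⋃ rs : ℤˣ × ℤˣ, (fun q => (⟨rs, momentumEquiv hN rs.1 rs.2 q⟩ :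
      Σ rs : ℤˣ × ℤˣ, FermiMomentum N rs.2)) ''
      ((Finset.Ico (-(M : ℤ)) M ×ˢ Finset.univ : Finset (ℤ × Pos N)) : Set (ℤ × Pos N))).Finite :=
    Set.finite_iUnion fun rs => (Finset.finite_toSet _).image _
  refine hfin.subset ?_
  rintro ⟨rs, κ⟩ hκ
  rw [Set.mem_iUnion]
  refine ⟨rs, (momentumEquiv hN rs.1 rs.2).symm κ, ?_, by simp⟩
  rw [Finset.mem_coe, Finset.mem_product]
  refine ⟨?_, Finset.mem_univ _⟩
  change relabel rs.1 (κ.1 rs.2) ∈ _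
  rw [Finset.mem_Ico]
  by_contra h
  have h' : relabel rs.1 (κ.1 rs.2) < -(M : ℤ) ∨ (M : ℤ) ≤ relabel rs.1 (κ.1 rs.2) := by omega
  apply hκ
  refine (ofBounded_apply _ _).trans ?_
  rw [smul_apply, bilinear_eq_zero ha hN0 hM h', smul_zero]

theorem freeHamiltonian_symm {v a : ℝ} {u w : Fock N}
    (hu : u ∈ (freeHamiltonian v a N).domain) (hw : w ∈ (freeHamiltonian v a N).domain) :
    ⟪freeHamiltonian v a N ⟨u, hu⟩, w⟫_ℂ = ⟪u, freeHamiltonian v a N ⟨w, hw⟩⟫_ℂ := by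
  unfold freeHamiltonian
  rw [LinearPMap.smul_apply, LinearPMap.smul_apply, inner_smul_left, inner_smul_right,
    Complex.conj_ofReal]
  congr 1
  refine opSum_symm (fun i _ _ => ?_) hu hw
  rw [ofBounded_apply, ofBounded_apply, smul_apply, smul_apply, inner_smul_left, inner_smul_right,
    Complex.conj_ofReal, bilinear_inner]

/-- Every term removes and adds a fermion of the same longitudinal momentum. The free part therefore
lies in the diagonal blocks, on which Carleman's criterion imposes no bound. -/
theorem freeHamiltonian_mem_graded {v a : ℝ} (ha : 0 < a) (hN : Odd N) {m : ℤ} {w : Fock N}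
    (hw : w ∈ (freeHamiltonian v a N).domain) (hm : w ∈ graded N m) :
    freeHamiltonian v a N ⟨w, hw⟩ ∈ graded N m := by
  have hN0 : N ≠ 0 := by
    rintro rfl
    simp at hN
  refine Submodule.smul_mem _ _ (opSum_mem_supportedOn (fun i _ => ?_) hw)
  rw [ofBounded_apply, smul_apply]
  refine Submodule.smul_mem _ _ ?_
  have h := bilinear_mem_graded ha hN0 (r := i.1.1) (k₁ := i.2) (k₂ := i.2) hm
  rw [sub_self, mul_zero, add_zero] at h
  exact h

end Mattis

open scoped InnerProductSpace lp ComplexConjugate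

namespace Mattis

variable {N : ℕ}

/-! ### Klein states -/

theorem signedPerm_apply {ι : Type*} (σ : Equiv.Perm ι) (ε : ι → ℤˣ) (f : ℓ²(ι, ℂ)) (i : ι) :
    signedPerm σ ε f i = ((ε (σ.symm i) : ℤ) : ℂ) * f (σ.symm i) := rfl

theorem signedPerm_single {ι : Type*} [DecidableEq ι] (σ : Equiv.Perm ι) (ε : ι → ℤˣ) (i : ι)
    (c : ℂ) : signedPerm σ ε (lp.single 2 i c) = lp.single 2 (σ i) (((ε i : ℤ) : ℂ) * c) := by
  ext j
  rw [signedPerm_apply, lp.single_apply, lp.single_apply]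
  by_cases h : j = σ i
  · subst h
    rw [Equiv.symm_apply_apply, Pi.single_eq_same, Pi.single_eq_same]
  · rw [Pi.single_eq_of_ne h, Pi.single_eq_of_ne, mul_zero]
    rintro h'
    exact h (by rw [← h', Equiv.apply_symm_apply])

/-- `S` is the set of excitations of the ground state in which the Fermi level of every species
`A` is shifted to `ν A`. -/
def IsGround (S : Finset (Mode N)) (ν : Species N → ℤ) : Prop :=
  ∀ A n, mode A n ∈ S ↔ (0 ≤ n ↔ n < ν A)

theorem IsGround.unique {S T : Finset (Mode N)} {ν : Species N → ℤ} (hS : IsGround S ν)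
    (hT : IsGround T ν) : S = T := by
  ext m
  exact (hS (ofLex m).1 (ofLex m).2).trans (hT (ofLex m).1 (ofLex m).2).symm

theorem mode_inj {A B : Species N} {n l : ℤ} : mode A n = mode B l ↔ A = B ∧ n = l :=
  ⟨fun h => ⟨congrArg (fun m : Mode N => (ofLex m).1) h,
    congrArg (fun m : Mode N => (ofLex m).2) h⟩, fun h => by rw [h.1, h.2]⟩

theorem shiftMode_same (A : Species N) (n : ℤ) : shiftMode A (mode A n) = mode A (n + 1) :=
  if_pos rfl

theorem shiftMode_of_ne {A B : Species N} (h : B ≠ A) (n : ℤ) :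
    shiftMode A (mode B n) = mode B n := if_neg h

theorem shiftMode_symm_same (A : Species N) (n : ℤ) :
    (shiftMode A).symm (mode A n) = mode A (n - 1) := if_pos rfl

theorem shiftMode_symm_of_ne {A B : Species N} (h : B ≠ A) (n : ℤ) :
    (shiftMode A).symm (mode B n) = mode B n := if_neg h

theorem mem_kleinPerm {A : Species N} {S : Finset (Mode N)} {m : Mode N} :
    m ∈ kleinPerm A S ↔ ((shiftMode A).symm m ∈ S ↔ m ≠ mode A 0) := by
  change m ∈ symmDiff (S.map (shiftMode A).toEmbedding) {mode A 0} ↔ _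
  rw [Finset.mem_symmDiff, Finset.mem_map_equiv, Finset.mem_singleton]
  tauto

theorem mem_kleinPerm_symm {A : Species N} {S : Finset (Mode N)} {m : Mode N} :
    m ∈ (kleinPerm A).symm S ↔ (shiftMode A m ∈ S ↔ shiftMode A m ≠ mode A 0) := by
  change m ∈ (symmDiff S {mode A 0}).map (shiftMode A).symm.toEmbedding ↔ _
  rw [Finset.mem_map_equiv, Finset.mem_symmDiff, Finset.mem_singleton, Equiv.symm_symm]
  tauto

theorem IsGround.kleinPerm {A : Species N} {S : Finset (Mode N)} {ν : Species N → ℤ}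
    (hS : IsGround S ν) : IsGround (kleinPerm A S) (ν + Pi.single A 1) := by
  intro B n
  rw [mem_kleinPerm]
  by_cases h : B = A
  · subst h
    rw [shiftMode_symm_same, hS, Ne, mode_inj, Pi.add_apply, Pi.single_eq_same]
    simp only [true_and]
    omega
  · rw [shiftMode_symm_of_ne h, hS, Ne, mode_inj, Pi.add_apply, Pi.single_eq_of_ne h, add_zero]
    simp [h]

theorem IsGround.kleinPerm_symm {A : Species N} {S : Finset (Mode N)} {ν : Species N → ℤ}
    (hS : IsGround S ν) : IsGround ((Mattis.kleinPerm A).symm S) (ν - Pi.single A 1) := by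
  intro B n
  rw [mem_kleinPerm_symm]
  by_cases h : B = A
  · subst h
    rw [shiftMode_same, hS, Ne, mode_inj, Pi.sub_apply, Pi.single_eq_same]
    simp only [true_and]
    omega
  · rw [shiftMode_of_ne h, hS, Ne, mode_inj, Pi.sub_apply, Pi.single_eq_of_ne h, sub_zero]
    simp [h]

/-- A nonzero multiple of the basis vector of a shifted ground state. -/
def IsGroundState (v : Fock N) (ν : Species N → ℤ) : Prop :=
  ∃ S : Finset (Mode N), ∃ c : ℂ, c ≠ 0 ∧ v = lp.single 2 S c ∧ IsGround S ν

theorem IsGroundState.klein {A : Species N} {v : Fock N} {ν : Species N → ℤ}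
    (hv : IsGroundState v ν) : IsGroundState (klein A v) (ν + Pi.single A 1) := by
  obtain ⟨S, c, hc, rfl, hS⟩ := hv
  refine ⟨_, _, ?_, signedPerm_single _ _ _ _, hS.kleinPerm⟩
  rcases Int.units_eq_one_or (kleinSign A S) with h | h <;> simp [h, hc]

theorem IsGroundState.klein_inv {A : Species N} {v : Fock N} {ν : Species N → ℤ}
    (hv : IsGroundState v ν) : IsGroundState ((Mattis.klein A)⁻¹ v) (ν - Pi.single A 1) := by
  obtain ⟨S, c, hc, rfl, hS⟩ := hv
  obtain ⟨T, rfl⟩ := (Mattis.kleinPerm A).surjective S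
  have hT := hS.kleinPerm_symm (A := A)
  rw [Equiv.symm_apply_apply] at hT
  refine ⟨T, ((kleinSign A T : ℤ) : ℂ) * c, ?_, ?_, hT⟩
  · rcases Int.units_eq_one_or (kleinSign A T) with h | h <;> simp [h, hc]
  · change (Mattis.klein A).symm _ = _
    rw [LinearIsometryEquiv.symm_apply_eq, Mattis.klein, signedPerm_single, ← mul_assoc]
    rcases Int.units_eq_one_or (kleinSign A T) with h | h <;> simp [h]

theorem IsGroundState.klein_zpow {A : Species N} (k : ℤ) :
    ∀ {v : Fock N} {ν : Species N → ℤ}, IsGroundState v ν →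
      IsGroundState ((Mattis.klein A ^ k) v) (ν + Pi.single A k) := by
  induction k using Int.induction_on with
  | zero =>
    intro v ν hv
    simpa using hv
  | succ k ih =>
    intro v ν hv
    have h := ih (hv.klein (A := A))
    rw [add_assoc, ← Pi.single_add, add_comm 1] at h
    rw [zpow_add_one]
    exact h
  | pred k ih =>
    intro v ν hv
    have h := ih (hv.klein_inv (A := A))
    rw [sub_add_eq_add_sub, add_sub_assoc, ← Pi.single_sub] at h
    rw [zpow_sub_one]
    exact h

theorem isGroundState_vacuum : IsGroundState (vacuum N) 0 := by
  refine ⟨∅, 1, one_ne_zero, rfl, fun A n => ?_⟩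
  simp
  omega

theorem isGroundState_list (ν : Species N → ℤ) (l : List (ℤˣ × ℤˣ × Pos N)) :
    IsGroundState ((l.map fun i => klein (species i.1 i.2.1 i.2.2) ^
      ν (species i.1 i.2.1 i.2.2)).prod (vacuum N))
      (l.map fun i => Pi.single (species i.1 i.2.1 i.2.2) (ν (species i.1 i.2.1 i.2.2))).sum := by
  induction l with
  | nil => exact isGroundState_vacuum
  | cons i l ih =>
    rw [List.map_cons, List.map_cons, List.prod_cons, List.sum_cons, add_comm]
    exact ih.klein_zpow _

theorem isGroundState_kleinState (ν : Species N → ℤ) : IsGroundState (kleinState ν) ν := by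
  have h := isGroundState_list ν (Finset.univ : Finset (ℤˣ × ℤˣ × Pos N)).toList
  rw [Finset.sum_map_toList] at h
  refine (congrArg (IsGroundState (kleinState ν)) ?_).mp h
  funext B
  rw [Finset.sum_apply, Finset.sum_eq_single ((ofLex B).1, (ofLex (ofLex B).2).1,
    (ofLex (ofLex B).2).2)]
  · exact Pi.single_eq_same (M := fun _ : Species N => ℤ) B (ν B)
  · rintro ⟨r, s, x⟩ _ hne
    refine Pi.single_eq_of_ne ?_ _
    rintro rfl
    exact hne rfl
  · intro h
    exact (h (Finset.mem_univ _)).elim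

theorem kleinState_mem_finiteVectors (ν : Species N → ℤ) : kleinState ν ∈ finiteVectors N := by
  obtain ⟨S, c, -, h, -⟩ := isGroundState_kleinState ν
  rw [h]
  exact supportedOn_le_finiteVectors (Set.finite_singleton S)
    (single_mem_supportedOn (Set.mem_singleton S) c)

/-- Zero excess forces the occupied levels of each species to be an initial segment of the window,
i.e. a Fermi sea with shifted level. -/
theorem exists_isGround {M : ℕ} {S : Finset (Mode N)}
    (hS : ∀ m ∈ S, -(M : ℤ) ≤ (ofLex m).2 ∧ (ofLex m).2 < M)
    (h : ∀ A, excess A M S = 0) : ∃ ν, IsGround S ν := by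
  have h1 : ∀ (A : Species N) k, orbital A k ∈ S ↔ (0 ≤ k ↔ k < (occupied A M S).card - (M : ℤ)) := by
    intro A k
    have hcard : (occupied A M S).card ≤ 2 * M := by
      have h2 : occupied A M S ⊆ Finset.Ico (-(M : ℤ)) M := fun k hk =>
        Finset.mem_Ico.2 (mem_occupied.1 hk).1
      have h3 := Finset.card_le_card h2
      rw [Int.card_Ico] at h3
      omega
    by_cases hk : -(M : ℤ) ≤ k ∧ k < M
    · have h4 := mem_occupied_of_excess_eq_zero (h A) k
      rw [mem_occupied] at h4
      tauto
    · have h5 : orbital A k ∉ S := fun h6 => hk (orbital_mem_window.1 (hS _ h6))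
      simp only [h5, false_iff]
      omega
  -- The shift is the charge of the species; the factor r undoes the reflection of momenta in the
  -- relabelling.
  refine ⟨fun A => ((ofLex A).1 : ℤ) * ((occupied A M S).card - M), fun A n => ?_⟩
  have h2 := h1 A (relabel (ofLex A).1 n)
  rw [orbital, relabel_relabel] at h2
  refine h2.trans ?_
  change _ ↔ (0 ≤ n ↔ n < ((ofLex A).1 : ℤ) * ((occupied A M S).card - M))
  generalize (occupied A M S).card = c
  rcases Int.units_eq_one_or (ofLex A).1 with h3 | h3
  · simp only [h3]
    simp [relabel]
  · have : (-1 : ℤˣ) ≠ 1 := by decide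
    simp only [h3]
    simp only [relabel, if_neg this, Units.val_neg, Units.val_one]
    omega

/-! ### Bosons -/

/-- The sign of the component `p_s` of a boson momentum. -/
noncomputable def bosonSign (q : BosonMode N) : ℤˣ := if 0 < q.1.2 q.1.1 then 1 else -1

theorem bosonSign_mul_pos (q : BosonMode N) : 0 < (bosonSign q : ℤ) * q.1.2 q.1.1 := by
  have h := q.2.2
  unfold bosonSign
  split_ifs with h0
  · simpa using h0
  · simp
    omega

/-- Only the nonvanishing of the normalization matters below, because 𝓓 is a span. -/
theorem exists_boson_eq {a : ℝ} (ha : 0 < a) (hN : N ≠ 0) (q : BosonMode N) :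
    ∃ c : ℂ, c ≠ 0 ∧ boson a q = c • density a (bosonSign q) q.1.1 q.1.2 := by
  have hL : boxLength a N ≠ 0 := by
    unfold boxLength
    positivity
  have hq : (q.1.2 q.1.1 : ℝ) ≠ 0 := by exact_mod_cast q.2.2
  have hc : Complex.I / (boxLength a N : ℂ) *
    ((√(2 * Real.pi * a / |2 * Real.pi / boxLength a N * (q.1.2 q.1.1 : ℝ)|) : ℝ) : ℂ) ≠ 0 := by
    refine mul_ne_zero (div_ne_zero Complex.I_ne_zero (Complex.ofReal_ne_zero.2 hL)) ?_
    rw [Complex.ofReal_ne_zero]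
    have := Real.pi_pos
    have h1 : 0 < |2 * Real.pi / boxLength a N * (q.1.2 q.1.1 : ℝ)| :=
      abs_pos.2 (mul_ne_zero (div_ne_zero (by positivity) hL) hq)
    positivity
  by_cases h : 0 < q.1.2 q.1.1
  · refine ⟨_, neg_ne_zero.2 hc, ?_⟩
    rw [bosonSign, if_pos h]
    exact if_pos h
  · refine ⟨_, hc, ?_⟩
    rw [bosonSign, if_neg h]
    exact if_neg h

/-- The coefficient of the density in the boson annihilation operator. -/
noncomputable def bosonCoeff {a : ℝ} (ha : 0 < a) (hN : N ≠ 0) (q : BosonMode N) : ℂ :=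
  (exists_boson_eq ha hN q).choose

theorem bosonCoeff_ne_zero {a : ℝ} (ha : 0 < a) (hN : N ≠ 0) (q : BosonMode N) :
    bosonCoeff ha hN q ≠ 0 := (exists_boson_eq ha hN q).choose_spec.1

theorem boson_eq {a : ℝ} (ha : 0 < a) (hN : N ≠ 0) (q : BosonMode N) :
    boson a q = bosonCoeff ha hN q • density a (bosonSign q) q.1.1 q.1.2 :=
  (exists_boson_eq ha hN q).choose_spec.2

/-- The boson is densely defined, so its adjoint at `v` is determined by its pairings with the whole
domain; `density_formalAdjoint` supplies them, with the density at -p as the candidate. -/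
theorem bosonDag_apply {a : ℝ} (ha : 0 < a) (hN : Odd N) (q : BosonMode N) {v : Fock N}
    (hv : v ∈ finiteVectors N) :
    opApply (bosonDag a q) v = conj (bosonCoeff ha hN.pos.ne' q) •
      planeDensity (bosonSign q) q.1.1 (-q.1.2) v := by
  obtain ⟨h1, h2⟩ := mem_density_domain_and_apply ha hN (bosonSign q) q.1.1 (-q.1.2) hv
  have hadj : ∀ u : (bosonCoeff ha hN.pos.ne' q • density a (bosonSign q) q.1.1 q.1.2).domain,
      ⟪conj (bosonCoeff ha hN.pos.ne' q) • planeDensity (bosonSign q) q.1.1 (-q.1.2) v,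
        (u : Fock N)⟫_ℂ
      = ⟪v, (bosonCoeff ha hN.pos.ne' q • density a (bosonSign q) q.1.1 q.1.2) u⟫_ℂ := by
    rintro ⟨u, hu⟩
    rw [LinearPMap.smul_apply, inner_smul_left, inner_smul_right, Complex.conj_conj, ← h2]
    congr 1
    exact density_formalAdjoint h1 hu
  rw [← boson_eq] at hadj
  have hdense : Dense ((boson a q).domain : Set (Fock N)) := by
    refine dense_finiteVectors.mono fun u hu => ?_
    rw [boson_eq ha hN.pos.ne']
    exact (mem_density_domain_and_apply ha hN _ _ _ hu).choose
  have hdom : v ∈ (bosonDag a q).domain :=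
    LinearPMap.mem_adjoint_domain_of_exists _ ⟨_, hadj⟩
  rw [opApply, dif_pos hdom]
  exact LinearPMap.adjoint_apply_eq hdense _ hadj

end Mattis

open scoped InnerProductSpace lp ComplexConjugate

namespace Mattis

/-! ### Products of commuting operators and finite-dimensional energy layers. -/

/-- In a product of powers of commuting elements, one exponent may be raised. -/
theorem prod_pow_add_single {M ι : Type*} [Monoid M] (f : ι → M)
    (hf : ∀ i j, Commute (f i) (f j)) (n : ι →₀ ℕ) (i : ι) :
    ((n + Finsupp.single i 1).support.toList.map fun j => f j ^ (n + Finsupp.single i 1 : ι →₀ ℕ) j).prod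
      = f i * (n.support.toList.map fun j => f j ^ n j).prod := by
  classical
  -- The list order of a support is arbitrary, so the product is computed in the commutative
  -- submonoid generated by the factors, where it does not depend on the order.
  have hcomm : IsMulCommutative (Submonoid.closure (Set.range f)) :=
    Submonoid.isMulCommutative_closure M (by
      rintro _ ⟨i, rfl⟩ _ ⟨j, rfl⟩
      exact hf i j)
  let _ : CommMonoid (Submonoid.closure (Set.range f)) :=
    { Submonoid.toMonoid (Submonoid.closure (Set.range f)) with
      mul_comm := hcomm.is_comm.comm }
  let g : ι → Submonoid.closure (Set.range f) := fun j => ⟨f j, Submonoid.subset_closure ⟨j, rfl⟩⟩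
  have h1 : ∀ n : ι →₀ ℕ, (n.support.toList.map fun j => f j ^ n j).prod
      = ((n.prod fun j k => g j ^ k : Submonoid.closure (Set.range f)) : M) := by
    intro n
    have h2 : (n.prod fun j k => g j ^ k) = (n.support.toList.map fun j => g j ^ n j).prod :=
      (Finset.prod_map_toList _ _).symm
    rw [h2]
    refine Eq.trans ?_ (map_list_prod (Submonoid.subtype (Submonoid.closure (Set.range f))) _).symm
    rw [List.map_map]
    rfl
  rw [h1, h1, Finsupp.prod_add_index' (fun _ => pow_zero _) fun _ _ _ => pow_add _ _ _,
    Finsupp.prod_single_index (h := fun j k => g j ^ k) (pow_zero _), pow_one, mul_comm]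
  rfl

variable {N : ℕ}

theorem finiteDimensional_supportedOn {ι : Type*} {P : Set ι} (hP : P.Finite) :
    FiniteDimensional ℂ (supportedOn P) := by
  have := hP.to_subtype
  let f : supportedOn P →ₗ[ℂ] (P → ℂ) :=
    { toFun := fun v i => (v : ℓ²(ι, ℂ)) i
      map_add' := fun _ _ => rfl
      map_smul' := fun _ _ => rfl }
  refine Module.Finite.of_injective f ((injective_iff_map_eq_zero f).2 fun v hv => ?_)
  apply Subtype.ext
  ext i
  by_contra hi
  exact hi (congrFun hv ⟨i, v.2 i hi⟩)

theorem finiteDimensional_graded (m : ℕ) : FiniteDimensional ℂ (graded N (m : ℤ)) :=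
  finiteDimensional_supportedOn ((finite_weight_le m).subset fun S hS => by
    have h : (weight S : ℤ) = m := hS
    exact (Int.ofNat_le.1 h.le))

/-! ### The boson creation operators on vectors with finitely many nonzero coordinates -/

/-- The one-dimensional density as a linear map. -/
noncomputable def rhoLin (A : Species N) (p : ℤ) : Module.End ℂ (finiteVectors N) where
  toFun v := ⟨rho A p v, rho_mem_finiteVectors v.2⟩
  map_add' := by
    rintro ⟨u, M, hu⟩ ⟨v, M', hv⟩
    apply Subtype.ext
    have hu' := window_mono (le_max_left M M') hu
    have hv' := window_mono (le_max_right M M') hv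
    change rho A p (u + v) = rho A p u + rho A p v
    rw [rho_eq_sum hu' subset_rfl, rho_eq_sum hv' subset_rfl, rho_eq_sum (add_mem hu' hv') subset_rfl,
      ← Finset.sum_add_distrib]
    exact Finset.sum_congr rfl fun _ _ => map_add _ _ _
  map_smul' := by
    rintro c ⟨v, M, hv⟩
    apply Subtype.ext
    change rho A p (c • v) = c • rho A p v
    rw [rho_eq_sum hv subset_rfl, rho_eq_sum (Submodule.smul_mem _ c hv) subset_rfl,
      Finset.smul_sum]
    exact Finset.sum_congr rfl fun _ _ => map_smul _ _ _

/-- The density as a linear map. -/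
noncomputable def planeDensityLin (r s : ℤˣ) (p : ℤˣ → ℤ) : Module.End ℂ (finiteVectors N) :=
  ∑ x : Pos N, wave N (-(p (-s) * x.1)) • rhoLin (species r s x) (r * p s)

theorem planeDensityLin_apply (r s : ℤˣ) (p : ℤˣ → ℤ) (v : finiteVectors N) :
    (planeDensityLin r s p v : Fock N) = planeDensity r s p v := by
  unfold planeDensityLin planeDensity
  rw [LinearMap.sum_apply, Submodule.coe_sum]
  rfl

theorem planeDensityLin_commute {r s r' s' : ℤˣ} {p p' : ℤˣ → ℤ} (h : r * p s < 0)
    (h' : r' * p' s' < 0) :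
    Commute (planeDensityLin (N := N) r s p) (planeDensityLin r' s' p') := by
  refine Commute.sum_left _ _ _ fun x _ => Commute.sum_right _ _ _ fun y _ => ?_
  refine Commute.smul_left (Commute.smul_right ?_ _) _
  refine LinearMap.ext fun v => Subtype.ext ?_
  have h1 := rho_neg_comm (A := species r s x) (B := species r' s' y) (neg_pos.2 h) (neg_pos.2 h') v.2
  rw [neg_neg, neg_neg] at h1
  exact h1

/-- The boson creation operator as a linear map. -/
noncomputable def raise {a : ℝ} (ha : 0 < a) (hN : Odd N) (q : BosonMode N) : Module.End ℂ (finiteVectors N) :=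
  conj (bosonCoeff ha hN.pos.ne' q) • planeDensityLin (bosonSign q) q.1.1 (-q.1.2)

theorem raise_apply {a : ℝ} (ha : 0 < a) (hN : Odd N) (q : BosonMode N) (v : finiteVectors N) :
    (raise ha hN q v : Fock N) = opApply (bosonDag a q) v := by
  rw [bosonDag_apply ha hN q v.2, raise, LinearMap.smul_apply, Submodule.coe_smul,
    planeDensityLin_apply]

theorem raise_commute {a : ℝ} (ha : 0 < a) (hN : Odd N) (q q' : BosonMode N) : Commute (raise ha hN q) (raise ha hN q') := by
  refine Commute.smul_left (Commute.smul_right (planeDensityLin_commute ?_ ?_) _) _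
  · have := bosonSign_mul_pos q
    rw [Pi.neg_apply]
    linarith
  · have := bosonSign_mul_pos q'
    rw [Pi.neg_apply]
    linarith

/-- The product of creation operators. -/
noncomputable def raiseProd {a : ℝ} (ha : 0 < a) (hN : Odd N) (n : BosonMode N →₀ ℕ) : Module.End ℂ (finiteVectors N) :=
  (n.support.toList.map fun q => raise ha hN q ^ n q).prod

/-- Replaces iterates of partially defined adjoints by powers of endomorphisms, collecting the
factorials in one nonzero constant. -/
theorem exists_basisState_eq {a : ℝ} (ha : 0 < a) (hN : Odd N) (n : BosonMode N →₀ ℕ) (ν : Species N → ℤ) :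
    ∃ c : ℂ, c ≠ 0 ∧ basisState a n ν
      = c • (raiseProd ha hN n ⟨kleinState ν, kleinState_mem_finiteVectors ν⟩ : Fock N) := by
  unfold basisState raiseProd
  generalize n.support.toList = l
  induction l with
  | nil => exact ⟨1, one_ne_zero, (one_smul _ _).symm⟩
  | cons q l ih =>
    obtain ⟨c, hc, h⟩ := ih
    refine ⟨((1 / √((n q).factorial : ℝ) : ℝ) : ℂ) * c, mul_ne_zero ?_ hc, ?_⟩
    · rw [Complex.ofReal_ne_zero]
      have : (0 : ℝ) < (n q).factorial := by exact_mod_cast Nat.factorial_pos _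
      positivity
    · have hiter : ∀ (k : ℕ) (w : finiteVectors N), (opApply (bosonDag a q))^[k] (w : Fock N)
          = ((raise ha hN q ^ k) w : finiteVectors N) := by
        intro k
        induction k with
        | zero => exact fun _ => rfl
        | succ k ih =>
          intro w
          rw [Function.iterate_succ_apply, ← raise_apply ha hN, ih, pow_succ]
          rfl
      rw [List.foldr_cons, h, List.map_cons, List.prod_cons, mul_smul, ← Submodule.coe_smul, hiter,
        map_smul]
      rfl

theorem raiseProd_mem_domain {a : ℝ} (ha : 0 < a) (hN : Odd N) (n : BosonMode N →₀ ℕ) (ν : Species N → ℤ) :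
    (raiseProd ha hN n ⟨kleinState ν, kleinState_mem_finiteVectors ν⟩ : Fock N) ∈ domain a N := by
  obtain ⟨c, hc, h⟩ := exists_basisState_eq ha hN n ν
  have h1 : basisState a n ν ∈ domain a N := Submodule.subset_span ⟨(n, ν), rfl⟩
  rw [h] at h1
  exact (Submodule.smul_mem_iff _ hc).1 h1

theorem domain_induction {a : ℝ} (ha : 0 < a) (hN : Odd N) {p : Fock N → Prop}
    (raiseProd : ∀ n ν, p (raiseProd ha hN n ⟨kleinState ν, kleinState_mem_finiteVectors ν⟩))
    (zero : p 0) (add : ∀ u v, p u → p v → p (u + v)) (smul : ∀ (c : ℂ) u, p u → p (c • u))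
    {u : Fock N} (hu : u ∈ domain a N) : p u := by
  refine Submodule.span_induction ?_ zero (fun u v _ _ => add u v) (fun c u _ => smul c u) hu
  rintro _ ⟨⟨n, ν⟩, rfl⟩
  obtain ⟨c, -, h⟩ := exists_basisState_eq ha hN n ν
  simp only [h]
  exact smul c _ (raiseProd n ν)

theorem domain_le_finiteVectors {a : ℝ} (ha : 0 < a) (hN : Odd N) : domain a N ≤ finiteVectors N := fun _ hu =>
  domain_induction ha hN (p := fun u => u ∈ finiteVectors N) (fun _ _ => Subtype.property _)
    (zero_mem _) (fun _ _ => add_mem) (fun c _ => Submodule.smul_mem _ c) hu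

theorem kleinState_mem_domain {a : ℝ} (ha : 0 < a) (hN : Odd N) (ν : Species N → ℤ) : kleinState ν ∈ domain a N := by
  have h := raiseProd_mem_domain ha hN 0 ν
  rw [raiseProd, Finsupp.support_zero, Finset.toList_empty] at h
  exact h

/-- Since the creation operators commute, one more of them merely raises an occupation number of a
spanning vector. -/
theorem raise_mem_domain {a : ℝ} (ha : 0 < a) (hN : Odd N) (q : BosonMode N) {v : finiteVectors N} (hv : (v : Fock N) ∈ domain a N) :
    (raise ha hN q v : Fock N) ∈ domain a N := by
  have h : ∃ hv : (v : Fock N) ∈ finiteVectors N, (raise ha hN q ⟨v, hv⟩ : Fock N) ∈ domain a N := by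
    refine domain_induction ha hN (p := fun u => ∃ hu : u ∈ finiteVectors N,
      (raise ha hN q ⟨u, hu⟩ : Fock N) ∈ domain a N) ?_ ?_ ?_ ?_ hv
    · intro n ν
      have h1 := raiseProd_mem_domain ha hN (n + Finsupp.single q 1) ν
      rw [raiseProd, prod_pow_add_single _ (raise_commute ha hN)] at h1
      exact ⟨Subtype.property _, h1⟩
    · refine ⟨zero_mem _, ?_⟩
      have h1 : raise ha hN q ⟨0, zero_mem _⟩ = 0 := map_zero _
      rw [h1]
      exact zero_mem _
    · rintro u w ⟨hu, hu'⟩ ⟨hw, hw'⟩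
      refine ⟨add_mem hu hw, ?_⟩
      have h1 := map_add (raise ha hN q) ⟨u, hu⟩ ⟨w, hw⟩
      rw [AddMemClass.mk_add_mk] at h1
      rw [h1]
      exact add_mem hu' hw'
    · rintro c u ⟨hu, hu'⟩
      refine ⟨Submodule.smul_mem _ c hu, ?_⟩
      have h1 := map_smul (raise ha hN q) c ⟨u, hu⟩
      rw [SetLike.mk_smul_mk] at h1
      rw [h1]
      exact Submodule.smul_mem _ c hu'
  exact h.choose_spec

/-- Homogeneity of the spanning vectors makes orthogonality to 𝓓 a question inside a single energy
layer. -/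
theorem exists_raiseProd_mem_graded {a : ℝ} (ha : 0 < a) (hN : Odd N) (n : BosonMode N →₀ ℕ)
    (ν : Species N → ℤ) : ∃ m, (raiseProd ha hN n ⟨kleinState ν, kleinState_mem_finiteVectors ν⟩ :
      Fock N) ∈ graded N m := by
  have hr : ∀ (q : BosonMode N) (k : ℕ) (v : finiteVectors N), (∃ m, (v : Fock N) ∈ graded N m) →
      ∃ m, ((raise ha hN q ^ k) v : Fock N) ∈ graded N m := by
    intro q k
    induction k with
    | zero => exact fun _ h => h
    | succ k ih =>
      rintro v ⟨m, hm⟩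
      rw [pow_succ]
      refine ih _ ⟨m - 2 * (bosonSign q * (-q.1.2) q.1.1), ?_⟩
      rw [raise, LinearMap.smul_apply, Submodule.coe_smul, planeDensityLin_apply]
      exact Submodule.smul_mem _ _ (planeDensity_mem_graded hm)
  unfold raiseProd
  generalize n.support.toList = l
  induction l with
  | nil =>
    obtain ⟨S, c, -, h, -⟩ := isGroundState_kleinState ν
    refine ⟨weight S, ?_⟩
    change kleinState ν ∈ _
    rw [h]
    exact single_mem_supportedOn (by rfl) c
  | cons q l ih =>
    rw [List.map_cons, List.prod_cons]
    exact hr q _ _ ih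

/-! ### Completeness of the boson states -/

/-- Fourier inversion in the transverse variable recovers the one-dimensional densities from the
planar ones; r * P enters because r² = 1. -/
theorem sum_wave_smul_planeDensity (hN : Odd N) (r s : ℤˣ) (x : Pos N) (P : ℤ) (v : Fock N) :
    ∑ j : Pos N, wave N (j.1 * x.1) • planeDensity r s (fun t => if t = s then r * P else j.1) v
      = (N : ℂ) • rho (species r s x) P v := by
  have h1 : ∀ j : Pos N,
      wave N (j.1 * x.1) • planeDensity r s (fun t => if t = s then r * P else j.1) v
      = ∑ y : Pos N, wave N (j.1 * (x.1 - y.1)) • rho (species r s y) P v := by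
    intro j
    have h2 : (r : ℤ) * (r * P) = P := by
      rcases Int.units_eq_one_or r with rfl | rfl <;> simp
    rw [planeDensity, Finset.smul_sum, if_pos rfl, if_neg (units_ne_neg s).symm, h2]
    refine Finset.sum_congr rfl fun y _ => ?_
    rw [smul_smul, ← wave_add]
    congr 2
    ring
  rw [Finset.sum_congr rfl fun j _ => h1 j, Finset.sum_comm]
  simp only [← Finset.sum_smul, sum_wave hN (abs_sub_lt_of_pos _ _)]
  rw [Finset.sum_eq_single x]
  · rw [if_pos (sub_self _)]
  · intro y _ hy
    rw [if_neg fun h => hy (Subtype.ext (sub_eq_zero.1 h).symm), zero_smul]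
  · exact fun h => (h (Finset.mem_univ _)).elim

/-- A vector that is annihilated by all bosons and orthogonal to all Klein states vanishes. -/
theorem eq_zero_of_bosons_eq_zero (hN : Odd N) {v : Fock N} (hv : v ∈ finiteVectors N)
    (hb : ∀ q : BosonMode N, planeDensity (bosonSign q) q.1.1 q.1.2 v = 0)
    (hk : ∀ ν, ⟪kleinState ν, v⟫_ℂ = 0) : v = 0 := by
  have hrho : ∀ (A : Species N) (P : ℤ), 0 < P → rho A P v = 0 := by
    intro A P hP
    set r := (ofLex A).1
    set s := (ofLex (ofLex A).2).1
    set x := (ofLex (ofLex A).2).2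
    have hA : A = species r s x := rfl
    have hN1 : (N : ℂ) ≠ 0 := Nat.cast_ne_zero.2 hN.pos.ne'
    have h1 := sum_wave_smul_planeDensity hN r s x P v
    rw [Finset.sum_eq_zero] at h1
    · rw [hA]
      exact (smul_eq_zero.1 h1.symm).resolve_left hN1
    intro j _
    -- Since P > 0, the longitudinal momentum r * P has sign r, so the annihilation operator of this
    -- boson mode uses precisely the density with index r.
    let q : BosonMode N := ⟨(s, fun t => if t = s then r * P else j.1), by
      refine ⟨?_, ?_⟩
      · change -(N : ℤ) ≤ 2 * (if -s = s then r * P else j.1) ∧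
          2 * (if -s = s then r * P else j.1) < N
        rw [if_neg (units_ne_neg s).symm]
        exact j.2
      · change (if s = s then r * P else j.1) ≠ 0
        rw [if_pos rfl]
        exact mul_ne_zero r.ne_zero hP.ne'⟩
    have hq : bosonSign q = r := by
      change (if 0 < (if s = s then r * P else j.1) then (1 : ℤˣ) else -1) = r
      rw [if_pos rfl]
      rcases Int.units_eq_one_or r with h | h
      · rw [h, if_pos (by simpa using hP)]
      · rw [h, if_neg (by simp; omega)]
    have h2 := hb q
    rw [hq] at h2
    rw [h2, smul_zero]
  obtain ⟨M, hM⟩ := hv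
  ext S
  by_contra hS
  -- By the Kronig identity every configuration in the support of v has zero excess in each species,
  -- so it is a shifted Fermi sea; orthogonality to the corresponding Klein state then kills its
  -- coefficient.
  obtain ⟨ν, hν⟩ := exists_isGround (hM S hS)
    fun A => excess_eq_zero_of_rho_eq_zero hM (hrho A) hS
  obtain ⟨T, c, hc, hT, hT'⟩ := isGroundState_kleinState ν
  have h := hk ν
  rw [hT, lp.inner_single_left, hT'.unique hν] at h
  have h' : v S * conj c = 0 := h
  exact (mul_ne_zero hS ((map_ne_zero _).2 hc)) h'

/-- Induction on the weight. The component v of a layer vector orthogonal to 𝓓 is killed by every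
boson: the lowered vector w is already in 𝓓, raising it stays in 𝓓, and pairing the result with v
gives ‖w‖² = 0. -/
theorem graded_le_domain {a : ℝ} (ha : 0 < a) (hN : Odd N) (m : ℕ) : graded N m ≤ domain a N := by
  induction m using Nat.strong_induction_on with
  | _ m ih =>
  have ih' : ∀ l : ℤ, l < m → graded N l ≤ domain a N := by
    intro l hl v hv
    by_cases h0 : 0 ≤ l
    · lift l to ℕ using h0
      exact ih l (by omega) hv
    · rw [graded_eq_bot (by omega) hv]
      exact zero_mem _
  have hfin : FiniteDimensional ℂ (graded N (m : ℤ)) := finiteDimensional_graded m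
  set K := domain a N ⊓ graded N m with hK
  have : FiniteDimensional ℂ K := Submodule.finiteDimensional_of_le inf_le_right
  intro u hu
  -- Projecting within one layer suffices: the spanning vectors of 𝓓 in other layers are orthogonal
  -- to v automatically. Finite dimension of K provides the projection.
  set v := u - K.starProjection u with hv
  have hv1 : v ∈ graded N m := sub_mem hu (inf_le_right (a := domain a N)
    (Submodule.starProjection_apply_mem K u))
  have hv2 : ∀ w ∈ domain a N, ⟪w, v⟫_ℂ = 0 := by
    intro w hw
    refine domain_induction ha hN (p := fun w => ⟪w, v⟫_ℂ = 0) ?_ (inner_zero_left _) ?_ ?_ hw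
    · intro n ν
      obtain ⟨l, hl⟩ := exists_raiseProd_mem_graded ha hN n ν
      by_cases hlm : l = m
      · subst hlm
        exact Submodule.inner_right_of_mem_orthogonal
          (Submodule.mem_inf.2 ⟨raiseProd_mem_domain ha hN n ν, hl⟩)
          (Submodule.sub_starProjection_mem_orthogonal u)
      · refine inner_eq_zero_of_supportedOn ?_ hl hv1
        rw [Set.disjoint_left]
        intro S h1 h2
        exact hlm (h1.symm.trans h2)
    · intro w w' h h'
      rw [inner_add_left, h, h', add_zero]
    · intro c w h
      rw [inner_smul_left, h, mul_zero]
  have hvf := graded_le_finiteVectors m hv1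
  have hv0 : v = 0 := by
    refine eq_zero_of_bosons_eq_zero hN hvf (fun q => ?_)
      fun ν => hv2 _ (kleinState_mem_domain ha hN ν)
    set w := planeDensity (bosonSign q) q.1.1 q.1.2 v
    have hw : w ∈ domain a N := by
      refine ih' _ ?_ (planeDensity_mem_graded hv1)
      have := bosonSign_mul_pos q
      omega
    have hwf : w ∈ finiteVectors N := planeDensity_mem_finiteVectors hvf
    have h1 := raise_mem_domain ha hN q (v := ⟨w, hwf⟩) hw
    rw [raise, LinearMap.smul_apply, Submodule.coe_smul, planeDensityLin_apply,
      Submodule.smul_mem_iff _ ((map_ne_zero _).2 (bosonCoeff_ne_zero ha _ q))] at h1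
    have h2 := hv2 _ h1
    rw [planeDensity_inner hwf hvf, neg_neg] at h2
    exact inner_self_eq_zero.1 h2
  rw [sub_eq_zero.1 hv0]
  exact inf_le_left (b := graded N m) (Submodule.starProjection_apply_mem K u)

theorem domain_eq_finiteVectors {a : ℝ} (ha : 0 < a) (hN : Odd N) :
    domain a N = finiteVectors N := by
  refine le_antisymm (domain_le_finiteVectors ha hN) ?_
  rintro v ⟨M, hM⟩
  have h : v ∈ supportedOn ((finite_window (N := N) M).toFinset : Set (Finset (Mode N))) := by
    rwa [Set.Finite.coe_toFinset]
  rw [← eq_restrict_of_supportedOn h, restrict]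
  refine Submodule.sum_mem _ fun S _ => graded_le_domain ha hN (weight S) ?_
  have h1 := single_mem_supportedOn (P := {T : Finset (Mode N) | (weight T : ℤ) = weight S}) (i := S)
    rfl (v S)
  convert h1
  rfl

end Mattis

open scoped InnerProductSpace lp ComplexConjugate

namespace Mattis

/-! ### Products of partially defined operators. -/

section OpComp

variable {F : Type*} [NormedAddCommGroup F] [InnerProductSpace ℂ F]

theorem opComp_apply_of_eq {S T : F →ₗ.[ℂ] F} {v x y : F} (hT : ∃ h : v ∈ T.domain, T ⟨v, h⟩ = x)
    (hS : ∃ h : x ∈ S.domain, S ⟨x, h⟩ = y) :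
    ∃ h : v ∈ (opComp S T).domain, opComp S T ⟨v, h⟩ = y := by
  obtain ⟨h, rfl⟩ := hT
  obtain ⟨h', rfl⟩ := hS
  exact ⟨⟨h, h'⟩, rfl⟩

theorem opComp_formalAdjoint {S T S' T' : F →ₗ.[ℂ] F}
    (h₁ : ∀ u (hu : u ∈ S.domain) w (hw : w ∈ T'.domain), ⟪S ⟨u, hu⟩, w⟫_ℂ = ⟪u, T' ⟨w, hw⟩⟫_ℂ)
    (h₂ : ∀ u (hu : u ∈ T.domain) w (hw : w ∈ S'.domain), ⟪T ⟨u, hu⟩, w⟫_ℂ = ⟪u, S' ⟨w, hw⟩⟫_ℂ)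
    {u w : F} (hu : u ∈ (opComp S T).domain) (hw : w ∈ (opComp S' T').domain) :
    ⟪opComp S T ⟨u, hu⟩, w⟫_ℂ = ⟪u, opComp S' T' ⟨w, hw⟩⟫_ℂ :=
  (h₁ _ hu.choose_spec w hw.choose).trans (h₂ u hu.choose _ hw.choose_spec)

end OpComp

variable {N : ℕ}

/-! ### The interaction -/

theorem coupling_symm (v a γ₁ γ₂ : ℝ) (r s r' s' : ℤˣ) :
    coupling v a γ₁ γ₂ r s r' s' = coupling v a γ₁ γ₂ r' s' r s := by
  have h1 : (s = s' ∧ r = -r') ↔ (s' = s ∧ r' = -r) :=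
    and_congr eq_comm ⟨fun h => by rw [h, neg_neg], fun h => by rw [h, neg_neg]⟩
  have h2 : s = -s' ↔ s' = -s := ⟨fun h => by rw [h, neg_neg], fun h => by rw [h, neg_neg]⟩
  unfold coupling
  simp only [h1, h2]

/-- The coefficients of the interaction. -/
noncomputable def interactionCoeff (v a γ₁ γ₂ : ℝ) (N : ℕ)
    (i : (ℤˣ × ℤˣ × ℤˣ × ℤˣ) × (ℤˣ → ℤ)) : ℝ :=
  (1 / boxLength a N) ^ 2 * coupling v a γ₁ γ₂ i.1.1 i.1.2.1 i.1.2.2.1 i.1.2.2.2 * cutoff N i.2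

/-- The term of the interaction on vectors with finitely many nonzero coordinates. -/
noncomputable def interactionTerm (i : (ℤˣ × ℤˣ × ℤˣ × ℤˣ) × (ℤˣ → ℤ)) (w : Fock N) : Fock N :=
  planeDensity i.1.1 i.1.2.1 (-i.2) (planeDensity i.1.2.2.1 i.1.2.2.2 i.2 w)

/-- The momenta below the cutoff. -/
noncomputable def cutoffMomenta (N : ℕ) : Finset (ℤˣ → ℤ) :=
  Fintype.piFinset fun _ => (Finset.Icc (-(N : ℤ)) N).filter fun k => |2 * k| ≤ N

theorem cutoff_eq_zero {p : ℤˣ → ℤ} (h : p ∉ cutoffMomenta N) : cutoff N p = 0 := by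
  refine if_neg fun h' => h (Fintype.mem_piFinset.2 fun t => ?_)
  have := h' t
  rw [Finset.mem_filter, Finset.mem_Icc, abs_le]
  omega

theorem two_mul_abs_le {p : ℤˣ → ℤ} (h : p ∈ cutoffMomenta N) (t : ℤˣ) : 2 * |p t| ≤ N := by
  have h1 := (Finset.mem_filter.1 (Fintype.mem_piFinset.1 h t)).2
  rwa [abs_mul, abs_two] at h1

/-- The cutoff makes all but finitely many coefficients zero. Membership in the domain still has to
be checked for every p; it holds because densities map finitely supported vectors to finitely
supported ones. -/
theorem interaction_apply {v a γ₁ γ₂ : ℝ} (ha : 0 < a) (hN : Odd N) {w : Fock N}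
    (hw : w ∈ finiteVectors N) :
    ∃ h : w ∈ (interaction v a γ₁ γ₂ N).domain, interaction v a γ₁ γ₂ N ⟨w, h⟩
      = ∑ i ∈ Finset.univ ×ˢ cutoffMomenta N,
        (interactionCoeff v a γ₁ γ₂ N i : ℂ) • interactionTerm i w := by
  have h : ∀ i : (ℤˣ × ℤˣ × ℤˣ × ℤˣ) × (ℤˣ → ℤ),
      ∃ h : w ∈ (opComp (density a i.1.1 i.1.2.1 (-i.2))
        (density a i.1.2.2.1 i.1.2.2.2 i.2)).domain,
      opComp (density a i.1.1 i.1.2.1 (-i.2)) (density a i.1.2.2.1 i.1.2.2.2 i.2) ⟨w, h⟩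
        = interactionTerm i w := fun i =>
    opComp_apply_of_eq (mem_density_domain_and_apply ha hN _ _ _ hw)
      (mem_density_domain_and_apply ha hN _ _ _ (planeDensity_mem_finiteVectors hw))
  choose h1 h2 using h
  refine opSum_apply_of_hasSum h1 ?_
  have h3 : ∀ i : (ℤˣ × ℤˣ × ℤˣ × ℤˣ) × (ℤˣ → ℤ), i ∉ Finset.univ ×ˢ cutoffMomenta N →
      (interactionCoeff v a γ₁ γ₂ N i : ℂ) • interactionTerm i w = 0 := by
    intro i hi
    rw [Finset.mem_product] at hi
    rw [interactionCoeff, cutoff_eq_zero fun h => hi ⟨Finset.mem_univ _, h⟩, mul_zero,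
      Complex.ofReal_zero, zero_smul]
  refine (iff_of_eq (congrArg (fun f => HasSum f _) (funext fun i => ?_))).2
    (hasSum_sum_of_ne_finset_zero h3)
  exact congrArg (fun x => (interactionCoeff v a γ₁ γ₂ N i : ℂ) • x) (h2 i)

/-- The adjoint of J_{r,s}(-p) J_{r',s'}(p) is formally J_{r',s'}(-p) J_{r,s}(p), the term with the
index pairs exchanged at the same p, and the coupling is symmetric under this exchange. -/
theorem interaction_symm {v a γ₁ γ₂ : ℝ} {u w : Fock N}
    (hu : u ∈ (interaction v a γ₁ γ₂ N).domain) (hw : w ∈ (interaction v a γ₁ γ₂ N).domain) :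
    ⟪interaction v a γ₁ γ₂ N ⟨u, hu⟩, w⟫_ℂ = ⟪u, interaction v a γ₁ γ₂ N ⟨w, hw⟩⟫_ℂ := by
  let e : ℤˣ × ℤˣ × ℤˣ × ℤˣ ≃ ℤˣ × ℤˣ × ℤˣ × ℤˣ :=
    { toFun := fun i => (i.2.2.1, i.2.2.2, i.1, i.2.1)
      invFun := fun i => (i.2.2.1, i.2.2.2, i.1, i.2.1)
      left_inv := fun _ => rfl
      right_inv := fun _ => rfl }
  refine opSum_formalAdjoint (e.prodCongr (Equiv.refl _)) ?_ hu hw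
  rintro ⟨⟨r, s, r', s'⟩, p⟩ hu hw
  rw [LinearPMap.smul_apply, LinearPMap.smul_apply, inner_smul_left, inner_smul_right,
    Complex.conj_ofReal]
  refine congrArg₂ (· * ·) ?_ (opComp_formalAdjoint ?_ ?_ hu hw)
  · rw [coupling_symm]
    rfl
  · exact fun u hu w hw => density_formalAdjoint hu hw
  · intro u hu w hw
    rw [← inner_conj_symm]
    exact (congrArg conj (density_formalAdjoint hw hu).symm).trans (inner_conj_symm _ _)

theorem interactionTerm_mem_graded (i : (ℤˣ × ℤˣ × ℤˣ × ℤˣ) × (ℤˣ → ℤ)) {m : ℤ} {w : Fock N}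
    (hw : w ∈ graded N m) : interactionTerm i w ∈ graded N
      (m - 2 * (i.1.2.2.1 * i.2 i.1.2.2.2) - 2 * (i.1.1 * (-i.2) i.1.2.1)) :=
  planeDensity_mem_graded (planeDensity_mem_graded hw)

theorem abs_units_mul (r : ℤˣ) (k : ℤ) : |(r : ℤ) * k| = |k| := by
  rcases Int.units_eq_one_or r with rfl | rfl <;> simp

/-- Each density costs a factor N from its position sum and a square root of at most m + 2N, which
allows for the weight gained from the first density. The two roots multiply to a linear bound. -/
theorem norm_interactionTerm_le (hN : Odd N) {i : (ℤˣ × ℤˣ × ℤˣ × ℤˣ) × (ℤˣ → ℤ)}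
    (hi : i.2 ∈ cutoffMomenta N) {m : ℕ} {w : Fock N} (hw : w ∈ graded N m) :
    ‖interactionTerm i w‖ ≤ N ^ 2 * (2 * N + 1) * (m + 1) * ‖w‖ := by
  obtain ⟨⟨r, s, r', s'⟩, p⟩ := i
  have h1 := norm_planeDensity_le hN (r := r') (s := s') (p := p) hw
  have h2 := norm_planeDensity_le hN (r := r) (s := s) (p := -p)
    (planeDensity_mem_graded (r := r') (s := s') (p := p) hw)
  have hs : 2 * |p s| ≤ (N : ℤ) := two_mul_abs_le hi s
  have hs' : 2 * |p s'| ≤ (N : ℤ) := two_mul_abs_le hi s'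
  have e1 : (((m : ℤ) : ℝ) + 2 * |p s'|) ≤ m + 2 * N := by
    have : (m : ℤ) + 2 * |p s'| ≤ m + 2 * N := by omega
    exact_mod_cast this
  have e2 : (((m - 2 * (r' * p s') : ℤ) : ℝ) + 2 * |(-p) s|) ≤ m + 2 * N := by
    have h3 := neg_abs_le ((r' : ℤ) * p s')
    rw [abs_units_mul] at h3
    have : (m - 2 * (r' * p s') : ℤ) + 2 * |(-p) s| ≤ m + 2 * N := by
      rw [Pi.neg_apply, abs_neg]
      linarith
    exact_mod_cast this
  have e3 : √((m : ℝ) + 2 * N) * √((m : ℝ) + 2 * N) = m + 2 * N :=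
    Real.mul_self_sqrt (by positivity)
  calc ‖interactionTerm ((r, s, r', s'), p) w‖
      ≤ N * (√((m : ℝ) + 2 * N) * (N * (√((m : ℝ) + 2 * N) * ‖w‖))) := by
        refine h2.trans ?_
        gcongr
        refine h1.trans ?_
        gcongr
    _ = N ^ 2 * (√((m : ℝ) + 2 * N) * √((m : ℝ) + 2 * N)) * ‖w‖ := by ring
    _ ≤ N ^ 2 * ((2 * N + 1) * (m + 1)) * ‖w‖ := by
        rw [e3]
        gcongr
        have : (0 : ℝ) ≤ N * m := by positivity
        linarith
    _ = _ := by ring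

/-! ### Essential self-adjointness -/

theorem finiteVectors_le_hamiltonian_domain {v a γ₁ γ₂ : ℝ} (ha : 0 < a) (hN : Odd N) :
    finiteVectors N ≤ (hamiltonian v a γ₁ γ₂ N).domain := fun _ hw =>
  ⟨mem_freeHamiltonian_domain ha hN hw, (interaction_apply ha hN hw).choose⟩

theorem hamiltonian_apply {v a γ₁ γ₂ : ℝ} {w : Fock N} (hw : w ∈ (hamiltonian v a γ₁ γ₂ N).domain) :
    hamiltonian v a γ₁ γ₂ N ⟨w, hw⟩
      = freeHamiltonian v a N ⟨w, hw.1⟩ + interaction v a γ₁ γ₂ N ⟨w, hw.2⟩ := rfl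

theorem graded_eq (m : ℕ) : supportedOn {S : Finset (Mode N) | weight S = m} = graded N m := by
  unfold graded
  simp only [Nat.cast_inj]

theorem hamiltonian_isEssentiallySelfAdjointOn (v γ₁ γ₂ : ℝ) {a : ℝ} (ha : 0 < a) (hN : Odd N) :
    IsEssentiallySelfAdjointOn (hamiltonian v a γ₁ γ₂ N) (finiteVectors N) := by
  set G := ∑ i ∈ Finset.univ ×ˢ cutoffMomenta N, |interactionCoeff v a γ₁ γ₂ N i| with hG
  have hG0 : 0 ≤ G := Finset.sum_nonneg fun _ _ => abs_nonneg _
  -- The band width 2N comes from two densities, each shifting the weight by 2|p_s| ≤ N below the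
  -- cutoff; C is the total coupling strength times the constant of `norm_interactionTerm_le`.
  refine isEssentiallySelfAdjointOn_of_band (w := weight) finite_weight_le
    (hamiltonian v a γ₁ γ₂ N) (finiteVectors N) (fun _ => supportedOn_le_finiteVectors)
    (finiteVectors_le_hamiltonian_domain ha hN) ?_
    (C := G * (N ^ 2 * (2 * N + 1))) (by positivity) (2 * N) ?_ ?_
  · intro u hu w hw
    rw [hamiltonian_apply, hamiltonian_apply, inner_add_left, inner_add_right,
      freeHamiltonian_symm, interaction_symm]
  · intro m w hw hm
    rw [graded_eq] at hm
    rw [hamiltonian_apply, (interaction_apply ha hN hw).choose_spec]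
    refine add_mem (supportedOn_mono ?_ (freeHamiltonian_mem_graded ha hN _ hm))
      (Submodule.sum_mem _ fun i hi => Submodule.smul_mem _ _
        (supportedOn_mono ?_ (interactionTerm_mem_graded i hm)))
    · intro S hS
      have hS' : (weight S : ℤ) = m := hS
      change weight S ≤ m + 2 * N
      omega
    · intro S hS
      have hS' : (weight S : ℤ)
        = m - 2 * (i.1.2.2.1 * i.2 i.1.2.2.2) - 2 * (i.1.1 * (-i.2) i.1.2.1) := hS
      have hp := (Finset.mem_product.1 hi).2
      have h1 := two_mul_abs_le hp i.1.2.2.2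
      have h2 := two_mul_abs_le hp i.1.2.1
      have h3 := neg_abs_le ((i.1.2.2.1 : ℤ) * i.2 i.1.2.2.2)
      have h4 := neg_abs_le ((i.1.1 : ℤ) * (-i.2) i.1.2.1)
      rw [abs_units_mul] at h3 h4
      rw [Pi.neg_apply, abs_neg] at h4
      rw [Pi.neg_apply] at hS'
      change weight S ≤ m + 2 * N
      omega
  · intro m m' hmm w hw hm u hu
    rw [graded_eq] at hm hu
    have h0 : ⟪u, freeHamiltonian v a N ⟨w, mem_freeHamiltonian_domain ha hN hw⟩⟫_ℂ = 0 := by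
      refine inner_eq_zero_of_supportedOn ?_ hu (freeHamiltonian_mem_graded ha hN _ hm)
      rw [Set.disjoint_left]
      intro S h1 h2
      exact hmm (Int.ofNat_inj.1 (h2.symm.trans h1))
    rw [hamiltonian_apply, (interaction_apply ha hN hw).choose_spec, inner_add_right, h0, zero_add]
    refine (norm_inner_le_norm _ _).trans ?_
    have h1 : ‖∑ i ∈ Finset.univ ×ˢ cutoffMomenta N,
        (interactionCoeff v a γ₁ γ₂ N i : ℂ) • interactionTerm i w‖
        ≤ G * (N ^ 2 * (2 * N + 1) * (m + 1) * ‖w‖) := by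
      rw [hG, Finset.sum_mul]
      refine norm_sum_le_of_le _ fun i hi => ?_
      rw [norm_smul, Complex.norm_real, Real.norm_eq_abs]
      exact mul_le_mul_of_nonneg_left
        (norm_interactionTerm_le hN (Finset.mem_product.1 hi).2 hm) (abs_nonneg _)
    refine (mul_le_mul_of_nonneg_left h1 (norm_nonneg u)).trans (le_of_eq ?_)
    ring

end Mattis

theorem corollary2p1 (v a γ₁ γ₂ : ℝ) (N : ℕ) (hv : 0 < v) (ha : 0 < a) (hN : Odd N)
    (hγ₁ : |γ₁| < 1) (hγ₂ : |γ₂| < |1 + γ₁|) :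
    Mattis.IsEssentiallySelfAdjointOn (Mattis.hamiltonian v a γ₁ γ₂ N) (Mattis.domain a N) := by
  rw [Mattis.domain_eq_finiteVectors ha hN]
  exact Mattis.hamiltonian_isEssentiallySelfAdjointOn v γ₁ γ₂ ha hN
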